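/- Let $\alpha>0$ and let $\partial_t^\alpha$ be the Riemann–Liouville derivative with lower limit $0$: $\partial_t^\alpha=\partial_t^n$ if $\alpha=n\in\mathbb N$, and $\partial_t^\alpha u(t)=\frac1{\Gamma(n-\alpha)}\frac{d^n}{dt^n}\int_0^t\frac{u(s)}{(t-s)^{\alpha-n+1}}\,ds$ if $n-1<\alpha<n$, $n\in\mathbb N$. For $\omega>0$, $t>0$ consider $$\partial_t^\alpha u(\omega,t)=u_{\omega\omega}(\omega,t)+\bar c(\omega)\,u_\omega(\omega,t).\qquad(*)$$ A solution $u$ of $(*)$ is called invariant under $V=\xi\partial_\omega+\tau\partial_t+\eta\partial_u$ if $\xi u_\omega+\tau u_t-\eta=0$. Let $s,\lambda_2,\lambda_3\in\mathbb R$ and $X_1=u\partial_u$. Consider two cases. (A) $\bar c(\omega)=\dfrac{\ln\omega+\lambda_2}{\omega(\ln\omega+\lambda_2-2)}$, $g(\omega)=\ln\omega+\lambda_2-2$, $\mu=0$, and $V=V_1=(s+\tfrac12)X_1+X_2$ with $X_2=\omega\partial_\omega+\frac2\alpha t\partial_t-\frac{\ln\omega+\lambda_2}{2(\ln\omega+\lambda_2-2)}u\partial_u$.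 (B) $\bar c(\omega)=\dfrac{(\lambda_2+1)(\lambda_3\omega^{\lambda_2}-\lambda_2+1)}{\omega(\lambda_3\omega^{\lambda_2}+\lambda_2+1)}$ with $\lambda_2\ne-1$, $g(\omega)=\lambda_3\omega^{\lambda_2}+\lambda_2+1$, $\mu=\lambda_2$, and $V=V_2=(s+\tfrac{1-\lambda_2}2)X_1+X_3$ with $X_3=\omega\partial_\omega+\frac2\alpha t\partial_t-\frac{(\lambda_2+1)(\lambda_3\omega^{\lambda_2}-\lambda_2+1)}{2(\lambda_3\omega^{\lambda_2}+\lambda_2+1)}u\partial_u$. In both cases the following holds at all $\omega>0$, $t>0$ with $g(\omega)\neq0$. 1. (Reduction.) Let $z=\omega^{-2/\alpha}t$ and $u(\omega,t)=\omega^s\varphi(z)/g(\omega)$. If $\varphi$ is differentiable at $z$, then $u$ satisfies the invariant surface condition of $V$ at $(\omega,t)$; and $u$ satisfies $(*)$ at $(\omega,t)$ (with all derivatives existing) if and only if at $z$ (with all derivatives existing) $$\frac{d^\alpha}{dz^\alpha}\varphi=s(s-\mu)\varphi+\frac2\alpha\Big(\frac2\alpha-2s+\mu\Big)z\varphi'+\frac4{\alpha^2}z^2\varphi''.$$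 2. If $0<\alpha<2$ and $c_1\in\mathbb R$, then $$u(\omega,t)=\frac{c_1\omega^s}{g(\omega)}H^{2,0}_{1,2}\left[\frac{\omega^2}{4t^\alpha}\,\Big|\begin{matrix}(1,\alpha)\\(-\frac s2,1),(-\frac s2+\frac\mu2,1)\end{matrix}\right]$$ is a real-valued solution of $(*)$ invariant under $V$. Here, for $x>0$, the Fox function $H^{2,0}_{1,2}\left[x\,\big|\begin{smallmatrix}(1,\alpha)\\(b_1,1),(b_2,1)\end{smallmatrix}\right]$ is the integral $\frac1{2\pi i}\int_{\gamma-i\infty}^{\gamma+i\infty}\frac{\Gamma(b_1-\zeta)\Gamma(b_2-\zeta)}{\Gamma(1-\alpha\zeta)}x^\zeta d\zeta$ along any line with real $\gamma<\min(b_1,b_2)$; it converges absolutely. 3. If $\alpha\ge2$, $n\in\mathbb N$, $n-1<\alpha\le n$, $c_1,\dots,c_n\in\mathbb R$, and for every $k$ with $c_k\ne0$ neither $1-\frac k\alpha-\frac s2$ nor $1-\frac k\alpha-\frac s2+\frac\mu2$ is a non-positive integer, then $$u(\omega,t)=\frac{\omega^{s-2}t^\alpha}{g(\omega)}\sum_{k=1}^n\frac{c_k\omega^{2k/\alpha}}{t^k}\,{}_3\Psi_1\left[\frac{4t^\alpha}{\omega^2}\,\Big|\begin{matrix}(1-\frac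 k\alpha-\frac s2,1),(1-\frac k\alpha-\frac s2+\frac\mu2,1),(1,1)\\(1+\alpha-k,\alpha)\end{matrix}\right]$$ is a real-valued solution of $(*)$ invariant under $V$, on all of $t>0$ if $\alpha>2$ and on $0<t<\omega$ if $\alpha=2$. Here ${}_3\Psi_1\left[x\,\big|\begin{smallmatrix}(a_1,1),(a_2,1),(1,1)\\(b,\alpha)\end{smallmatrix}\right]=\sum_{j\ge0}\frac{\Gamma(a_1+j)\Gamma(a_2+j)\Gamma(1+j)}{\Gamma(b+\alpha j)}\frac{x^j}{j!}$ is the generalized Wright function, and these series converge absolutely at the points in question. 4. ($\alpha=1$.) In case (A) with $s=-2$ the solution in 2 equals $\frac{c_1}{4(\ln\omega+\lambda_2-2)t}e^{-\omega^2/(4t)}$. In case (B) it equals $\frac{4^{\lambda_2/2-1}c_1t^{\lambda_2/2-1}}{\lambda_3\omega^{\lambda_2}+\lambda_2+1}e^{-\omega^2/(4t)}$ if $s=\lambda_2-2$, and $\frac{4^{-\lambda_2/2-1}c_1\omega^{\lambda_2}t^{-\lambda_2/2-1}}{\lambda_3\omega^{\lambda_2}+\lambda_2+1}e^{-\omega^2/(4t)}$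 if $s=-2$. 5. ($\alpha=2$, $0<t<\omega$.) Under the assumptions of 3 (with $n=2$) the solution in 3 equals $$\frac{c_1\Gamma(\frac12-\frac s2)\Gamma(\frac12-\frac s2+\frac\mu2)\omega^{s-1}t}{g(\omega)}\,{}_2F_1\Big(\tfrac12-\tfrac s2,\tfrac12-\tfrac s2+\tfrac\mu2;\tfrac32;\tfrac{t^2}{\omega^2}\Big)+\frac{c_2\Gamma(-\frac s2)\Gamma(-\frac s2+\frac\mu2)\omega^s}{g(\omega)}\,{}_2F_1\Big(-\tfrac s2,-\tfrac s2+\tfrac\mu2;\tfrac12;\tfrac{t^2}{\omega^2}\Big).$$ -/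

import Mathlib

open Complex MeasureTheory Topology

namespace FracDiffWave

noncomputable section

/-! ### Riemann-Liouville fractional derivative of order `α > 0` (lower limit `0`) -/

/-- The function whose `n`-th derivative, `n = ⌈α⌉`, is the Riemann-Liouville derivative of order
`α`: it is `f` itself if `α = n` is an integer, and
`τ ↦ 1 / Γ(n - α) * ∫₀^τ f(s) / (τ - s)^(α - n + 1) ds` otherwise. -/
def rlPrimitive (α : ℝ) (f : ℝ → ℂ) : ℝ → ℂ :=
  if α = (⌈α⌉₊ : ℝ) then f
  else fun τ => ((1 / Real.Gamma ((⌈α⌉₊ : ℝ) - α) : ℝ) : ℂ) *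
    ∫ s in (0 : ℝ)..τ, f s / (((τ - s) ^ (α - (⌈α⌉₊ : ℝ) + 1) : ℝ) : ℂ)

/-- The Riemann-Liouville derivative `∂ₜ^α f (t)`. -/
def rlDeriv (α : ℝ) (f : ℝ → ℂ) (t : ℝ) : ℂ :=
  iteratedDeriv ⌈α⌉₊ (rlPrimitive α f) t

/-- `∂ₜ^α f` genuinely exists at `t`: the integral in its definition converges near `t` (a condition
only for non-integer `α`), and the function to be differentiated is `C^n` at `t`. -/
def RLDifferentiableAt (α : ℝ) (f : ℝ → ℂ) (t : ℝ) : Prop :=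
  (α ≠ (⌈α⌉₊ : ℝ) → ∀ᶠ τ in 𝓝 t, IntervalIntegrable
    (fun s => f s / (((τ - s) ^ (α - (⌈α⌉₊ : ℝ) + 1) : ℝ) : ℂ)) volume 0 τ) ∧
  ContDiffAt ℝ (⌈α⌉₊ : ℕ) (rlPrimitive α f) t

/-! ### The equation, its reductions, infinitesimal generators and invariance -/

/-- `u` solves `∂ₜ^α u = u_ωω + c(ω) u_ω` at the point `(ω, t)`, all derivatives existing there. -/
def IsSolutionAt (α : ℝ) (c : ℝ → ℝ) (u : ℝ → ℝ → ℂ) (ω t : ℝ) : Prop :=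
  ContDiffAt ℝ 2 (fun y => u y t) ω ∧
  RLDifferentiableAt α (u ω) t ∧
  rlDeriv α (u ω) t =
    iteratedDeriv 2 (fun y => u y t) ω + (c ω : ℂ) * deriv (fun y => u y t) ω

/-- `φ` solves the Euler-type fractional ordinary differential equation
`d^α φ / dz^α = k₀ φ + k₁ z φ' + k₂ z² φ''` at `z`, all derivatives existing there. -/
def IsEulerSolutionAt (α k₀ k₁ k₂ : ℝ) (φ : ℝ → ℂ) (z : ℝ) : Prop :=
  ContDiffAt ℝ 2 φ z ∧
  RLDifferentiableAt α φ z ∧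
  rlDeriv α φ z =
    (k₀ : ℂ) * φ z + (k₁ : ℂ) * z * deriv φ z + (k₂ : ℂ) * (z : ℂ) ^ 2 * iteratedDeriv 2 φ z

/-- An infinitesimal generator `ξ ∂_ω + τ ∂_t + η ∂_u`, as the vector field
`(ω, t, u) ↦ (ξ, τ, η)`. -/
abbrev Generator := ℝ × ℝ × ℂ → ℝ × ℝ × ℂ

/-- `u` satisfies the invariant surface condition `ξ u_ω + τ u_t - η = 0` of the generator
`V = ξ ∂_ω + τ ∂_t + η ∂_u` at `(ω, t)`. -/
def IsInvariantAt (V : Generator) (u : ℝ → ℝ → ℂ) (ω t : ℝ) : Prop :=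
  DifferentiableAt ℝ (fun p : ℝ × ℝ => u p.1 p.2) (ω, t) ∧
  ((V (ω, t, u ω t)).1 : ℂ) * deriv (fun y => u y t) ω
    + ((V (ω, t, u ω t)).2.1 : ℂ) * deriv (u ω) t - (V (ω, t, u ω t)).2.2 = 0

/-- `u` is a real-valued solution at `(ω, t)` that is invariant under `V`. -/
def IsInvariantSolutionAt (α : ℝ) (c : ℝ → ℝ) (V : Generator) (u : ℝ → ℝ → ℂ) (ω t : ℝ) : Prop :=
  (u ω t).im = 0 ∧ IsSolutionAt α c u ω t ∧ IsInvariantAt V u ω t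

/-! ### Special functions -/

/-- The integrand (without the power of `z`) of the Mellin-Barnes integral for `H^{m,l}_{p,q}`.
Mathlib's `Gamma` is `0` at its poles, so that the quotient vanishes wherever a Gamma factor of the
denominator has a pole, as the entire function `1 / Γ` does. -/
def foxKernel (m l : ℕ) {p q : ℕ} (a A : Fin p → ℝ) (b B : Fin q → ℝ) (s : ℂ) : ℂ :=
  ((∏ j : Fin q with j.val < m, Complex.Gamma (b j - B j * s)) *
    (∏ i : Fin p with i.val < l, Complex.Gamma (1 - a i + A i * s))) /
  ((∏ i : Fin p with l ≤ i.val, Complex.Gamma (a i - A i * s)) *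
    (∏ j : Fin q with m ≤ j.val, Complex.Gamma (1 - b j + B j * s)))

/-- The line `Re s = γ` is a suitable contour: the poles of the `Γ(b_j - β_j s)`, `j ≤ m`, lie to
its right and those of the `Γ(1 - a_i + α_i s)`, `i ≤ l`, to its left. -/
def FoxAdmissible (m l : ℕ) {p q : ℕ} (a A : Fin p → ℝ) (b B : Fin q → ℝ) (γ : ℝ) : Prop :=
  (∀ j : Fin q, j.val < m → ∀ k : ℕ, B j * γ < b j + k) ∧
  (∀ i : Fin p, i.val < l → ∀ k : ℕ, a i - 1 - k < A i * γ)

/-- Absolute convergence of the Mellin-Barnes integral along `Re s = γ`. -/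
def FoxConverges (m l : ℕ) {p q : ℕ} (a A : Fin p → ℝ) (b B : Fin q → ℝ) (γ : ℝ) (z : ℂ) : Prop :=
  Integrable (fun y : ℝ => foxKernel m l a A b B (γ + y * I) * z ^ ((γ : ℂ) + y * I))

/-- The Fox H-function `H^{m,l}_{p,q}[z | (a_i, α_i); (b_j, β_j)]` (with `A = (α_i)`, `B = (β_j)`),
as the integral `1 / (2 π i) ∫_L … z^s ds` along the line `L` from `γ - i∞` to `γ + i∞`. -/
def foxH (m l : ℕ) {p q : ℕ} (a A : Fin p → ℝ) (b B : Fin q → ℝ) (γ : ℝ) (z : ℂ) : ℂ :=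
  1 / (2 * Real.pi * I) *
    ∫ y : ℝ, foxKernel m l a A b B (γ + y * I) * z ^ ((γ : ℂ) + y * I) * I

/-- The `k`-th term of the series of the generalized Wright function. -/
def wrightTerm {p q : ℕ} (a : Fin p → ℂ) (A : Fin p → ℝ) (b : Fin q → ℂ) (B : Fin q → ℝ) (z : ℂ)
    (k : ℕ) : ℂ :=
  (∏ i, Complex.Gamma (a i + A i * k)) / (∏ j, Complex.Gamma (b j + B j * k)) *
    (z ^ k / (k.factorial : ℂ))

/-- The generalized Wright function `ₚΨ_q[z | (a_i, α_i); (b_j, β_j)]`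
(with `A = (α_i)`, `B = (β_j)`). -/
def wright {p q : ℕ} (a : Fin p → ℂ) (A : Fin p → ℝ) (b : Fin q → ℂ) (B : Fin q → ℝ) (z : ℂ) : ℂ :=
  ∑' k : ℕ, wrightTerm a A b B z k

/-- `x` is not a pole of the Gamma function. -/
def NotGammaPole (x : ℝ) : Prop := ∀ m : ℕ, x ≠ -(m : ℝ)

/-! ### The two coefficient functions and their generators -/

/-- `X₁ = u ∂_u`. -/
def X₁ : Generator := fun p => (0, 0, p.2.2)

/-- `ln ω + μ - 2`. -/
def den₁ (μ ω : ℝ) : ℝ := Real.log ω + μ - 2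

/-- The logarithmic coefficient (`μ` is the parameter `λ₂`). -/
def coeff₁ (μ ω : ℝ) : ℝ := (Real.log ω + μ) / (ω * (Real.log ω + μ - 2))

/-- `X₂ = ω ∂_ω + (2/α) t ∂_t - (ln ω + μ) / (2 (ln ω + μ - 2)) u ∂_u`. -/
def X₂ (α μ : ℝ) : Generator := fun p =>
  (p.1, 2 / α * p.2.1,
    -(((Real.log p.1 + μ) / (2 * (Real.log p.1 + μ - 2)) : ℝ) : ℂ) * p.2.2)

/-- `V₁ = (s + 1/2) X₁ + X₂`. -/
def V₁ (α s μ : ℝ) : Generator := (s + 1 / 2) • X₁ + X₂ α μ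

/-- `ν ω^μ + μ + 1`. -/
def den₂ (μ ν ω : ℝ) : ℝ := ν * ω ^ μ + μ + 1

/-- The power-type coefficient (`μ`, `ν` are the parameters `λ₂`, `λ₃`). -/
def coeff₂ (μ ν ω : ℝ) : ℝ :=
  (μ + 1) * (ν * ω ^ μ - μ + 1) / (ω * (ν * ω ^ μ + μ + 1))

/-- `X₃ = ω ∂_ω + (2/α) t ∂_t - (μ + 1) (ν ω^μ - μ + 1) / (2 (ν ω^μ + μ + 1)) u ∂_u`. -/
def X₃ (α μ ν : ℝ) : Generator := fun p =>
  (p.1, 2 / α * p.2.1,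
    -(((μ + 1) * (ν * p.1 ^ μ - μ + 1) / (2 * (ν * p.1 ^ μ + μ + 1)) : ℝ) : ℂ) * p.2.2)

/-- `V₂ = (s + (1 - μ)/2) X₁ + X₃`. -/
def V₂ (α s μ ν : ℝ) : Generator := (s + (1 - μ) / 2) • X₁ + X₃ α μ ν

/-! ### The similarity form and the explicit solutions -/

/-- The similarity transformation `u(ω, t) = ω^s φ(ω^(-2/α) t) / g(ω)`. -/
def similarity (α s : ℝ) (g : ℝ → ℝ) (φ : ℝ → ℂ) (ω t : ℝ) : ℂ :=
  ((ω ^ s : ℝ) : ℂ) * φ (ω ^ (-2 / α) * t) / (g ω : ℂ)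

/-- `c₁ ω^s / (ln ω + μ - 2) * H^{2,0}_{1,2}[ω²/(4 t^α) | (1, α); (-s/2, 1), (-s/2, 1)]`. -/
def foxSol₁ (α s μ γ c₁ ω t : ℝ) : ℂ :=
  ((c₁ * ω ^ s / den₁ μ ω : ℝ) : ℂ) *
    foxH 2 0 ![1] ![α] ![-s / 2, -s / 2] ![1, 1] γ ((ω ^ 2 / (4 * t ^ α) : ℝ) : ℂ)

/-- `c₁ ω^s / (ν ω^μ + μ + 1) * H^{2,0}_{1,2}[ω²/(4 t^α) | (1, α); (-s/2, 1), (-s/2 + μ/2, 1)]`. -/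
def foxSol₂ (α s μ ν γ c₁ ω t : ℝ) : ℂ :=
  ((c₁ * ω ^ s / den₂ μ ν ω : ℝ) : ℂ) *
    foxH 2 0 ![1] ![α] ![-s / 2, -s / 2 + μ / 2] ![1, 1] γ ((ω ^ 2 / (4 * t ^ α) : ℝ) : ℂ)

/-- `ω^(s-2) t^α / (ln ω + μ - 2) * ∑_{k=1}^n c_k ω^(2k/α) t^(-k) *
₃Ψ₁[4 t^α / ω² | (1 - k/α - s/2, 1), (1 - k/α - s/2, 1), (1, 1); (1 + α - k, α)]`. -/
def wrightSol₁ (α s μ : ℝ) (n : ℕ) (c : ℕ → ℝ) (ω t : ℝ) : ℂ :=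
  ((ω ^ (s - 2) * t ^ α / den₁ μ ω : ℝ) : ℂ) *
    ∑ k ∈ Finset.Icc 1 n, ((c k * ω ^ (2 * k / α) / t ^ k : ℝ) : ℂ) *
      wright ![((1 - k / α - s / 2 : ℝ) : ℂ), ((1 - k / α - s / 2 : ℝ) : ℂ), 1] ![1, 1, 1]
        ![((1 + α - k : ℝ) : ℂ)] ![α] ((4 * t ^ α / ω ^ 2 : ℝ) : ℂ)

/-- `ω^(s-2) t^α / (ν ω^μ + μ + 1) * ∑_{k=1}^n c_k ω^(2k/α) t^(-k) *
₃Ψ₁[4 t^α / ω² | (1 - k/α - s/2, 1), (1 - k/α - s/2 + μ/2, 1), (1, 1); (1 + α - k, α)]`. -/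
def wrightSol₂ (α s μ ν : ℝ) (n : ℕ) (c : ℕ → ℝ) (ω t : ℝ) : ℂ :=
  ((ω ^ (s - 2) * t ^ α / den₂ μ ν ω : ℝ) : ℂ) *
    ∑ k ∈ Finset.Icc 1 n, ((c k * ω ^ (2 * k / α) / t ^ k : ℝ) : ℂ) *
      wright ![((1 - k / α - s / 2 : ℝ) : ℂ), ((1 - k / α - s / 2 + μ / 2 : ℝ) : ℂ), 1] ![1, 1, 1]
        ![((1 + α - k : ℝ) : ℂ)] ![α] ((4 * t ^ α / ω ^ 2 : ℝ) : ℂ)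

end

end FracDiffWave

open FracDiffWave

namespace FracDiffWave

/-! ### Scaling of the Riemann-Liouville derivative -/

/-! Both coefficients have the form c = (1-μ)/ω + 2g'/g with ωg'' = (μ-1)g', where this μ is 0 in
the logarithmic case. Hence 1/g is annihilated by ∂_ω² + c∂_ω, and u = w/g turns the equation into
∂_t^α w = w_ωω + ((1-μ)/ω) w_ω, which is homogeneous under (ω,t) ↦ (kω, k^(2/α) t). For w = ω^s
φ(ω^(-2/α) t) both sides of the equation for u carry the nonzero factor ω^(s-2)/g. Cancelling it
leaves the Euler-type equation (`isSolutionAt_similarity_iff`), and invariance is the chain rule.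

The Euler operator acts on powers: with b₁ = -s/2 and b₂ = -s/2 + μ/2 it multiplies z^p by 4(b₁ +
p/α)(b₂ + p/α), while the fractional derivative sends z^p/Γ(p+1) to z^(p-α)/Γ(p-α+1) if Re p > -1.
So a superposition ∫ a(x) z^p(x)/Γ(p(x)+1) is a solution once the shift p ↦ p-α reproduces that
polynomial. `SuperposGood.isEulerSolutionAt` establishes this for a general measure, and it is used
twice.

With Lebesgue measure and p = -αζ on a vertical line, the shift is ζ ↦ ζ+1. The functional equation
of the factors Γ(bᵢ-ζ) supplies the polynomial, and Cauchy's theorem moves the contour back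
(`isEulerSolutionAt_superpos_fox`). With counting measure and p = α(j+1)-k, the shift lowers j by
one, and the term j = 0 disappears because 1/Γ(1-k) = 0 (`isEulerSolutionAt_wrightProfile`).

The value α = 2 separates the regimes: the Mellin-Barnes kernel decays like exp(-π(1-α/2)|Im ζ|) up
to an arbitrarily small loss in the exponent, whereas the ratio of consecutive terms of the Wright
series tends to 0 for α > 2 and to t²/ω² for α = 2. For α = 1 a Gamma factor cancels and Mellin
inversion of exp(-x) remains; for α = 2 the duplication of Γ yields hypergeometric series. -/

theorem iteratedDeriv_comp_mul_left (f : ℝ → ℂ) (κ : ℝ) (n : ℕ) (x : ℝ) :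
    iteratedDeriv n (fun y => f (κ * y)) x = (κ : ℂ) ^ n * iteratedDeriv n f (κ * x) := by
  induction n generalizing x with
  | zero => simp
  | succ n ih =>
    -- No smoothness is needed: the rules for constant factors and for scaling the argument hold for
    -- `deriv` with its default value as well.
    rw [iteratedDeriv_succ, iteratedDeriv_succ, funext ih, deriv_const_mul_field,
      deriv_comp_mul_left κ (iteratedDeriv n f) x, real_smul]
    ring

theorem rlPrimitive_scale {α : ℝ} (C : ℂ) (f : ℝ → ℂ) {κ τ : ℝ} (hκ : 0 < κ) (hτ : 0 < τ) :
    rlPrimitive α (fun y => C * f (κ * y)) τ =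
      C * ((κ ^ (α - ⌈α⌉₊) : ℝ) : ℂ) * rlPrimitive α f (κ * τ) := by
  unfold rlPrimitive
  split_ifs with h
  · rw [← h, sub_self, Real.rpow_zero]; simp
  · have key : ∫ y in (0 : ℝ)..τ, C * f (κ * y) / (((τ - y) ^ (α - ⌈α⌉₊ + 1) : ℝ) : ℂ) =
        ∫ y in (0 : ℝ)..τ, (C * ((κ ^ (α - ⌈α⌉₊ + 1) : ℝ) : ℂ)) *
          (f (κ * y) / (((κ * τ - κ * y) ^ (α - ⌈α⌉₊ + 1) : ℝ) : ℂ)) := by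
      refine intervalIntegral.integral_congr fun y hy => ?_
      rw [Set.uIcc_of_le hτ.le] at hy
      have h0 : ((κ ^ (α - ⌈α⌉₊ + 1) : ℝ) : ℂ) ≠ 0 := by
        exact_mod_cast (Real.rpow_pos_of_pos hκ _).ne'
      rw [← mul_sub, Real.mul_rpow hκ.le (sub_nonneg.2 hy.2), ofReal_mul]
      field_simp
    beta_reduce
    rw [key, intervalIntegral.integral_const_mul, intervalIntegral.integral_comp_mul_left
      (fun y => f y / (((κ * τ - y) ^ (α - ⌈α⌉₊ + 1) : ℝ) : ℂ)) hκ.ne', mul_zero,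
      Real.rpow_add hκ, Real.rpow_one, real_smul]
    push_cast
    have : (κ : ℂ) ≠ 0 := by exact_mod_cast hκ.ne'
    field_simp

theorem rlIntegrable_scale {q : ℝ} {C : ℂ} (hC : C ≠ 0) (f : ℝ → ℂ) {κ τ : ℝ} (hκ : 0 < κ)
    (hτ : 0 < τ) :
    IntervalIntegrable (fun y => C * f (κ * y) / (((τ - y) ^ q : ℝ) : ℂ)) volume 0 τ ↔
      IntervalIntegrable (fun y => f y / (((κ * τ - y) ^ q : ℝ) : ℂ)) volume 0 (κ * τ) := by
  have h0 : ((κ ^ q : ℝ) : ℂ) ≠ 0 := by exact_mod_cast (Real.rpow_pos_of_pos hκ _).ne'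
  have h1 := IntervalIntegrable.comp_mul_left_iff
    (f := fun y => f y / (((κ * τ - y) ^ q : ℝ) : ℂ)) (a := 0) (b := κ * τ) (c := κ) hκ.ne'
  rw [zero_div, mul_div_cancel_left₀ _ hκ.ne'] at h1
  rw [← h1]
  have h2 : ∀ y ∈ Set.uIoc 0 τ, C * f (κ * y) / (((τ - y) ^ q : ℝ) : ℂ) =
      (C * ((κ ^ q : ℝ) : ℂ)) * (f (κ * y) / (((κ * τ - κ * y) ^ q : ℝ) : ℂ)) := by
    intro y hy
    rw [Set.uIoc_of_le hτ.le] at hy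
    rw [← mul_sub, Real.mul_rpow hκ.le (sub_nonneg.2 hy.2), ofReal_mul]
    field_simp
  rw [intervalIntegrable_congr h2]
  refine ⟨fun h => ?_, fun h => h.const_mul _⟩
  have := h.const_mul (C * ((κ ^ q : ℝ) : ℂ))⁻¹
  refine this.congr fun y _ => ?_
  field_simp

theorem eventually_pos_nhds {x : ℝ} (hx : 0 < x) : ∀ᶠ y in 𝓝 x, 0 < y := lt_mem_nhds hx

theorem eventually_mul_left_iff {κ : ℝ} (hκ : 0 < κ) {P : ℝ → Prop} {t : ℝ} :
    (∀ᶠ τ in 𝓝 t, P (κ * τ)) ↔ ∀ᶠ τ in 𝓝 (κ * t), P τ := by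
  have := (Homeomorph.mulLeft₀ κ hκ.ne').map_nhds_eq t
  rw [Homeomorph.coe_mulLeft₀] at this
  rw [← this, Filter.eventually_map]

theorem contDiffAt_comp_mul_left_iff {κ : ℝ} (hκ : κ ≠ 0) {f : ℝ → ℂ} {t : ℝ} {n : ℕ} :
    ContDiffAt ℝ n (fun τ => f (κ * τ)) t ↔ ContDiffAt ℝ n f (κ * t) := by
  refine ⟨fun h => ?_, fun h => h.comp t (contDiffAt_const.mul contDiffAt_id)⟩
  have h1 : ContDiffAt ℝ n (fun τ => f (κ * τ)) (κ⁻¹ * (κ * t)) := by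
    rwa [inv_mul_cancel_left₀ hκ]
  have := h1.comp (κ * t) (contDiffAt_const.mul contDiffAt_id)
  refine this.congr_of_eventuallyEq (Filter.Eventually.of_forall fun x => ?_)
  simp [hκ]

theorem rlPrimitive_scale_eventuallyEq {α : ℝ} (C : ℂ) (f : ℝ → ℂ) {κ t : ℝ} (hκ : 0 < κ)
    (ht : 0 < t) :
    rlPrimitive α (fun y => C * f (κ * y)) =ᶠ[𝓝 t] fun τ =>
      C * ((κ ^ (α - ⌈α⌉₊) : ℝ) : ℂ) * rlPrimitive α f (κ * τ) :=
  (eventually_pos_nhds ht).mono fun _ hτ => rlPrimitive_scale C f hκ hτ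

theorem rlDifferentiableAt_scale {α : ℝ} {C : ℂ} (hC : C ≠ 0) (f : ℝ → ℂ) {κ t : ℝ}
    (hκ : 0 < κ) (ht : 0 < t) :
    RLDifferentiableAt α (fun y => C * f (κ * y)) t ↔ RLDifferentiableAt α f (κ * t) := by
  have h0 : C * ((κ ^ (α - ⌈α⌉₊) : ℝ) : ℂ) ≠ 0 :=
    mul_ne_zero hC (by exact_mod_cast (Real.rpow_pos_of_pos hκ _).ne')
  unfold RLDifferentiableAt
  refine and_congr (imp_congr Iff.rfl ?_) ?_
  · rw [← eventually_mul_left_iff hκ]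
    exact Filter.eventually_congr
      ((eventually_pos_nhds ht).mono fun τ hτ => rlIntegrable_scale hC f hκ hτ)
  · have he := rlPrimitive_scale_eventuallyEq (α := α) C f hκ ht
    rw [← contDiffAt_comp_mul_left_iff hκ.ne']
    refine ⟨fun h => ?_, fun h => (contDiffAt_const.mul h).congr_of_eventuallyEq he⟩
    replace h := h.congr_of_eventuallyEq he.symm
    refine ((contDiffAt_const (c := (C * ((κ ^ (α - ⌈α⌉₊) : ℝ) : ℂ))⁻¹)).mul
      h).congr_of_eventuallyEq (Filter.Eventually.of_forall fun x => ?_)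
    simp only []
    rw [inv_mul_cancel_left₀ h0]

/-- Homogeneity of degree α: the fractional integral contributes κ^(α-⌈α⌉) and the ⌈α⌉ derivatives
contribute κ^⌈α⌉. -/
theorem rlDeriv_scale {α : ℝ} (C : ℂ) (f : ℝ → ℂ) {κ t : ℝ} (hκ : 0 < κ) (ht : 0 < t) :
    rlDeriv α (fun y => C * f (κ * y)) t = C * ((κ ^ α : ℝ) : ℂ) * rlDeriv α f (κ * t) := by
  unfold rlDeriv
  rw [(rlPrimitive_scale_eventuallyEq C f hκ ht).iteratedDeriv_eq, iteratedDeriv_const_mul_field,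
    iteratedDeriv_comp_mul_left, Real.rpow_sub hκ, Real.rpow_natCast]
  have : (κ : ℂ) ≠ 0 := by exact_mod_cast hκ.ne'
  push_cast
  field_simp

/-! ### The similarity reduction -/

theorem hasDerivAt_rpow_div {g : ℝ → ℝ} {g' s y : ℝ} (hy : 0 < y) (hg : HasDerivAt g g' y)
    (h0 : g y ≠ 0) :
    HasDerivAt (fun y => y ^ s / g y) (s * y ^ (s - 1) / g y - y ^ s * g' / g y ^ 2) y := by
  have := (Real.hasDerivAt_rpow_const (p := s) (Or.inl hy.ne')).div hg h0
  exact this.congr_deriv (by field_simp)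

theorem hasDerivAt_rpow_mul_const {p t y : ℝ} (hy : 0 < y) :
    HasDerivAt (fun y => y ^ p * t) (p * y ^ (p - 1) * t) y :=
  (Real.hasDerivAt_rpow_const (p := p) (Or.inl hy.ne')).mul_const t

theorem hasDerivAt_smul_comp {G k : ℝ → ℝ} {φ : ℝ → ℂ} {G' k' y : ℝ} {φ' : ℂ}
    (hG : HasDerivAt G G' y) (hk : HasDerivAt k k' y) (hφ : HasDerivAt φ φ' (k y)) :
    HasDerivAt (fun y => (G y : ℂ) * φ (k y)) (G' * φ (k y) + G y * (k' * φ')) y := by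
  have h1 := (HasDerivAt.scomp y hφ hk)
  have := (hG.ofReal_comp).mul h1
  rw [real_smul] at this
  exact this

theorem similarity_eq (α s : ℝ) (g : ℝ → ℝ) (φ : ℝ → ℂ) (y t : ℝ) :
    similarity α s g φ y t = ((y ^ s / g y : ℝ) : ℂ) * φ (y ^ (-2 / α) * t) := by
  unfold similarity; push_cast; ring

/-- The converse inverts y ↦ y^(-2/α) t on the positive axis and divides out the nonvanishing
prefactor. It makes the reduction an equivalence that includes existence of derivatives. -/
theorem contDiffAt_similarity_iff {α s ω t : ℝ} {g : ℝ → ℝ} {φ : ℝ → ℂ} (hα : 0 < α)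
    (hω : 0 < ω) (ht : 0 < t) (hg : ContDiffAt ℝ 2 g ω) (h0 : g ω ≠ 0) :
    ContDiffAt ℝ 2 (fun y => similarity α s g φ y t) ω ↔
      ContDiffAt ℝ 2 φ (ω ^ (-2 / α) * t) := by
  have hG : ContDiffAt ℝ 2 (fun y => y ^ s / g y) ω :=
    (Real.contDiffAt_rpow_const_of_ne hω.ne').div hg h0
  have hk : ContDiffAt ℝ 2 (fun y => y ^ (-2 / α) * t) ω :=
    (Real.contDiffAt_rpow_const_of_ne hω.ne').mul contDiffAt_const
  simp_rw [similarity_eq]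
  refine ⟨fun h => ?_, fun h => ?_⟩
  · set z := ω ^ (-2 / α) * t with hz
    have hz0 : 0 < z := mul_pos (Real.rpow_pos_of_pos hω _) ht
    have hr : ∀ y, 0 < y → (y ^ (-2 / α) * t / t) ^ (-α / 2) = y := by
      intro y hy
      rw [mul_div_cancel_right₀ _ ht.ne', ← Real.rpow_mul hy.le]
      have : -2 / α * (-α / 2) = 1 := by field_simp
      rw [this, Real.rpow_one]
    have hr' : ∀ w, 0 < w → ((w / t) ^ (-α / 2)) ^ (-2 / α) * t = w := by
      intro w hw
      rw [← Real.rpow_mul (div_pos hw ht).le]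
      have : -α / 2 * (-2 / α) = 1 := by field_simp
      rw [this, Real.rpow_one, div_mul_cancel₀ _ ht.ne']
    have hinv : ContDiffAt ℝ 2 (fun w : ℝ => (w / t) ^ (-α / 2)) z :=
      (contDiffAt_id.div_const t).rpow_const_of_ne (div_pos hz0 ht).ne'
    have hzr : (z / t) ^ (-α / 2) = ω := hr ω hω
    have hG' : ContDiffAt ℝ 2 (fun y => (((y ^ s / g y)⁻¹ : ℝ) : ℂ)) ω :=
      ofRealCLM.contDiff.contDiffAt.comp ω
        (hG.inv (div_ne_zero (Real.rpow_pos_of_pos hω s).ne' h0))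
    have h2 := hG'.mul h
    rw [← hzr] at h2
    have h3 := h2.comp z hinv
    refine h3.congr_of_eventuallyEq ?_
    have hgz : ∀ᶠ w in 𝓝 z, g ((w / t) ^ (-α / 2)) ≠ 0 := by
      have hc : ContinuousAt (fun w => g ((w / t) ^ (-α / 2))) z := by
        refine ContinuousAt.comp (g := g) ?_ hinv.continuousAt
        rw [hzr]; exact hg.continuousAt
      refine hc.eventually_ne ?_
      rwa [hzr]
    filter_upwards [eventually_pos_nhds hz0, hgz] with w hw hgw
    simp only [Function.comp_apply]
    rw [hr' w hw]
    have : ((((w / t) ^ (-α / 2)) ^ s / g ((w / t) ^ (-α / 2)) : ℝ) : ℂ) ≠ 0 := by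
      exact_mod_cast div_ne_zero (Real.rpow_pos_of_pos (Real.rpow_pos_of_pos (div_pos hw ht) _) _).ne' hgw
    rw [ofReal_inv, inv_mul_cancel_left₀ this]
  · exact (ofRealCLM.contDiff.contDiffAt.comp ω hG).mul
      (ContDiffAt.comp (g := φ) ω h hk)

theorem hasDerivAt_similarity_snd {α s ω t : ℝ} {g : ℝ → ℝ} {φ : ℝ → ℂ}
    (hφ : DifferentiableAt ℝ φ (ω ^ (-2 / α) * t)) :
    HasDerivAt (similarity α s g φ ω) (((ω ^ s / g ω : ℝ) : ℂ) *
      (((ω ^ (-2 / α) : ℝ) : ℂ) * deriv φ (ω ^ (-2 / α) * t))) t := by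
  have hk : HasDerivAt (fun τ : ℝ => ω ^ (-2 / α) * τ) (ω ^ (-2 / α)) t := by
    simpa using (hasDerivAt_id t).const_mul (ω ^ (-2 / α))
  have := hasDerivAt_smul_comp (hasDerivAt_const t (ω ^ s / g ω)) hk hφ.hasDerivAt
  rw [ofReal_zero, zero_mul, zero_add] at this
  exact this.congr_of_eventuallyEq (Filter.Eventually.of_forall fun τ => similarity_eq ..)

theorem hasDerivAt_similarity_fst {α s ω t g' : ℝ} {g : ℝ → ℝ} {φ : ℝ → ℂ} (hω : 0 < ω)
    (hg : HasDerivAt g g' ω) (h0 : g ω ≠ 0) (hφ : DifferentiableAt ℝ φ (ω ^ (-2 / α) * t)) :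
    HasDerivAt (fun y => similarity α s g φ y t)
      (((s * ω ^ (s - 1) / g ω - ω ^ s * g' / g ω ^ 2 : ℝ) : ℂ) * φ (ω ^ (-2 / α) * t) +
        ((ω ^ s / g ω : ℝ) : ℂ) * (((-2 / α * ω ^ (-2 / α - 1) * t : ℝ) : ℂ) *
          deriv φ (ω ^ (-2 / α) * t))) ω := by
  have := hasDerivAt_smul_comp (hasDerivAt_rpow_div (s := s) hω hg h0)
    (hasDerivAt_rpow_mul_const (p := -2 / α) (t := t) hω) hφ.hasDerivAt
  exact this.congr_of_eventuallyEq (Filter.Eventually.of_forall fun τ => similarity_eq ..)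

/-- The field ω∂_ω + (2/α)t∂_t annihilates z = ω^(-2/α) t, so it only sees the prefactor ω^s/g,
whose logarithmic derivative ω d/dω is s - ωg'/g. -/
theorem isInvariantAt_similarity {α s ω t g' : ℝ} {g : ℝ → ℝ} {φ : ℝ → ℂ} {V : Generator}
    (hω : 0 < ω) (hg : HasDerivAt g g' ω) (h0 : g ω ≠ 0)
    (hV : ∀ u : ℂ, V (ω, t, u) = (ω, 2 / α * t, ((s - ω * g' / g ω : ℝ) : ℂ) * u))
    (hφ : DifferentiableAt ℝ φ (ω ^ (-2 / α) * t)) :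
    IsInvariantAt V (similarity α s g φ) ω t := by
  refine ⟨?_, ?_⟩
  · have h1 : DifferentiableAt ℝ (fun p : ℝ × ℝ => p.1 ^ s / g p.1) (ω, t) :=
      (hasDerivAt_rpow_div (s := s) hω hg h0).differentiableAt.comp (ω, t)
        (f := Prod.fst) differentiableAt_fst
    have h2 : DifferentiableAt ℝ (fun p : ℝ × ℝ => p.1 ^ (-2 / α) * p.2) (ω, t) :=
      (((Real.hasDerivAt_rpow_const (p := -2 / α) (Or.inl hω.ne')).differentiableAt.comp (ω, t)
        (f := Prod.fst) differentiableAt_fst)).mul differentiableAt_snd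
    have h3 : DifferentiableAt ℝ (fun p : ℝ × ℝ => φ (p.1 ^ (-2 / α) * p.2)) (ω, t) :=
      DifferentiableAt.comp (g := φ) (ω, t) hφ h2
    have h4 : DifferentiableAt ℝ (fun p : ℝ × ℝ => ((p.1 ^ s / g p.1 : ℝ) : ℂ)) (ω, t) :=
      ofRealCLM.differentiableAt.comp (ω, t) h1
    exact (h4.mul h3).congr_of_eventuallyEq
      (Filter.Eventually.of_forall fun p => similarity_eq ..)
  · rw [(hasDerivAt_similarity_fst hω hg h0 hφ).deriv, (hasDerivAt_similarity_snd hφ).deriv, hV,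
      similarity_eq]
    simp only [Real.rpow_sub hω, Real.rpow_one]
    have h1 : (ω : ℂ) ≠ 0 := by exact_mod_cast hω.ne'
    have h2 : (g ω : ℂ) ≠ 0 := by exact_mod_cast h0
    push_cast
    field_simp
    ring

/-- For `u = ω^s φ(z) / g(ω)` with `ω g'' = (μ - 1) g'` and `c = (1 - μ) / ω + 2 g' / g`, the spatial
operator of the equation becomes the Euler operator. -/
theorem similarity_spatial {α s μ ω t g₂ cω : ℝ} {g g₁ : ℝ → ℝ} {φ : ℝ → ℂ} (hω : 0 < ω)
    (hg : ∀ᶠ y in 𝓝 ω, HasDerivAt g (g₁ y) y) (hg₁ : HasDerivAt g₁ g₂ ω)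
    (h0 : g ω ≠ 0) (hode : ω * g₂ = (μ - 1) * g₁ ω) (hc : cω = (1 - μ) / ω + 2 * g₁ ω / g ω)
    (hα : 0 < α) (hφ : ContDiffAt ℝ 2 φ (ω ^ (-2 / α) * t)) :
    iteratedDeriv 2 (fun y => similarity α s g φ y t) ω +
        (cω : ℂ) * deriv (fun y => similarity α s g φ y t) ω =
      ((ω ^ s / g ω / ω ^ 2 : ℝ) : ℂ) *
        (((s * (s - μ) : ℝ) : ℂ) * φ (ω ^ (-2 / α) * t) +
        ((2 / α * (2 / α - 2 * s + μ) : ℝ) : ℂ) * ((ω ^ (-2 / α) * t : ℝ) : ℂ) *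
          deriv φ (ω ^ (-2 / α) * t) +
        ((4 / α ^ 2 : ℝ) : ℂ) * ((ω ^ (-2 / α) * t : ℝ) : ℂ) ^ 2 *
          iteratedDeriv 2 φ (ω ^ (-2 / α) * t)) := by
  have hgω : HasDerivAt g (g₁ ω) ω := hg.self_of_nhds
  have hk : ContinuousAt (fun y => y ^ (-2 / α) * t) ω :=
    (hasDerivAt_rpow_mul_const hω).continuousAt
  have hφ1 : ∀ᶠ w in 𝓝 (ω ^ (-2 / α) * t), DifferentiableAt ℝ φ w :=
    (hφ.eventually (by simp)).mono fun w hw => hw.differentiableAt (by simp)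
  have hφ2 : HasDerivAt (deriv φ) (iteratedDeriv 2 φ (ω ^ (-2 / α) * t)) (ω ^ (-2 / α) * t) := by
    rw [iteratedDeriv_succ, iteratedDeriv_one]
    exact ((hφ.derivWithin (m := 1) (by norm_num)).differentiableAt (by simp)).hasDerivAt
  have hU : deriv (fun y => similarity α s g φ y t) =ᶠ[𝓝 ω] fun y =>
      (((s * y ^ (s - 1) / g y - y ^ s * g₁ y / g y ^ 2 : ℝ) : ℂ) * φ (y ^ (-2 / α) * t) +
        ((y ^ s / g y * (-2 / α * y ^ (-2 / α - 1) * t) : ℝ) : ℂ) *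
          deriv φ (y ^ (-2 / α) * t)) := by
    filter_upwards [hg, eventually_pos_nhds hω, hgω.continuousAt.eventually_ne h0,
      hk.eventually hφ1] with y h1 h2 h3 h4
    rw [(hasDerivAt_similarity_fst h2 h1 h3 h4).deriv]
    push_cast
    ring
  have hG := hasDerivAt_rpow_div (s := s) hω hgω h0
  have hk1 := hasDerivAt_rpow_mul_const (p := -2 / α) (t := t) hω
  have hG1 : HasDerivAt (fun y => s * y ^ (s - 1) / g y - y ^ s * g₁ y / g y ^ 2) _ ω :=
    (((Real.hasDerivAt_rpow_const (p := s - 1) (Or.inl hω.ne')).const_mul s).div hgω h0).sub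
      (((Real.hasDerivAt_rpow_const (p := s) (Or.inl hω.ne')).mul hg₁).div (hgω.pow 2)
        (pow_ne_zero 2 h0))
  have hk2 : HasDerivAt (fun y => y ^ s / g y * (-2 / α * y ^ (-2 / α - 1) * t)) _ ω :=
    hG.mul (((Real.hasDerivAt_rpow_const (p := -2 / α - 1) (Or.inl hω.ne')).const_mul
      (-2 / α)).mul_const t)
  have hU2 := (hasDerivAt_smul_comp hG1 hk1 hφ1.self_of_nhds.hasDerivAt).add
    (hasDerivAt_smul_comp hk2 hk1 hφ2)
  rw [iteratedDeriv_succ, iteratedDeriv_one, hU.deriv_eq, hU.self_of_nhds]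
  erw [hU2.deriv]
  -- Once g'' and c are eliminated, all terms containing g' cancel, since 1/g solves the spatial
  -- equation.
  have hg2 : g₂ = (μ - 1) * g₁ ω / ω := by field_simp; linarith
  subst hc hg2
  simp only [Real.rpow_sub hω, Real.rpow_one, Pi.mul_apply]
  have h1 : (ω : ℂ) ≠ 0 := by exact_mod_cast hω.ne'
  have h2 : (g ω : ℂ) ≠ 0 := by exact_mod_cast h0
  have h3 : (α : ℂ) ≠ 0 := by exact_mod_cast hα.ne'
  push_cast
  field_simp
  ring

theorem isSolutionAt_similarity_iff {α s μ ω t g₂ : ℝ} {c g g₁ : ℝ → ℝ} {φ : ℝ → ℂ}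
    (hα : 0 < α) (hω : 0 < ω) (ht : 0 < t) (hgd : ContDiffAt ℝ 2 g ω)
    (hg : ∀ᶠ y in 𝓝 ω, HasDerivAt g (g₁ y) y) (hg₁ : HasDerivAt g₁ g₂ ω)
    (h0 : g ω ≠ 0) (hode : ω * g₂ = (μ - 1) * g₁ ω) (hc : c ω = (1 - μ) / ω + 2 * g₁ ω / g ω) :
    IsSolutionAt α c (similarity α s g φ) ω t ↔
      IsEulerSolutionAt α (s * (s - μ)) (2 / α * (2 / α - 2 * s + μ)) (4 / α ^ 2) φ
        (ω ^ (-2 / α) * t) := by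
  have hκ : 0 < ω ^ (-2 / α) := Real.rpow_pos_of_pos hω _
  have hC : ((ω ^ s / g ω : ℝ) : ℂ) ≠ 0 := by
    exact_mod_cast div_ne_zero (Real.rpow_pos_of_pos hω s).ne' h0
  have hu : similarity α s g φ ω = fun τ => ((ω ^ s / g ω : ℝ) : ℂ) * φ (ω ^ (-2 / α) * τ) :=
    funext fun τ => similarity_eq ..
  -- The similarity exponent is chosen so that the fractional time derivative also produces the
  -- factor ω^(-2) of the spatial side.
  have hκα : (ω ^ (-2 / α)) ^ α = (ω ^ 2)⁻¹ := by
    rw [← Real.rpow_mul hω.le, div_mul_cancel₀ _ hα.ne', Real.rpow_neg hω.le, Real.rpow_two]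
  have hne : ((ω ^ s / g ω / ω ^ 2 : ℝ) : ℂ) ≠ 0 := by
    exact_mod_cast div_ne_zero (div_ne_zero (Real.rpow_pos_of_pos hω s).ne' h0)
      (pow_ne_zero 2 hω.ne')
  unfold IsSolutionAt IsEulerSolutionAt
  rw [contDiffAt_similarity_iff hα hω ht hgd h0]
  refine and_congr_right fun hφ => ?_
  rw [similarity_spatial hω hg hg₁ h0 hode hc hα hφ, hu, rlDifferentiableAt_scale hC φ hκ ht,
    rlDeriv_scale _ φ hκ ht, hκα]
  refine and_congr_right fun _ => ?_
  rw [← ofReal_mul, ← div_eq_mul_inv, mul_right_inj' hne]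

/-! ### The two coefficient functions -/

theorem contDiffAt_den₁ {μ ω : ℝ} (hω : 0 < ω) : ContDiffAt ℝ 2 (den₁ μ) ω :=
  ((Real.contDiffAt_log.2 hω.ne').add contDiffAt_const).sub contDiffAt_const

theorem hasDerivAt_den₁ {μ ω : ℝ} (hω : 0 < ω) : HasDerivAt (den₁ μ) ω⁻¹ ω :=
  ((Real.hasDerivAt_log hω.ne').add_const μ).sub_const 2

theorem contDiffAt_den₂ {μ ν ω : ℝ} (hω : 0 < ω) : ContDiffAt ℝ 2 (den₂ μ ν) ω :=
  ((contDiffAt_const.mul (Real.contDiffAt_rpow_const_of_ne hω.ne')).add contDiffAt_const).add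
    contDiffAt_const

theorem hasDerivAt_den₂ {μ ν ω : ℝ} (hω : 0 < ω) :
    HasDerivAt (den₂ μ ν) (ν * (μ * ω ^ (μ - 1))) ω :=
  (((Real.hasDerivAt_rpow_const (p := μ) (Or.inl hω.ne')).const_mul ν).add_const μ).add_const 1

theorem isInvariantAt_similarity₁ {α s μ ω t : ℝ} {φ : ℝ → ℂ} (hω : 0 < ω) (h0 : den₁ μ ω ≠ 0)
    (hφ : DifferentiableAt ℝ φ (ω ^ (-2 / α) * t)) :
    IsInvariantAt (V₁ α s μ) (similarity α s (den₁ μ) φ) ω t := by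
  refine isInvariantAt_similarity hω (hasDerivAt_den₁ hω) h0 (fun u => ?_) hφ
  have h1 : s - ω * ω⁻¹ / den₁ μ ω =
      (s + 1 / 2) - (Real.log ω + μ) / (2 * (Real.log ω + μ - 2)) := by
    unfold den₁ at h0 ⊢
    field_simp
    ring
  rw [h1]
  simp only [V₁, X₁, X₂, Pi.add_apply, Pi.smul_apply, Prod.smul_mk, Prod.mk_add_mk, smul_zero,
    zero_add, real_smul]
  push_cast
  congr 2
  ring

theorem isInvariantAt_similarity₂ {α s μ ν ω t : ℝ} {φ : ℝ → ℂ} (hω : 0 < ω)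
    (h0 : den₂ μ ν ω ≠ 0) (hφ : DifferentiableAt ℝ φ (ω ^ (-2 / α) * t)) :
    IsInvariantAt (V₂ α s μ ν) (similarity α s (den₂ μ ν) φ) ω t := by
  refine isInvariantAt_similarity hω (hasDerivAt_den₂ hω) h0 (fun u => ?_) hφ
  have h1 : s - ω * (ν * (μ * ω ^ (μ - 1))) / den₂ μ ν ω =
      (s + (1 - μ) / 2) - (μ + 1) * (ν * ω ^ μ - μ + 1) / (2 * (ν * ω ^ μ + μ + 1)) := by
    unfold den₂ at h0 ⊢
    rw [Real.rpow_sub hω, Real.rpow_one]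
    field_simp
    ring
  rw [h1]
  simp only [V₂, X₁, X₃, Pi.add_apply, Pi.smul_apply, Prod.smul_mk, Prod.mk_add_mk, smul_zero,
    zero_add, real_smul]
  push_cast
  congr 2
  ring

theorem isSolutionAt_similarity₁_iff {α s μ ω t : ℝ} {φ : ℝ → ℂ} (hα : 0 < α) (hω : 0 < ω)
    (ht : 0 < t) (h0 : den₁ μ ω ≠ 0) :
    IsSolutionAt α (coeff₁ μ) (similarity α s (den₁ μ) φ) ω t ↔
      IsEulerSolutionAt α (s * (s - 0)) (2 / α * (2 / α - 2 * s + 0)) (4 / α ^ 2) φ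
        (ω ^ (-2 / α) * t) := by
  refine isSolutionAt_similarity_iff (μ := 0) (g₁ := fun y => y⁻¹) hα hω ht (contDiffAt_den₁ hω)
    ((eventually_pos_nhds hω).mono fun y hy => hasDerivAt_den₁ hy) (hasDerivAt_inv hω.ne') h0 ?_ ?_
  · field_simp; ring
  · unfold coeff₁ den₁ at *
    field_simp
    ring

theorem isSolutionAt_similarity₂_iff {α s μ ν ω t : ℝ} {φ : ℝ → ℂ} (hα : 0 < α) (hω : 0 < ω)
    (ht : 0 < t) (h0 : den₂ μ ν ω ≠ 0) :
    IsSolutionAt α (coeff₂ μ ν) (similarity α s (den₂ μ ν) φ) ω t ↔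
      IsEulerSolutionAt α (s * (s - μ)) (2 / α * (2 / α - 2 * s + μ)) (4 / α ^ 2) φ
        (ω ^ (-2 / α) * t) := by
  refine isSolutionAt_similarity_iff (g₁ := fun y => ν * (μ * y ^ (μ - 1))) hα hω ht
    (contDiffAt_den₂ hω) ((eventually_pos_nhds hω).mono fun y hy => hasDerivAt_den₂ hy)
    (((Real.hasDerivAt_rpow_const (Or.inl hω.ne')).const_mul μ).const_mul ν) h0 ?_ ?_
  · simp only [Real.rpow_sub hω, Real.rpow_one]
    field_simp
  · unfold coeff₂ den₂ at *
    rw [Real.rpow_sub hω, Real.rpow_one]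
    field_simp
    ring

/-! ### Locality: only the values on the open quadrant matter -/

/-- The fractional integral looks back over all of (0,τ), so germ equality at t is not enough, but
agreement on (0,R) is. This suits power formulas, which are valid only for positive arguments. -/
theorem rlPrimitive_eventuallyEq {α : ℝ} {f h : ℝ → ℂ} {R t : ℝ}
    (hfh : ∀ x, 0 < x → x < R → f x = h x) (ht : 0 < t) (htR : t < R) :
    rlPrimitive α f =ᶠ[𝓝 t] rlPrimitive α h := by
  filter_upwards [eventually_pos_nhds ht, gt_mem_nhds htR] with τ h1 h2
  unfold rlPrimitive
  split_ifs
  · exact hfh τ h1 h2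
  · beta_reduce
    congr 1
    rw [intervalIntegral.integral_of_le h1.le, intervalIntegral.integral_of_le h1.le]
    exact setIntegral_congr_fun measurableSet_Ioc fun x hx => by
      rw [hfh x hx.1 (hx.2.trans_lt h2)]

theorem RLDifferentiableAt.congr {α : ℝ} {f h : ℝ → ℂ} {R t : ℝ} (H : RLDifferentiableAt α h t)
    (hfh : ∀ x, 0 < x → x < R → f x = h x) (ht : 0 < t) (htR : t < R) :
    RLDifferentiableAt α f t := by
  refine ⟨fun hα => ?_, H.2.congr_of_eventuallyEq (rlPrimitive_eventuallyEq hfh ht htR)⟩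
  filter_upwards [H.1 hα, eventually_pos_nhds ht, gt_mem_nhds htR] with τ h0 h1 h2
  refine h0.congr fun x hx => ?_
  rw [Set.uIoc_of_le h1.le] at hx
  rw [hfh x hx.1 (hx.2.trans_lt h2)]

theorem rlDeriv_congr {α : ℝ} {f h : ℝ → ℂ} {R t : ℝ} (hfh : ∀ x, 0 < x → x < R → f x = h x)
    (ht : 0 < t) (htR : t < R) : rlDeriv α f t = rlDeriv α h t :=
  (rlPrimitive_eventuallyEq hfh ht htR).iteratedDeriv_eq _

theorem IsEulerSolutionAt.congr {α k₀ k₁ k₂ : ℝ} {f h : ℝ → ℂ} {R z : ℝ}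
    (H : IsEulerSolutionAt α k₀ k₁ k₂ h z) (hfh : ∀ x, 0 < x → x < R → f x = h x) (hz : 0 < z)
    (hzR : z < R) : IsEulerSolutionAt α k₀ k₁ k₂ f z := by
  have he : f =ᶠ[𝓝 z] h := by
    filter_upwards [eventually_pos_nhds hz, gt_mem_nhds hzR] with x h1 h2 using hfh x h1 h2
  refine ⟨H.1.congr_of_eventuallyEq he, H.2.1.congr hfh hz hzR, ?_⟩
  rw [rlDeriv_congr hfh hz hzR, H.2.2, he.deriv_eq, he.iteratedDeriv_eq, he.self_of_nhds]

theorem IsInvariantSolutionAt.congr {α : ℝ} {c : ℝ → ℝ} {V : Generator} {u v : ℝ → ℝ → ℂ}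
    {ω t : ℝ} (H : IsInvariantSolutionAt α c V v ω t)
    (huv : ∀ y τ, 0 < y → 0 < τ → u y τ = v y τ) (hω : 0 < ω) (ht : 0 < t) :
    IsInvariantSolutionAt α c V u ω t := by
  have h1 : (fun y => u y t) =ᶠ[𝓝 ω] fun y => v y t :=
    (eventually_pos_nhds hω).mono fun y hy => huv y t hy ht
  -- Any bound beyond t would do: the derivative at t needs the past of a neighbourhood of t.
  have h2 : ∀ τ, 0 < τ → τ < t + 1 → u ω τ = v ω τ := fun τ hτ _ => huv ω τ hω hτ
  have h3 : u ω =ᶠ[𝓝 t] v ω := (eventually_pos_nhds ht).mono fun τ hτ => huv ω τ hω hτ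
  have h4 : (fun p : ℝ × ℝ => u p.1 p.2) =ᶠ[𝓝 (ω, t)] fun p => v p.1 p.2 := by
    filter_upwards [prod_mem_nhds (Ioi_mem_nhds hω) (Ioi_mem_nhds ht)] with p hp
    exact huv p.1 p.2 hp.1 hp.2
  obtain ⟨H1, ⟨H2, H3, H4⟩, H5, H6⟩ := H
  have ht1 : t < t + 1 := lt_add_one t
  refine ⟨by rw [huv ω t hω ht]; exact H1, ⟨H2.congr_of_eventuallyEq h1, H3.congr h2 ht ht1, ?_⟩,
    H5.congr_of_eventuallyEq h4, ?_⟩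
  · rw [rlDeriv_congr h2 ht ht1, H4, h1.iteratedDeriv_eq, h1.deriv_eq]
  · rw [huv ω t hω ht, h1.deriv_eq, h3.deriv_eq, H6]

/-! ### Linearity -/

theorem rlPrimitive_add {α : ℝ} {f h : ℝ → ℂ} {τ : ℝ}
    (hf : α ≠ (⌈α⌉₊ : ℝ) → IntervalIntegrable
      (fun s => f s / (((τ - s) ^ (α - (⌈α⌉₊ : ℝ) + 1) : ℝ) : ℂ)) volume 0 τ)
    (hh : α ≠ (⌈α⌉₊ : ℝ) → IntervalIntegrable
      (fun s => h s / (((τ - s) ^ (α - (⌈α⌉₊ : ℝ) + 1) : ℝ) : ℂ)) volume 0 τ) :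
    rlPrimitive α (f + h) τ = rlPrimitive α f τ + rlPrimitive α h τ := by
  unfold rlPrimitive
  split_ifs with hα
  · rfl
  · beta_reduce
    rw [← mul_add, ← intervalIntegral.integral_add (hf hα) (hh hα)]
    simp only [Pi.add_apply, add_div]

/-- Additivity of the fractional integral needs both integrals to converge near z, which is part of
`RLDifferentiableAt`. -/
theorem IsEulerSolutionAt.add {α k₀ k₁ k₂ : ℝ} {f h : ℝ → ℂ} {z : ℝ}
    (Hf : IsEulerSolutionAt α k₀ k₁ k₂ f z) (Hh : IsEulerSolutionAt α k₀ k₁ k₂ h z) :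
    IsEulerSolutionAt α k₀ k₁ k₂ (f + h) z := by
  have he : rlPrimitive α (f + h) =ᶠ[𝓝 z] rlPrimitive α f + rlPrimitive α h := by
    by_cases hα : α = (⌈α⌉₊ : ℝ)
    · exact Filter.Eventually.of_forall fun τ =>
        rlPrimitive_add (fun h => absurd hα h) fun h => absurd hα h
    · filter_upwards [Hf.2.1.1 hα, Hh.2.1.1 hα] with τ h1 h2
      exact rlPrimitive_add (fun _ => h1) fun _ => h2
  refine ⟨Hf.1.add Hh.1, ⟨fun hα => ?_, (Hf.2.1.2.add Hh.2.1.2).congr_of_eventuallyEq he⟩, ?_⟩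
  · filter_upwards [Hf.2.1.1 hα, Hh.2.1.1 hα] with τ h1 h2
    simpa only [Pi.add_apply, add_div] using h1.add h2
  · have h3 : rlDeriv α (f + h) z = rlDeriv α f z + rlDeriv α h z := by
      unfold rlDeriv
      rw [he.iteratedDeriv_eq, iteratedDeriv_add Hf.2.1.2 Hh.2.1.2]
    rw [h3, Hf.2.2, Hh.2.2, deriv_add (Hf.1.differentiableAt (by simp))
      (Hh.1.differentiableAt (by simp)), iteratedDeriv_add Hf.1 Hh.1, Pi.add_apply]
    ring

theorem isEulerSolutionAt_zero {α k₀ k₁ k₂ z : ℝ} : IsEulerSolutionAt α k₀ k₁ k₂ 0 z := by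
  have h0 : rlPrimitive α 0 = 0 := by
    funext τ
    unfold rlPrimitive
    split_ifs <;> simp
  refine ⟨contDiffAt_const, ⟨fun _ => by simp, by rw [h0]; exact contDiffAt_const⟩, ?_⟩
  simp [rlDeriv, h0]

noncomputable section

/-! ### Superpositions of powers -/

/-- The superposition `z ↦ ∫ A(x) z^(p(x)) dν(x)` of complex powers. -/
def superpos {X : Type*} [MeasurableSpace X] (ν : Measure X) (A p : X → ℂ) (z : ℝ) : ℂ :=
  ∫ x, A x * (z : ℂ) ^ p x ∂ν

/-- The superposition with amplitude `A` and exponent `p` converges on `(0, R)`, together with all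
its formal derivatives. -/
structure SuperposGood {X : Type*} [MeasurableSpace X] (ν : Measure X) (A p : X → ℂ) (R : ℝ) :
    Prop where
  aesm : AEStronglyMeasurable A ν
  meas : Measurable p
  int : ∀ (N : ℕ) (z : ℝ), 0 < z → z < R →
    Integrable (fun x => ‖A x‖ * (1 + ‖p x‖) ^ N * z ^ (p x).re) ν

variable {X : Type*} [MeasurableSpace X] {ν : Measure X} {A p : X → ℂ} {R : ℝ}

theorem measurable_cpow_exponent (hp : Measurable p) (z : ℂ) : Measurable fun x => z ^ p x :=
  measurable_const.pow hp

/-- The condition carries every polynomial weight in p, so it survives amplitudes of polynomial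
growth and constant shifts of the exponent. This covers differentiation, the Euler operator and
fractional integration. -/
theorem SuperposGood.of_le (H : SuperposGood ν A p R) {A' : X → ℂ} (c : ℂ) {C : ℝ} (M : ℕ)
    (hA' : AEStronglyMeasurable A' ν) (hle : ∀ x, ‖A' x‖ ≤ C * (1 + ‖p x‖) ^ M * ‖A x‖) :
    SuperposGood ν A' (fun x => p x + c) R := by
  refine ⟨hA', H.meas.add_const c, fun N z hz hzR => ?_⟩
  have h1 := ((H.int (M + N) z hz hzR).const_mul (C * (1 + ‖c‖) ^ N * z ^ c.re))
  refine h1.mono' ?_ (Filter.Eventually.of_forall fun x => ?_)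
  · have hm : Measurable fun x => (1 + ‖p x + c‖) ^ N :=
      (measurable_const.add (H.meas.add_const c).norm).pow_const N
    have hm2 : Measurable fun x => z ^ (p x + c).re :=
      measurable_const.pow (measurable_re.comp (H.meas.add_const c))
    exact (hA'.norm.mul hm.aestronglyMeasurable).mul hm2.aestronglyMeasurable
  · have hz1 : 0 < z ^ (p x + c).re := Real.rpow_pos_of_pos hz _
    have h2 : ‖p x + c‖ ≤ ‖p x‖ + ‖c‖ := norm_add_le _ _
    have h3 : (1 + ‖p x + c‖) ^ N ≤ (1 + ‖c‖) ^ N * (1 + ‖p x‖) ^ N := by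
      rw [← mul_pow]
      gcongr
      nlinarith [norm_nonneg (p x), norm_nonneg c]
    rw [Real.norm_of_nonneg (by positivity)]
    calc ‖A' x‖ * (1 + ‖p x + c‖) ^ N * z ^ (p x + c).re
        ≤ (C * (1 + ‖p x‖) ^ M * ‖A x‖) * ((1 + ‖c‖) ^ N * (1 + ‖p x‖) ^ N) *
            z ^ (p x + c).re := by
          gcongr
          · exact (norm_nonneg _).trans (hle x)
          · exact hle x
      _ = _ := by rw [add_re, Real.rpow_add hz]; ring

theorem SuperposGood.integrable (H : SuperposGood ν A p R) {z : ℝ} (hz : 0 < z) (hzR : z < R) :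
    Integrable (fun x => A x * (z : ℂ) ^ p x) ν := by
  refine (H.int 0 z hz hzR).mono'
    (H.aesm.mul (measurable_cpow_exponent H.meas z).aestronglyMeasurable)
    (Filter.Eventually.of_forall fun x => ?_)
  rw [norm_mul, norm_cpow_eq_rpow_re_of_pos hz]
  simp

/-! ### Termwise differentiation of superpositions -/

theorem SuperposGood.deriv_good (H : SuperposGood ν A p R) :
    SuperposGood ν (fun x => A x * p x) (fun x => p x - 1) R := by
  simp_rw [sub_eq_add_neg]
  refine H.of_le (-1) (C := 1) 1 (H.aesm.mul H.meas.aestronglyMeasurable) fun x => ?_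
  rw [norm_mul]
  nlinarith [norm_nonneg (A x), norm_nonneg (p x)]

/-- For either sign of q one endpoint dominates. The sum of both serves all exponents at once and
gives a majorant for differentiation under the integral. -/
theorem rpow_le_add_rpow {a b z q : ℝ} (ha : 0 < a) (haz : a ≤ z) (hzb : z ≤ b) :
    z ^ q ≤ a ^ q + b ^ q := by
  have hz : 0 < z := ha.trans_le haz
  have h1 := Real.rpow_pos_of_pos ha q
  have h2 := Real.rpow_pos_of_pos (hz.trans_le hzb) q
  rcases le_total 0 q with h | h
  · linarith [Real.rpow_le_rpow hz.le hzb h]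
  · linarith [Real.rpow_le_rpow_of_nonpos ha haz h]

theorem hasDerivAt_ofReal_cpow {z : ℝ} (hz : 0 < z) (q : ℂ) :
    HasDerivAt (fun y : ℝ => (y : ℂ) ^ q) (q * (z : ℂ) ^ (q - 1)) z := by
  have h : HasDerivAt (fun y : ℂ => y ^ q) (q * (z : ℂ) ^ (q - 1)) (z : ℂ) := by
    simpa using (hasDerivAt_id (z : ℂ)).cpow_const (c := q) (Or.inl (by simpa using hz))
  exact h.comp_ofReal

theorem SuperposGood.hasDerivAt (H : SuperposGood ν A p R) {z : ℝ} (hz : 0 < z) (hzR : z < R) :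
    HasDerivAt (superpos ν A p) (superpos ν (fun x => A x * p x) (fun x => p x - 1) z) z := by
  have H' := H.deriv_good
  set a := z / 2 with ha
  set b := (z + R) / 2 with hb
  have ha0 : 0 < a := by positivity
  have haz : a < z := by linarith
  have hzb : z < b := by linarith
  have hbR : b < R := by linarith
  -- The majorant on (a,b) is the sum of the differentiated integrand's norms at the two endpoints.
  have hi := (H'.int 0 a ha0 (haz.trans hzR)).add (H'.int 0 b (hz.trans hzb) hbR)
  exact (hasDerivAt_integral_of_dominated_loc_of_deriv_le
    (F := fun (y : ℝ) x => A x * (y : ℂ) ^ p x)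
    (F' := fun (y : ℝ) x => A x * p x * (y : ℂ) ^ (p x - 1)) (Ioo_mem_nhds haz hzb)
    (Filter.Eventually.of_forall fun y =>
      H.aesm.mul (measurable_cpow_exponent H.meas y).aestronglyMeasurable)
    (H.integrable hz hzR)
    (H'.aesm.mul (measurable_cpow_exponent H'.meas z).aestronglyMeasurable)
    (Filter.Eventually.of_forall fun x y hy => by
      have hy0 : 0 < y := ha0.trans hy.1
      rw [norm_mul, norm_cpow_eq_rpow_re_of_pos hy0]
      simp only [pow_zero, mul_one, Pi.add_apply]
      rw [← mul_add]
      gcongr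
      exact rpow_le_add_rpow ha0 hy.1.le hy.2.le) hi
    (Filter.Eventually.of_forall fun x y hy => by
      rw [mul_assoc]
      exact (hasDerivAt_ofReal_cpow (ha0.trans hy.1) (p x)).const_mul (A x))).2

theorem SuperposGood.contDiffOn (H : SuperposGood ν A p R) (n : ℕ) :
    ContDiffOn ℝ n (superpos ν A p) (Set.Ioo 0 R) := by
  induction n generalizing A p with
  | zero =>
    exact contDiffOn_zero.2 fun z hz =>
      (H.hasDerivAt hz.1 hz.2).continuousAt.continuousWithinAt
  | succ n ih =>
    rw [Nat.cast_succ, contDiffOn_succ_iff_deriv_of_isOpen isOpen_Ioo]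
    refine ⟨fun z hz => (H.hasDerivAt hz.1 hz.2).differentiableAt.differentiableWithinAt,
      by simp, (ih H.deriv_good).congr fun z hz => (H.hasDerivAt hz.1 hz.2).deriv⟩

theorem SuperposGood.contDiffAt (H : SuperposGood ν A p R) (n : ℕ) {z : ℝ} (hz : 0 < z)
    (hzR : z < R) : ContDiffAt ℝ n (superpos ν A p) z :=
  (H.contDiffOn n).contDiffAt (Ioo_mem_nhds hz hzR)

/-- The identity w/Γ(w+1) = 1/Γ(w) holds for every w, including the poles, where the value 0 of Γ
makes the quotient vanish. Hence no condition on the exponents. -/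
theorem superpos_eq_of_gamma {a : X → ℂ} (c : ℂ) (z : ℝ) :
    superpos ν (fun x => a x / Gamma (p x + c + 1) * (p x + c)) (fun x => p x + c - 1) z =
      superpos ν (fun x => a x / Gamma (p x + (c - 1) + 1)) (fun x => p x + (c - 1)) z := by
  refine integral_congr_ae (Filter.Eventually.of_forall fun x => ?_)
  beta_reduce
  rw [add_sub_assoc, show p x + (c - 1) + 1 = p x + c by ring]
  congr 1
  rw [div_eq_mul_one_div _ (Gamma (p x + c)), one_div,
    one_div_Gamma_eq_self_mul_one_div_Gamma_add_one]
  ring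

theorem SuperposGood.gamma_deriv_good {a : X → ℂ} {c : ℂ}
    (H : SuperposGood ν (fun x => a x / Gamma (p x + c + 1)) (fun x => p x + c) R) :
    SuperposGood ν (fun x => a x / Gamma (p x + (c - 1) + 1)) (fun x => p x + (c - 1)) R := by
  convert! H.deriv_good using 2 with x x
  · rw [show p x + (c - 1) + 1 = p x + c by ring, div_eq_mul_one_div, one_div,
      one_div_Gamma_eq_self_mul_one_div_Gamma_add_one]
    ring
  · ring

/-- With the normalisation 1/Γ(p+c+1) a derivative merely lowers c by 1, so the induction runs over
all c. -/
theorem SuperposGood.iteratedDeriv_eq {a : X → ℂ} {c : ℂ}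
    (H : SuperposGood ν (fun x => a x / Gamma (p x + c + 1)) (fun x => p x + c) R) (n : ℕ)
    {z : ℝ} (hz : 0 < z) (hzR : z < R) :
    iteratedDeriv n (superpos ν (fun x => a x / Gamma (p x + c + 1)) (fun x => p x + c)) z =
      superpos ν (fun x => a x / Gamma (p x + (c - n) + 1)) (fun x => p x + (c - n)) z := by
  induction n generalizing c with
  | zero => simp
  | succ n ih =>
    have h1 : deriv (superpos ν (fun x => a x / Gamma (p x + c + 1)) (fun x => p x + c)) =ᶠ[𝓝 z]
        superpos ν (fun x => a x / Gamma (p x + (c - 1) + 1)) (fun x => p x + (c - 1)) := by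
      filter_upwards [Ioo_mem_nhds hz hzR] with y hy
      rw [(H.hasDerivAt hy.1 hy.2).deriv, superpos_eq_of_gamma]
    rw [iteratedDeriv_succ', h1.iteratedDeriv_eq, ih H.gamma_deriv_good]
    have : c - 1 - n = c - (n + 1 : ℕ) := by push_cast; ring
    rw [this]

/-! ### The Riemann-Liouville derivative of a superposition -/

theorem intervalIntegrable_rpow_mul_rpow {u e τ : ℝ} (hu : -1 < u) (he : 0 < e) (hτ : 0 < τ) :
    IntervalIntegrable (fun s : ℝ => s ^ u * (τ - s) ^ (e - 1)) volume 0 τ := by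
  have h := betaIntegral_convergent (u := (u + 1 : ℝ)) (v := (e : ℝ)) (by simp; linarith)
    (by simpa using he)
  have h2 : IntervalIntegrable (fun s : ℝ => ‖((s : ℂ) ^ (((u + 1 : ℝ) : ℂ) - 1) *
      (1 - (s : ℂ)) ^ ((e : ℂ) - 1))‖) volume 0 1 := h.norm
  have h3 : IntervalIntegrable (fun s : ℝ => s ^ u * (1 - s) ^ (e - 1)) volume 0 1 := by
    rw [intervalIntegrable_iff_integrableOn_Ioo_of_le zero_le_one] at h2 ⊢
    refine h2.congr_fun (fun s hs => ?_) measurableSet_Ioo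
    have h4 : (1 : ℂ) - (s : ℂ) = ((1 - s : ℝ) : ℂ) := by push_cast; ring
    beta_reduce
    rw [norm_mul, h4, norm_cpow_eq_rpow_re_of_pos hs.1,
      norm_cpow_eq_rpow_re_of_pos (sub_pos.2 hs.2)]
    simp
  have h5 : IntervalIntegrable (fun s : ℝ => (τ⁻¹ * s) ^ u * (1 - τ⁻¹ * s) ^ (e - 1)) volume
      (0 / τ⁻¹) (1 / τ⁻¹) := h3.comp_mul_left
  rw [zero_div, one_div, inv_inv] at h5
  refine (h5.const_mul (τ ^ u * τ ^ (e - 1))).congr fun s hs => ?_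
  rw [Set.uIoc_of_le hτ.le] at hs
  have h6 : 1 - τ⁻¹ * s = τ⁻¹ * (τ - s) := by field_simp
  rw [h6, Real.mul_rpow (inv_pos.2 hτ).le hs.1.le,
    Real.mul_rpow (inv_pos.2 hτ).le (sub_nonneg.2 hs.2), Real.inv_rpow hτ.le, Real.inv_rpow hτ.le]
  have h7 := (Real.rpow_pos_of_pos hτ u).ne'
  have h8 := (Real.rpow_pos_of_pos hτ (e - 1)).ne'
  field_simp

theorem norm_betaIntegral_le {p₀ e : ℝ} {u : ℂ} (hp₀ : -1 < p₀) (he : 0 < e)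
    (hu : p₀ ≤ u.re) :
    ‖betaIntegral (u + 1) e‖ ≤ ∫ s in (0 : ℝ)..1, s ^ p₀ * (1 - s) ^ (e - 1) := by
  unfold betaIntegral
  refine intervalIntegral.norm_integral_le_of_norm_le zero_le_one ?_
    (intervalIntegrable_rpow_mul_rpow hp₀ he one_pos)
  -- At s = 1 the base 1-s vanishes and the norm formula for complex powers is not available.
  have h1 : ∀ᵐ s : ℝ ∂volume, s ≠ 1 := by simp [ae_iff, measure_singleton]
  filter_upwards [h1] with s hs1 hs
  have h4 : (1 : ℂ) - (s : ℂ) = ((1 - s : ℝ) : ℂ) := by push_cast; ring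
  have hs2 : 0 < 1 - s := sub_pos.2 (lt_of_le_of_ne hs.2 hs1)
  rw [norm_mul, h4, norm_cpow_eq_rpow_re_of_pos hs.1, norm_cpow_eq_rpow_re_of_pos hs2]
  have h5 : ((e : ℂ) - 1).re = e - 1 := by simp
  have h6 : (u + 1 - 1).re = u.re := by simp
  rw [h5, h6]
  exact mul_le_mul_of_nonneg_right (Real.rpow_le_rpow_of_exponent_ge hs.1 hs.2 hu)
    (Real.rpow_nonneg hs2.le _)

theorem measurable_one_div_Gamma : Measurable fun w : ℂ => (Gamma w)⁻¹ :=
  differentiable_one_div_Gamma.continuous.measurable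

theorem Gamma_add_one_div {u : ℂ} {e : ℝ} (hu : -1 < u.re) (he : 0 < e) :
    1 / Gamma (u + e + 1) = 1 / Gamma (u + 1) * (betaIntegral (u + 1) e / Gamma e) := by
  have h := Gamma_mul_Gamma_eq_betaIntegral (s := u + 1) (t := e) (by simp; linarith)
    (by simpa using he)
  have h1 : Gamma (u + 1) ≠ 0 := Gamma_ne_zero_of_re_pos (by simp; linarith)
  have h2 : Gamma e ≠ 0 := Gamma_ne_zero_of_re_pos (by simpa using he)
  have h3 : Gamma (u + e + 1) ≠ 0 := Gamma_ne_zero_of_re_pos (by simp; linarith)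
  rw [show u + 1 + (e : ℂ) = u + e + 1 by ring] at h
  field_simp
  linear_combination h

/-- Passing from 1/Γ(p+1) to 1/Γ(p+e+1) multiplies by B(p+1,e)/Γ(e), and the Beta integral is
bounded uniformly for Re p ≥ p₀ > -1. -/
theorem SuperposGood.fractional_good {a : X → ℂ} {p₀ e : ℝ} (hp₀ : -1 < p₀)
    (hp : ∀ x, p₀ ≤ (p x).re) (he : 0 < e) (ha : AEStronglyMeasurable a ν)
    (H : SuperposGood ν (fun x => a x / Gamma (p x + 1)) p R) :
    SuperposGood ν (fun x => a x / Gamma (p x + e + 1)) (fun x => p x + e) R := by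
  refine H.of_le (e : ℂ) (C := (∫ s in (0 : ℝ)..1, s ^ p₀ * (1 - s) ^ (e - 1)) / ‖Gamma e‖) 0 ?_
    fun x => ?_
  · simp_rw [div_eq_mul_inv]
    exact ha.mul (measurable_one_div_Gamma.comp
      ((H.meas.add_const _).add_const _)).aestronglyMeasurable
  · rw [div_eq_mul_one_div, Gamma_add_one_div (hp₀.trans_le (hp x)) he, ← mul_assoc,
      ← div_eq_mul_one_div, norm_mul, norm_div _ (Gamma e), pow_zero, mul_one, mul_comm]
    gcongr
    exact norm_betaIntegral_le hp₀ he (hp x)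


/-- The hypothesis of Fubini's theorem for the fractional integral: since (s/τ)^(Re p) ≤ (s/τ)^p₀
for 0 < s ≤ τ, the integrand is dominated by a Beta density in s times an integrable function of x.
-/
theorem SuperposGood.integrable_prod {p₀ e τ : ℝ} (H : SuperposGood ν A p R) (hp₀ : -1 < p₀)
    (hp : ∀ x, p₀ ≤ (p x).re) (he : 0 < e) (hτ : 0 < τ) (hτR : τ < R) [SFinite ν] :
    Integrable (fun q : ℝ × X => A q.2 * (q.1 : ℂ) ^ p q.2 / (((τ - q.1) ^ (1 - e) : ℝ) : ℂ))
      ((volume.restrict (Set.Ioc 0 τ)).prod ν) := by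
  have h1 : Integrable (fun s : ℝ => s ^ p₀ * (τ - s) ^ (e - 1)) (volume.restrict (Set.Ioc 0 τ)) :=
    (intervalIntegrable_iff_integrableOn_Ioc_of_le hτ.le).1
      (intervalIntegrable_rpow_mul_rpow hp₀ he hτ)
  have h2 := (H.int 0 τ hτ hτR).const_mul (τ ^ (-p₀))
  refine (h1.mul_prod h2).mono' ?_ ?_
  · refine (AEStronglyMeasurable.mul H.aesm.comp_snd (Measurable.aestronglyMeasurable ?_)).mul
      (Measurable.aestronglyMeasurable ?_)
    · exact (measurable_ofReal.comp measurable_fst).pow (H.meas.comp measurable_snd)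
    · exact (measurable_ofReal.comp
        ((measurable_const.sub measurable_fst).pow_const (1 - e))).inv
  · have h3 : ∀ᵐ q : ℝ × X ∂((volume.restrict (Set.Ioc 0 τ)).prod ν), q.1 ∈ Set.Ioc 0 τ :=
      Measure.quasiMeasurePreserving_fst.ae (ae_restrict_mem measurableSet_Ioc)
    filter_upwards [h3] with q hq
    have hτq : 0 ≤ τ - q.1 := sub_nonneg.2 hq.2
    rw [norm_div, norm_mul, norm_cpow_eq_rpow_re_of_pos hq.1, norm_real,
      Real.norm_of_nonneg (Real.rpow_nonneg hτq _), div_eq_mul_inv, ← Real.rpow_neg hτq, neg_sub,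
      pow_zero, mul_one]
    have h4 : q.1 ^ (p q.2).re ≤ q.1 ^ p₀ * (τ ^ (-p₀) * τ ^ (p q.2).re) := by
      have h5 : (q.1 / τ) ^ (p q.2).re ≤ (q.1 / τ) ^ p₀ :=
        Real.rpow_le_rpow_of_exponent_ge (div_pos hq.1 hτ) ((div_le_one hτ).2 hq.2) (hp _)
      rw [Real.div_rpow hq.1.le hτ.le, Real.div_rpow hq.1.le hτ.le,
        div_le_iff₀ (Real.rpow_pos_of_pos hτ _)] at h5
      rw [Real.rpow_neg hτ.le]
      calc _ ≤ _ := h5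
        _ = _ := by ring
    calc ‖A q.2‖ * q.1 ^ (p q.2).re * (τ - q.1) ^ (e - 1)
        ≤ ‖A q.2‖ * (q.1 ^ p₀ * (τ ^ (-p₀) * τ ^ (p q.2).re)) * (τ - q.1) ^ (e - 1) := by
          have := Real.rpow_nonneg hτq (e - 1)
          gcongr
      _ = _ := by ring

theorem integral_cpow_div_rpow {u : ℂ} {e τ : ℝ} (hτ : 0 < τ) :
    ∫ s in (0 : ℝ)..τ, (s : ℂ) ^ u / (((τ - s) ^ (1 - e) : ℝ) : ℂ) =
      (τ : ℂ) ^ (u + e) * betaIntegral (u + 1) e := by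
  have h := betaIntegral_scaled (u + 1) e hτ
  rw [show u + 1 + (e : ℂ) - 1 = u + e by ring] at h
  rw [← h]
  refine intervalIntegral.integral_congr fun s hs => ?_
  rw [Set.uIcc_of_le hτ.le] at hs
  have h1 : 0 ≤ τ - s := sub_nonneg.2 hs.2
  rw [div_eq_mul_inv, ← ofReal_inv, ← Real.rpow_neg h1, neg_sub, add_sub_cancel_right,
    ofReal_cpow h1]
  push_cast
  rfl

variable {a : X → ℂ} {p₀ α : ℝ} {f : ℝ → ℂ}

theorem SuperposGood.intervalIntegrable_rl [SFinite ν] {e τ : ℝ} (H : SuperposGood ν A p R)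
    (hp₀ : -1 < p₀) (hp : ∀ x, p₀ ≤ (p x).re) (he : 0 < e) (hτ : 0 < τ) (hτR : τ < R) :
    IntervalIntegrable (fun s => superpos ν A p s / (((τ - s) ^ (1 - e) : ℝ) : ℂ)) volume 0 τ := by
  rw [intervalIntegrable_iff_integrableOn_Ioc_of_le hτ.le]
  refine (H.integrable_prod hp₀ hp he hτ hτR).integral_prod_left.congr
    (Filter.Eventually.of_forall fun s => ?_)
  exact integral_div (((τ - s) ^ (1 - e) : ℝ) : ℂ) fun x => A x * (s : ℂ) ^ p x

theorem SuperposGood.integral_rl [SFinite ν] {e τ : ℝ} (H : SuperposGood ν A p R)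
    (hp₀ : -1 < p₀) (hp : ∀ x, p₀ ≤ (p x).re) (he : 0 < e) (hτ : 0 < τ) (hτR : τ < R) :
    ∫ s in (0 : ℝ)..τ, superpos ν A p s / (((τ - s) ^ (1 - e) : ℝ) : ℂ) =
      ∫ x, A x * ((τ : ℂ) ^ (p x + e) * betaIntegral (p x + 1) e) ∂ν := by
  rw [intervalIntegral.integral_of_le hτ.le]
  simp_rw [superpos, ← integral_div]
  rw [integral_integral_swap (H.integrable_prod hp₀ hp he hτ hτR)]
  refine integral_congr_ae (Filter.Eventually.of_forall fun x => ?_)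
  beta_reduce
  rw [← integral_cpow_div_rpow hτ, ← intervalIntegral.integral_const_mul,
    intervalIntegral.integral_of_le hτ.le]
  simp_rw [mul_div_assoc]

theorem sub_ceil_add_one (α : ℝ) : α - (⌈α⌉₊ : ℝ) + 1 = 1 - ((⌈α⌉₊ : ℝ) - α) := by ring

theorem ceil_sub_pos {α : ℝ} (hα : α ≠ (⌈α⌉₊ : ℝ)) : 0 < (⌈α⌉₊ : ℝ) - α :=
  sub_pos.2 (lt_of_le_of_ne (Nat.le_ceil α) hα)

theorem SuperposGood.primitive_good (ha : AEStronglyMeasurable a ν)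
    (H : SuperposGood ν (fun x => a x / Gamma (p x + 1)) p R) (hp₀ : -1 < p₀)
    (hp : ∀ x, p₀ ≤ (p x).re) (α : ℝ) :
    SuperposGood ν (fun x => a x / Gamma (p x + (((⌈α⌉₊ : ℝ) - α : ℝ) : ℂ) + 1))
      (fun x => p x + (((⌈α⌉₊ : ℝ) - α : ℝ) : ℂ)) R := by
  -- For integer α there is no fractional integral and the shift is 0.
  by_cases hα : α = (⌈α⌉₊ : ℝ)
  · have : (⌈α⌉₊ : ℝ) - α = 0 := sub_eq_zero.2 hα.symm
    simpa [this] using H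
  · exact H.fractional_good hp₀ hp (ceil_sub_pos hα) ha

theorem SuperposGood.rlPrimitive_eq [SFinite ν]
    (H : SuperposGood ν (fun x => a x / Gamma (p x + 1)) p R) (hp₀ : -1 < p₀)
    (hp : ∀ x, p₀ ≤ (p x).re) {τ : ℝ} (hτ : 0 < τ) (hτR : τ < R) :
    rlPrimitive α (superpos ν (fun x => a x / Gamma (p x + 1)) p) τ =
      superpos ν (fun x => a x / Gamma (p x + (((⌈α⌉₊ : ℝ) - α : ℝ) : ℂ) + 1))
        (fun x => p x + (((⌈α⌉₊ : ℝ) - α : ℝ) : ℂ)) τ := by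
  unfold rlPrimitive
  split_ifs with hα
  · have : (⌈α⌉₊ : ℝ) - α = 0 := sub_eq_zero.2 hα.symm
    simp [this]
  · have he := ceil_sub_pos hα
    beta_reduce
    rw [sub_ceil_add_one, H.integral_rl hp₀ hp he hτ hτR, ← integral_const_mul]
    refine integral_congr_ae (Filter.Eventually.of_forall fun x => ?_)
    beta_reduce
    rw [div_eq_mul_one_div _ (Gamma (p x + _ + 1)), Gamma_add_one_div (hp₀.trans_le (hp x)) he,
      Gamma_ofReal]
    push_cast
    ring

theorem SuperposGood.rlDifferentiableAt [SFinite ν] (ha : AEStronglyMeasurable a ν)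
    (H : SuperposGood ν (fun x => a x / Gamma (p x + 1)) p R) (hp₀ : -1 < p₀)
    (hp : ∀ x, p₀ ≤ (p x).re) {z : ℝ} (hz : 0 < z) (hzR : z < R) :
    RLDifferentiableAt α (superpos ν (fun x => a x / Gamma (p x + 1)) p) z := by
  refine ⟨fun hα => ?_, ((H.primitive_good ha hp₀ hp α).contDiffAt _ hz
    hzR).congr_of_eventuallyEq ?_⟩
  · filter_upwards [Ioo_mem_nhds hz hzR] with τ hτ
    rw [sub_ceil_add_one]
    exact H.intervalIntegrable_rl hp₀ hp (ceil_sub_pos hα) hτ.1 hτ.2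
  · filter_upwards [Ioo_mem_nhds hz hzR] with τ hτ
    exact H.rlPrimitive_eq hp₀ hp hτ.1 hτ.2

/-- Fractional integration raises the exponents by ⌈α⌉-α and the derivatives lower them by ⌈α⌉, a
net shift by -α. Terms for which p-α+1 is a pole of Γ drop out. -/
theorem SuperposGood.rlDeriv_eq [SFinite ν] (ha : AEStronglyMeasurable a ν)
    (H : SuperposGood ν (fun x => a x / Gamma (p x + 1)) p R) (hp₀ : -1 < p₀)
    (hp : ∀ x, p₀ ≤ (p x).re) {z : ℝ} (hz : 0 < z) (hzR : z < R) :
    rlDeriv α (superpos ν (fun x => a x / Gamma (p x + 1)) p) z =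
      superpos ν (fun x => a x / Gamma (p x - α + 1)) (fun x => p x - α) z := by
  have he : rlPrimitive α (superpos ν (fun x => a x / Gamma (p x + 1)) p) =ᶠ[𝓝 z]
      superpos ν (fun x => a x / Gamma (p x + (((⌈α⌉₊ : ℝ) - α : ℝ) : ℂ) + 1))
        (fun x => p x + (((⌈α⌉₊ : ℝ) - α : ℝ) : ℂ)) := by
    filter_upwards [Ioo_mem_nhds hz hzR] with τ hτ
    exact H.rlPrimitive_eq hp₀ hp hτ.1 hτ.2
  unfold rlDeriv
  rw [he.iteratedDeriv_eq, (H.primitive_good ha hp₀ hp α).iteratedDeriv_eq _ hz hzR]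
  have : (((⌈α⌉₊ : ℝ) - α : ℝ) : ℂ) - (⌈α⌉₊ : ℂ) = -(α : ℂ) := by push_cast; ring
  simp_rw [this, ← sub_eq_add_neg]

theorem SuperposGood.mul_deriv (H : SuperposGood ν A p R) {z : ℝ} (hz : 0 < z) (hzR : z < R) :
    (z : ℂ) * deriv (superpos ν A p) z = superpos ν (fun x => A x * p x) p z := by
  have hz0 : (z : ℂ) ≠ 0 := by exact_mod_cast hz.ne'
  rw [(H.hasDerivAt hz hzR).deriv, superpos, superpos, ← integral_const_mul]
  refine integral_congr_ae (Filter.Eventually.of_forall fun x => ?_)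
  beta_reduce
  rw [cpow_sub _ _ hz0, cpow_one]
  field_simp

theorem SuperposGood.sq_mul_iteratedDeriv (H : SuperposGood ν A p R) {z : ℝ} (hz : 0 < z)
    (hzR : z < R) : (z : ℂ) ^ 2 * iteratedDeriv 2 (superpos ν A p) z =
      superpos ν (fun x => A x * (p x * (p x - 1))) p z := by
  have hz0 : (z : ℂ) ≠ 0 := by exact_mod_cast hz.ne'
  have h1 : deriv (superpos ν A p) =ᶠ[𝓝 z]
      superpos ν (fun x => A x * p x) (fun x => p x - 1) := by
    filter_upwards [Ioo_mem_nhds hz hzR] with y hy using (H.hasDerivAt hy.1 hy.2).deriv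
  rw [iteratedDeriv_succ, iteratedDeriv_one, h1.deriv_eq, pow_two, mul_assoc,
    H.deriv_good.mul_deriv hz hzR, superpos, superpos, ← integral_const_mul]
  refine integral_congr_ae (Filter.Eventually.of_forall fun x => ?_)
  beta_reduce
  rw [cpow_sub _ _ hz0, cpow_one]
  field_simp

/-- A superposition of powers solves the Euler-type fractional equation once the two sides agree
after termwise application of the operators. -/
theorem SuperposGood.isEulerSolutionAt [SFinite ν] {k₀ k₁ k₂ : ℝ} (ha : AEStronglyMeasurable a ν)
    (H : SuperposGood ν (fun x => a x / Gamma (p x + 1)) p R) (hp₀ : -1 < p₀)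
    (hp : ∀ x, p₀ ≤ (p x).re) {z : ℝ} (hz : 0 < z) (hzR : z < R)
    (heq : superpos ν (fun x => a x / Gamma (p x - α + 1)) (fun x => p x - α) z =
      superpos ν (fun x => a x / Gamma (p x + 1) * (k₀ + k₁ * p x + k₂ * (p x * (p x - 1)))) p z) :
    IsEulerSolutionAt α k₀ k₁ k₂ (superpos ν (fun x => a x / Gamma (p x + 1)) p) z := by
  refine ⟨H.contDiffAt 2 hz hzR, H.rlDifferentiableAt ha hp₀ hp hz hzR, ?_⟩
  have H0 := H.integrable hz hzR
  have h1 := (H.of_le (A' := fun x => a x / Gamma (p x + 1) * p x) 0 (C := 1) 1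
    (H.aesm.mul H.meas.aestronglyMeasurable) fun x => by
      rw [norm_mul]
      nlinarith [norm_nonneg (a x / Gamma (p x + 1)), norm_nonneg (p x)]).integrable hz hzR
  have h2 := (H.of_le (A' := fun x => a x / Gamma (p x + 1) * (p x * (p x - 1))) 0 (C := 1) 2
    (H.aesm.mul (H.meas.mul (H.meas.sub_const 1)).aestronglyMeasurable) fun x => by
      have h3 : ‖p x - 1‖ ≤ ‖p x‖ + 1 := by simpa using norm_sub_le (p x) 1
      rw [norm_mul, norm_mul, one_mul, mul_comm]
      gcongr
      nlinarith [norm_nonneg (p x), norm_nonneg (p x - 1)]).integrable hz hzR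
  simp only [add_zero] at h1 h2
  rw [H.rlDeriv_eq ha hp₀ hp hz hzR, heq, mul_assoc (k₁ : ℂ), H.mul_deriv hz hzR,
    mul_assoc (k₂ : ℂ), H.sq_mul_iteratedDeriv hz hzR]
  simp only [superpos]
  have h3 : Integrable (fun x => (k₀ : ℂ) * (a x / Gamma (p x + 1) * (z : ℂ) ^ p x) +
      (k₁ : ℂ) * (a x / Gamma (p x + 1) * p x * (z : ℂ) ^ p x)) ν :=
    (H0.const_mul _).add (h1.const_mul _)
  rw [← integral_const_mul, ← integral_const_mul, ← integral_const_mul,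
    ← integral_add (H0.const_mul _) (h1.const_mul _), ← integral_add h3 (h2.const_mul _)]
  refine integral_congr_ae (Filter.Eventually.of_forall fun x => ?_)
  ring

end

/-! ### Exponential decay of the Gamma function on vertical lines -/

theorem integrableOn_rpow_mul_exp_neg {q b : ℝ} (hq : -1 < q) (hb : 0 < b) :
    IntegrableOn (fun t : ℝ => t ^ q * Real.exp (-(b * t))) (Set.Ioi 0) := by
  have := integrableOn_rpow_mul_exp_neg_mul_rpow hq one_pos hb
  simpa only [Real.rpow_one, neg_mul] using this

theorem norm_cpow_mul_exp {t : ℝ} (ht : 0 < t) (w r : ℂ) :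
    ‖(t : ℂ) ^ w * exp (-(r * t))‖ = t ^ w.re * Real.exp (-(r.re * t)) := by
  rw [norm_mul, norm_cpow_eq_rpow_re_of_pos ht, norm_exp]
  simp

theorem aestronglyMeasurable_cpow_mul_exp (w r : ℂ) :
    AEStronglyMeasurable (fun t : ℝ => (t : ℂ) ^ w * exp (-(r * t)))
      (volume.restrict (Set.Ioi 0)) := by
  have h1 : Measurable fun t : ℝ => (t : ℂ) ^ w := measurable_ofReal.pow_const w
  have h2 : Measurable fun t : ℝ => exp (-(r * t)) := by fun_prop
  exact (h1.mul h2).aestronglyMeasurable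

theorem hasDerivAt_integral_cpow_mul_exp {w r : ℂ} (hw : 0 < w.re) (hr : 0 < r.re) :
    HasDerivAt (fun r : ℂ => ∫ t : ℝ in Set.Ioi 0, (t : ℂ) ^ (w - 1) * exp (-(r * t)))
      (∫ t : ℝ in Set.Ioi 0, -(t : ℂ) ^ w * exp (-(r * t))) r := by
  -- On this half-plane exp(-(Re r/2)t) dominates every exponential factor.
  have hs : {r' : ℂ | r.re / 2 < r'.re} ∈ 𝓝 r :=
    (isOpen_lt continuous_const continuous_re).mem_nhds (by simp; linarith)
  have hm := (aestronglyMeasurable_cpow_mul_exp w r).neg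
  refine (hasDerivAt_integral_of_dominated_loc_of_deriv_le
    (F' := fun (r : ℂ) (t : ℝ) => -(t : ℂ) ^ w * exp (-(r * t)))
    (bound := fun t => t ^ w.re * Real.exp (-(r.re / 2 * t))) hs
    (Filter.Eventually.of_forall fun r' => aestronglyMeasurable_cpow_mul_exp _ _) ?_ ?_ ?_
    (integrableOn_rpow_mul_exp_neg (by linarith) (by linarith)) ?_).2
  · refine (integrableOn_rpow_mul_exp_neg (q := w.re - 1) (by linarith) hr).mono'
      (aestronglyMeasurable_cpow_mul_exp _ _) ?_
    refine (ae_restrict_iff' measurableSet_Ioi).2 (Filter.Eventually.of_forall fun t ht => ?_)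
    rw [norm_cpow_mul_exp ht]
    simp
  · refine hm.congr (Filter.Eventually.of_forall fun t => ?_)
    simp
  · refine (ae_restrict_iff' measurableSet_Ioi).2
      (Filter.Eventually.of_forall fun t ht r' hr' => ?_)
    rw [neg_mul, norm_neg, norm_cpow_mul_exp ht]
    have ht0 : (0 : ℝ) < t := ht
    have hr1 : r.re / 2 < r'.re := hr'
    gcongr
  · refine (ae_restrict_iff' measurableSet_Ioi).2
      (Filter.Eventually.of_forall fun t ht r' hr' => ?_)
    have ht0 : (t : ℂ) ≠ 0 := by exact_mod_cast (ne_of_gt ht)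
    have h1 : HasDerivAt (fun r : ℂ => exp (-(r * t))) (exp (-(r' * t)) * (-(1 * t))) r' :=
      ((hasDerivAt_id r').mul_const (t : ℂ)).neg.cexp
    refine (h1.const_mul ((t : ℂ) ^ (w - 1))).congr_deriv ?_
    rw [cpow_sub _ _ ht0, cpow_one]
    field_simp

/-- For real r > 0 this is a rescaling of Euler's integral. Both sides are analytic for Re r > 0, so
the identity theorem extends it to complex r. -/
theorem integral_cpow_mul_exp_neg_mul {w r : ℂ} (hw : 0 < w.re) (hr : 0 < r.re) :
    ∫ t : ℝ in Set.Ioi 0, (t : ℂ) ^ (w - 1) * exp (-(r * t)) = r ^ (-w) * Gamma w := by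
  set U : Set ℂ := {r : ℂ | 0 < r.re} with hU
  have hUo : IsOpen U := isOpen_lt continuous_const continuous_re
  have h1 : AnalyticOnNhd ℂ
      (fun r : ℂ => ∫ t : ℝ in Set.Ioi 0, (t : ℂ) ^ (w - 1) * exp (-(r * t))) U :=
    DifferentiableOn.analyticOnNhd (fun r hr =>
      (hasDerivAt_integral_cpow_mul_exp hw hr).differentiableAt.differentiableWithinAt) hUo
  have h2 : AnalyticOnNhd ℂ (fun r : ℂ => r ^ (-w) * Gamma w) U :=
    DifferentiableOn.analyticOnNhd (fun r hr =>
      (((hasDerivAt_id r).cpow_const (c := -w) (Or.inl hr)).mul_const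
        (Gamma w)).differentiableAt.differentiableWithinAt) hUo
  have hUc : IsPreconnected U := (convex_halfSpace_re_gt 0).isPreconnected
  refine h1.eqOn_of_preconnected_of_frequently_eq h2 hUc (z₀ := 1) (by simp [hU]) ?_ hr
  have h3 : Filter.Tendsto (fun x : ℝ => (x : ℂ)) (𝓝[≠] 1) (𝓝[≠] 1) := by
    refine tendsto_nhdsWithin_iff.2 ⟨?_, ?_⟩
    · exact (continuous_ofReal.tendsto' 1 1 (by simp)).mono_left nhdsWithin_le_nhds
    · filter_upwards [self_mem_nhdsWithin] with x hx
      simpa using hx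
  refine h3.frequently (Filter.Eventually.frequently ?_)
  filter_upwards [nhdsWithin_le_nhds (lt_mem_nhds (zero_lt_one' ℝ))] with x hx
  rw [integral_cpow_mul_exp_neg_mul_Ioi hw hx, one_div, inv_cpow, cpow_neg]
  rw [arg_ofReal_of_nonneg hx.le]
  exact Real.pi_pos.ne

/-- Take r = exp(iθ) in the preceding integral: the factor r^(-w) has norm exp(θ Im w), while the
integral is bounded by its absolute version with rate cos θ. -/
theorem norm_Gamma_le {w : ℂ} (hw : 0 < w.re) {θ : ℝ} (h1 : -(Real.pi / 2) < θ)
    (h2 : θ < Real.pi / 2) :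
    ‖Gamma w‖ ≤ Real.Gamma w.re * (1 / Real.cos θ) ^ w.re * Real.exp (-(θ * w.im)) := by
  have hc : 0 < Real.cos θ := Real.cos_pos_of_mem_Ioo ⟨h1, h2⟩
  have hre : (exp (θ * I)).re = Real.cos θ := exp_ofReal_mul_I_re θ
  have h := integral_cpow_mul_exp_neg_mul hw (r := exp (θ * I)) (by rw [hre]; exact hc)
  have h3 : ‖exp (θ * I) ^ (-w) * Gamma w‖ ≤
      (1 / Real.cos θ) ^ w.re * Real.Gamma w.re := by
    rw [← h, ← Real.integral_rpow_mul_exp_neg_mul_Ioi hw hc]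
    refine (norm_integral_le_integral_norm _).trans_eq ?_
    refine setIntegral_congr_fun measurableSet_Ioi fun t ht => ?_
    rw [norm_cpow_mul_exp ht, hre]
    simp
  have h4 : ‖exp (θ * I) ^ (-w)‖ = Real.exp (θ * w.im) := by
    rw [cpow_def_of_ne_zero (exp_ne_zero _), log_exp (by simp; linarith) (by simp; linarith),
      norm_exp]
    simp
  rw [norm_mul, h4] at h3
  rw [Real.exp_neg, ← div_eq_mul_inv, le_div_iff₀ (Real.exp_pos _)]
  linarith

/-- The sign of θ is chosen to match that of Im w; the remaining factor depends continuously on Re w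
in a compact interval. -/
theorem exists_norm_Gamma_le {a b θ : ℝ} (ha : 0 < a) (h0 : 0 ≤ θ) (h2 : θ < Real.pi / 2) :
    ∃ C : ℝ, 0 ≤ C ∧ ∀ w : ℂ, a ≤ w.re → w.re ≤ b → ‖Gamma w‖ ≤ C * Real.exp (-(θ * |w.im|)) := by
  have hc : 0 < Real.cos θ := Real.cos_pos_of_mem_Ioo ⟨by linarith, h2⟩
  have hcont : ContinuousOn (fun σ : ℝ => Real.Gamma σ * (1 / Real.cos θ) ^ σ) (Set.Icc a b) := by
    refine ContinuousOn.mul (fun σ hσ => ?_) ?_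
    · refine (Real.differentiableAt_Gamma fun m => ?_).continuousAt.continuousWithinAt
      have : 0 < σ := ha.trans_le hσ.1
      have : (0 : ℝ) ≤ m := m.cast_nonneg
      linarith
    · exact (Real.continuous_const_rpow (by positivity)).continuousOn
  obtain ⟨C, hC⟩ := isCompact_Icc.exists_bound_of_continuousOn hcont
  refine ⟨max C 0, le_max_right _ _, fun w hw1 hw2 => ?_⟩
  have hw : 0 < w.re := ha.trans_le hw1
  have h3 : Real.Gamma w.re * (1 / Real.cos θ) ^ w.re ≤ max C 0 :=
    ((le_abs_self _).trans (hC w.re ⟨hw1, hw2⟩)).trans (le_max_left _ _)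
  rcases le_total 0 w.im with h | h
  · rw [abs_of_nonneg h]
    exact (norm_Gamma_le hw (by linarith) h2).trans (by gcongr)
  · rw [abs_of_nonpos h]
    refine (norm_Gamma_le hw (θ := -θ) (by linarith) (by linarith)).trans ?_
    rw [Real.cos_neg, neg_mul, mul_neg]
    gcongr

/-! ### Growth of the reciprocal Gamma function on vertical strips -/

theorem norm_sin_le (z : ℂ) : ‖sin z‖ ≤ Real.exp |z.im| := by
  have h1 : ‖exp (-z * I)‖ ≤ Real.exp |z.im| := by
    rw [norm_exp]
    gcongr
    simpa using le_abs_self z.im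
  have h2 : ‖exp (z * I)‖ ≤ Real.exp |z.im| := by
    rw [norm_exp]
    gcongr
    simpa using neg_le_abs z.im
  rw [sin, norm_div, norm_mul, norm_I]
  have h3 := norm_sub_le (exp (-z * I)) (exp (z * I))
  rw [Complex.norm_two]
  linarith

/-- Each step divides 1/Γ by a factor w+m whose norm is at least |Im w| ≥ 1. -/
theorem norm_inv_Gamma_add_nat_le {w : ℂ} (hw : 1 ≤ |w.im|) (m : ℕ) :
    ‖(Gamma (w + m))⁻¹‖ ≤ ‖(Gamma w)⁻¹‖ := by
  induction m with
  | zero => simp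
  | succ m ih =>
    refine le_trans ?_ ih
    have him : (w + m).im = w.im := by simp
    have h1 : 1 ≤ ‖w + m‖ := (hw.trans_eq (by rw [him])).trans (abs_im_le_norm _)
    rw [one_div_Gamma_eq_self_mul_one_div_Gamma_add_one (w + m), norm_mul, Nat.cast_succ,
      ← add_assoc]
    exact le_mul_of_one_le_left (norm_nonneg _) h1

theorem inv_Gamma_eq {w : ℂ} (hw : w.im ≠ 0) :
    (Gamma w)⁻¹ = Gamma (1 - w) * sin (Real.pi * w) / Real.pi := by
  have hpi : (Real.pi : ℂ) ≠ 0 := by exact_mod_cast Real.pi_ne_zero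
  have h : sin (Real.pi * w) ≠ 0 := by
    intro h
    obtain ⟨k, hk⟩ := sin_eq_zero_iff.1 h
    rw [mul_comm] at hk
    exact hw (by rw [mul_right_cancel₀ hpi hk]; exact intCast_im k)
  have h1 := Gamma_mul_Gamma_one_sub w
  have h2 : Gamma w ≠ 0 := by
    intro h0
    rw [h0, zero_mul, eq_comm, div_eq_zero_iff] at h1
    tauto
  rw [eq_div_iff h] at h1
  rw [inv_eq_one_div, div_eq_div_iff h2 hpi, one_mul]
  linear_combination -h1

/-- Reflection gives 1/Γ(w) = Γ(1-w) sin(πw)/π: the sine grows like exp(π|Im w|) and Γ gains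
exp(-θ|Im w|). The part |Im w| ≤ 1 of the strip is compact and treated separately. -/
theorem exists_norm_inv_Gamma_le {a b θ : ℝ} (h0 : 0 ≤ θ) (h2 : θ < Real.pi / 2) :
    ∃ C : ℝ, 0 ≤ C ∧ ∀ w : ℂ, a ≤ w.re → w.re ≤ b →
      ‖(Gamma w)⁻¹‖ ≤ C * Real.exp ((Real.pi - θ) * |w.im|) := by
  -- Replacing w by w-m with m > b puts the reflected argument 1-(w-m) in the right half-plane,
  -- where the Gamma bound applies.
  obtain ⟨m, hm⟩ := exists_nat_gt b
  obtain ⟨C₁, hC₁, H₁⟩ := exists_norm_Gamma_le (a := 1 + m - b) (b := 1 + m - a)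
    (by linarith) h0 h2
  have hK : IsCompact (Set.Icc a b ×ℂ Set.Icc (-1) 1) := isCompact_Icc.reProdIm isCompact_Icc
  obtain ⟨C₂, hC₂⟩ := hK.exists_bound_of_continuousOn
    differentiable_one_div_Gamma.continuous.continuousOn
  refine ⟨max C₁ C₂, le_max_of_le_left hC₁, fun w hw1 hw2 => ?_⟩
  have hθ : 0 < Real.pi - θ := by linarith [Real.pi_pos]
  rcases le_total |w.im| 1 with h | h
  · have h3 : ‖(Gamma w)⁻¹‖ ≤ C₂ := hC₂ w ⟨⟨hw1, hw2⟩, abs_le.1 h⟩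
    refine (h3.trans (le_max_right C₁ _)).trans
      (le_mul_of_one_le_right (le_max_of_le_left hC₁) ?_)
    exact Real.one_le_exp (by positivity)
  · have h3 := norm_inv_Gamma_add_nat_le (w := w - m) (by simpa using h) m
    rw [sub_add_cancel] at h3
    refine h3.trans ?_
    have him : w.im ≠ 0 := fun h0 => by rw [h0, abs_zero] at h; linarith
    rw [inv_Gamma_eq (by simpa using him), norm_div, norm_mul, norm_real, Real.norm_of_nonneg Real.pi_pos.le]
    have h5 := H₁ (1 - (w - m)) (by simp; linarith) (by simp; linarith)
    have h6 := norm_sin_le (Real.pi * (w - m))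
    have h7 : |(1 - (w - (m : ℂ))).im| = |w.im| := by simp
    have h8 : |((Real.pi : ℂ) * (w - (m : ℂ))).im| = Real.pi * |w.im| := by
      simp [abs_mul, abs_of_pos Real.pi_pos]
    rw [h7] at h5
    rw [h8] at h6
    calc ‖Gamma (1 - (w - m))‖ * ‖sin (Real.pi * (w - m))‖ / Real.pi
        ≤ C₁ * Real.exp (-(θ * |w.im|)) * Real.exp (Real.pi * |w.im|) / 1 := by
          gcongr
          linarith [Real.pi_gt_three]
      _ = C₁ * Real.exp ((Real.pi - θ) * |w.im|) := by
          rw [div_one, mul_assoc, ← Real.exp_add]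
          congr 2
          ring
      _ ≤ _ := by gcongr; exact le_max_left _ _

/-! ### Shifting a vertical contour -/

theorem integrable_exp_neg_mul_abs {δ : ℝ} (hδ : 0 < δ) :
    Integrable fun y : ℝ => Real.exp (-(δ * |y|)) := by
  have h1 : IntegrableOn (fun y : ℝ => Real.exp (-(δ * |y|))) (Set.Ioi 0) := by
    refine (integrableOn_exp_mul_Ioi (a := -δ) (by linarith) 0).congr_fun (fun y hy => ?_)
      measurableSet_Ioi
    beta_reduce
    rw [abs_of_pos hy, neg_mul]
  have h2 : IntegrableOn (fun y : ℝ => Real.exp (-(δ * |y|))) (Set.Iic 0) := by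
    refine (integrableOn_exp_mul_Iic hδ 0).congr_fun (fun y hy => ?_) measurableSet_Iic
    beta_reduce
    rw [abs_of_nonpos hy, mul_neg, neg_neg]
  rw [← integrableOn_univ, ← Set.Iic_union_Ioi (a := (0 : ℝ))]
  exact h2.union h1

theorem tendsto_exp_neg_mul_atTop {δ : ℝ} (hδ : 0 < δ) (C : ℝ) :
    Filter.Tendsto (fun T : ℝ => C * Real.exp (-(δ * T))) Filter.atTop (𝓝 0) := by
  have h : Filter.Tendsto (fun T : ℝ => Real.exp (-(δ * T))) Filter.atTop (𝓝 0) :=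
    Real.tendsto_exp_neg_atTop_nhds_zero.comp (Filter.tendsto_id.const_mul_atTop hδ)
  simpa using h.const_mul C

theorem integrable_vertical {F : ℂ → ℂ} {σ C δ : ℝ} (hδ : 0 < δ)
    (hd : ∀ z : ℂ, z.re = σ → DifferentiableAt ℂ F z)
    (hb : ∀ y : ℝ, ‖F (σ + y * I)‖ ≤ C * Real.exp (-(δ * |y|))) :
    Integrable fun y : ℝ => F (σ + y * I) := by
  refine ((integrable_exp_neg_mul_abs hδ).const_mul C).mono' ?_ (Filter.Eventually.of_forall hb)
  refine Continuous.aestronglyMeasurable (continuous_iff_continuousAt.2 fun y => ?_)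
  exact ContinuousAt.comp (g := F) (hd _ (by simp)).continuousAt (by fun_prop)

/-- Cauchy's theorem on rectangles of height 2T: the exponential bound kills the horizontal sides as
T → ∞. -/
theorem integral_vertical_eq {F : ℂ → ℂ} {σ₁ σ₂ C δ : ℝ} (hσ : σ₁ ≤ σ₂) (hδ : 0 < δ)
    (hd : ∀ z : ℂ, σ₁ ≤ z.re → z.re ≤ σ₂ → DifferentiableAt ℂ F z)
    (hb : ∀ σ y : ℝ, σ₁ ≤ σ → σ ≤ σ₂ → ‖F (σ + y * I)‖ ≤ C * Real.exp (-(δ * |y|))) :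
    ∫ y : ℝ, F (σ₁ + y * I) = ∫ y : ℝ, F (σ₂ + y * I) := by
  have hv : ∀ σ, σ₁ ≤ σ → σ ≤ σ₂ → Filter.Tendsto
      (fun T : ℝ => ∫ y in -T..T, F (σ + y * I)) Filter.atTop (𝓝 (∫ y : ℝ, F (σ + y * I))) :=
    fun σ h1 h2 => intervalIntegral_tendsto_integral
      (integrable_vertical hδ (fun z hz => hd z (hz ▸ h1) (hz ▸ h2)) fun y => hb σ y h1 h2)
      Filter.tendsto_neg_atTop_atBot Filter.tendsto_id
  have hh : ∀ ε : ℝ, |ε| = 1 → Filter.Tendsto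
      (fun T : ℝ => ∫ x in σ₁..σ₂, F (x + ((ε * T : ℝ) : ℂ) * I)) Filter.atTop (𝓝 0) := by
    intro ε hε
    refine squeeze_zero_norm' ?_ (tendsto_exp_neg_mul_atTop hδ (C * |σ₂ - σ₁|))
    filter_upwards [Filter.eventually_ge_atTop 0] with T hT
    have h3 : ∀ x ∈ Set.uIoc σ₁ σ₂, ‖F (x + ((ε * T : ℝ) : ℂ) * I)‖ ≤
        C * Real.exp (-(δ * T)) := by
      intro x hx
      rw [Set.uIoc_of_le hσ] at hx
      have := hb x (ε * T) hx.1.le hx.2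
      rwa [abs_mul, hε, one_mul, abs_of_nonneg hT] at this
    refine (intervalIntegral.norm_integral_le_of_norm_le_const h3).trans_eq ?_
    ring
  have hz : ∀ T : ℝ, (∫ x in σ₁..σ₂, F (x + ((-1 * T : ℝ) : ℂ) * I)) -
      (∫ x in σ₁..σ₂, F (x + ((1 * T : ℝ) : ℂ) * I)) +
      I • (∫ y in -T..T, F (σ₂ + y * I)) - I • (∫ y in -T..T, F (σ₁ + y * I)) = 0 := by
    intro T
    have := integral_boundary_rect_eq_zero_of_differentiableOn F (⟨σ₁, -T⟩ : ℂ) ⟨σ₂, T⟩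
      (fun z hz => (hd z ?_ ?_).differentiableWithinAt)
    · simpa using this
    · have := hz.1
      simp only [Set.uIcc_of_le hσ] at this
      exact this.1
    · have := hz.1
      simp only [Set.uIcc_of_le hσ] at this
      exact this.2
  have hlim := (((hh (-1) (by simp)).sub (hh 1 (by simp))).add
    ((hv σ₂ hσ le_rfl).const_smul I)).sub ((hv σ₁ le_rfl hσ).const_smul I)
  simp_rw [hz] at hlim
  have h4 := tendsto_nhds_unique hlim tendsto_const_nhds
  rw [sub_zero, zero_add, ← smul_sub, smul_eq_zero] at h4
  exact (sub_eq_zero.1 (h4.resolve_left I_ne_zero)).symm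

noncomputable section

/-! ### The Mellin-Barnes integral of `H^{2,0}_{1,2}` -/

/-- The kernel `Γ(b₁ - ζ) Γ(b₂ - ζ) / Γ(1 - α ζ)`. -/
def foxF (α b₁ b₂ : ℝ) (ζ : ℂ) : ℂ :=
  Gamma (b₁ - ζ) * Gamma (b₂ - ζ) * (Gamma (1 - α * ζ))⁻¹

theorem foxKernel_eq (α b₁ b₂ : ℝ) (ζ : ℂ) :
    foxKernel 2 0 ![1] ![α] ![b₁, b₂] ![1, 1] ζ = foxF α b₁ b₂ ζ := by
  have h1 : (Finset.univ.filter fun j : Fin 2 => j.val < 2) = Finset.univ := by decide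
  have h2 : (Finset.univ.filter fun j : Fin 2 => 2 ≤ j.val) = ∅ := by decide
  have h3 : (Finset.univ.filter fun j : Fin 1 => j.val < 0) = ∅ := by decide
  have h4 : (Finset.univ.filter fun j : Fin 1 => 0 ≤ j.val) = Finset.univ := by decide
  unfold foxKernel foxF
  rw [h1, h2, h3, h4]
  simp [Fin.prod_univ_two, div_eq_mul_inv]

theorem FoxAdmissible.lt {α b₁ b₂ γ : ℝ}
    (h : FoxAdmissible 2 0 ![1] ![α] ![b₁, b₂] ![1, 1] γ) : γ < b₁ ∧ γ < b₂ := by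
  have h0 := h.1 0 (by simp) 0
  have h1 := h.1 1 (by simp) 0
  simp at h0 h1
  exact ⟨h0, h1⟩

theorem differentiableAt_Gamma_sub {b : ℝ} {ζ : ℂ} (h : ζ.re < b) :
    DifferentiableAt ℂ (fun ζ : ℂ => Gamma (b - ζ)) ζ := by
  have h1 : DifferentiableAt ℂ Gamma (b - ζ) := by
    refine differentiableAt_Gamma _ fun m hm => ?_
    have := congrArg re hm
    simp at this
    have : (0 : ℝ) ≤ m := m.cast_nonneg
    linarith
  exact DifferentiableAt.comp (g := Gamma) ζ h1 (by fun_prop)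

theorem differentiableAt_foxF {α b₁ b₂ : ℝ} {ζ : ℂ} (h₁ : ζ.re < b₁) (h₂ : ζ.re < b₂) :
    DifferentiableAt ℂ (foxF α b₁ b₂) ζ := by
  refine ((differentiableAt_Gamma_sub h₁).mul (differentiableAt_Gamma_sub h₂)).mul ?_
  exact DifferentiableAt.comp (g := fun w : ℂ => (Gamma w)⁻¹) ζ
    (differentiable_one_div_Gamma _) (by fun_prop)

theorem exists_pow_le_exp {c δ : ℝ} (hc : 0 ≤ c) (hδ : 0 < δ) (N : ℕ) :
    ∃ C : ℝ, 0 ≤ C ∧ ∀ y : ℝ, 0 ≤ y → (c + y) ^ N ≤ C * Real.exp (δ * y) := by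
  refine ⟨N.factorial * (δ⁻¹) ^ N * Real.exp (δ * c), by positivity, fun y hy => ?_⟩
  have h := Real.pow_div_factorial_le_exp (δ * (c + y)) (by positivity) N
  rw [div_le_iff₀ (by positivity), mul_pow] at h
  have h1 : (δ⁻¹) ^ N * (δ ^ N * (c + y) ^ N) = (c + y) ^ N := by
    rw [← mul_assoc, ← mul_pow, inv_mul_cancel₀ hδ.ne', one_pow, one_mul]
  rw [← h1]
  calc (δ⁻¹) ^ N * (δ ^ N * (c + y) ^ N)
      ≤ (δ⁻¹) ^ N * (Real.exp (δ * (c + y)) * N.factorial) := by gcongr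
    _ = _ := by rw [mul_add, Real.exp_add]; ring

theorem exists_norm_foxF_le {α b₁ b₂ γ₁ γ₂ : ℝ} (hα : 0 < α) (hα2 : α < 2) (h₁ : γ₂ < b₁)
    (h₂ : γ₂ < b₂) : ∃ C δ : ℝ, 0 ≤ C ∧ 0 < δ ∧ ∀ ζ : ℂ, γ₁ ≤ ζ.re → ζ.re ≤ γ₂ →
      ‖foxF α b₁ b₂ ζ‖ ≤ C * Real.exp (-(δ * |ζ.im|)) := by
  -- With θ = π/2-ε the three factors give the rate π(1-α/2) - 2ε - αε = (6-α)ε, which exceeds 4ε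
  -- because α < 2.
  set ε := Real.pi * (1 - α / 2) / 8 with hε
  have hε0 : 0 < ε := by
    have := Real.pi_pos
    have : 0 < 1 - α / 2 := by linarith
    positivity
  have hε1 : ε < Real.pi / 2 := by nlinarith [Real.pi_pos]
  obtain ⟨C₁, hC₁, H₁⟩ := exists_norm_Gamma_le (a := b₁ - γ₂) (b := b₁ - γ₁)
    (θ := Real.pi / 2 - ε) (by linarith) (by linarith) (by linarith)
  obtain ⟨C₂, hC₂, H₂⟩ := exists_norm_Gamma_le (a := b₂ - γ₂) (b := b₂ - γ₁)
    (θ := Real.pi / 2 - ε) (by linarith) (by linarith) (by linarith)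
  obtain ⟨C₃, hC₃, H₃⟩ := exists_norm_inv_Gamma_le (a := 1 - α * γ₂) (b := 1 - α * γ₁)
    (θ := Real.pi / 2 - ε) (by linarith) (by linarith)
  refine ⟨C₁ * C₂ * C₃, 4 * ε, by positivity, by positivity, fun ζ h3 h4 => ?_⟩
  have e1 := H₁ (b₁ - ζ) (by simp; linarith) (by simp; linarith)
  have e2 := H₂ (b₂ - ζ) (by simp; linarith) (by simp; linarith)
  have e3 := H₃ (1 - α * ζ) (by simp; nlinarith) (by simp; nlinarith)
  have i1 : |((b₁ : ℂ) - ζ).im| = |ζ.im| := by simp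
  have i2 : |((b₂ : ℂ) - ζ).im| = |ζ.im| := by simp
  have i3 : |(1 - (α : ℂ) * ζ).im| = α * |ζ.im| := by simp [abs_mul, abs_of_pos hα]
  rw [i1] at e1
  rw [i2] at e2
  rw [i3] at e3
  rw [foxF, norm_mul, norm_mul]
  calc ‖Gamma (b₁ - ζ)‖ * ‖Gamma (b₂ - ζ)‖ * ‖(Gamma (1 - α * ζ))⁻¹‖
      ≤ (C₁ * Real.exp (-((Real.pi / 2 - ε) * |ζ.im|))) *
        (C₂ * Real.exp (-((Real.pi / 2 - ε) * |ζ.im|))) *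
        (C₃ * Real.exp ((Real.pi - (Real.pi / 2 - ε)) * (α * |ζ.im|))) := by gcongr
    _ = C₁ * C₂ * C₃ * Real.exp (-((8 * ε - 2 * ε - α * ε) * |ζ.im|)) := by
        have h8 : 8 * ε = Real.pi * (1 - α / 2) := by rw [hε]; ring
        rw [h8]
        have : -((Real.pi * (1 - α / 2) - 2 * ε - α * ε) * |ζ.im|) =
          -((Real.pi / 2 - ε) * |ζ.im|) + -((Real.pi / 2 - ε) * |ζ.im|) +
            (Real.pi - (Real.pi / 2 - ε)) * (α * |ζ.im|) := by ring
        rw [this, Real.exp_add, Real.exp_add]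
        ring
    _ ≤ _ := by
        gcongr
        nlinarith

/-- Half of the exponential rate is spent on absorbing the polynomial weight. -/
theorem exists_norm_foxF_mul_pow_le {α b₁ b₂ γ₁ γ₂ : ℝ} (hα : 0 < α) (hα2 : α < 2)
    (h₁ : γ₂ < b₁) (h₂ : γ₂ < b₂) (N : ℕ) : ∃ C δ : ℝ, 0 ≤ C ∧ 0 < δ ∧
      ∀ ζ : ℂ, γ₁ ≤ ζ.re → ζ.re ≤ γ₂ →
        ‖foxF α b₁ b₂ ζ‖ * (1 + ‖ζ‖) ^ N ≤ C * Real.exp (-(δ * |ζ.im|)) := by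
  obtain ⟨C, δ, hC, hδ, H⟩ := exists_norm_foxF_le (γ₁ := γ₁) hα hα2 h₁ h₂
  obtain ⟨C', hC', H'⟩ := exists_pow_le_exp (c := 1 + (|γ₁| + |γ₂|)) (δ := δ / 2)
    (by positivity) (by positivity) N
  refine ⟨C * C', δ / 2, by positivity, by positivity, fun ζ h3 h4 => ?_⟩
  have h5 : ‖ζ‖ ≤ (|γ₁| + |γ₂|) + |ζ.im| := by
    refine (norm_le_abs_re_add_abs_im ζ).trans (add_le_add_left (abs_le.2 ⟨?_, ?_⟩) _)
    · linarith [neg_abs_le γ₁, abs_nonneg γ₂]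
    · linarith [le_abs_self γ₂, abs_nonneg γ₁]
  calc ‖foxF α b₁ b₂ ζ‖ * (1 + ‖ζ‖) ^ N
      ≤ (C * Real.exp (-(δ * |ζ.im|))) * (C' * Real.exp (δ / 2 * |ζ.im|)) := by
        have h6 : (1 + ‖ζ‖) ^ N ≤ (1 + (|γ₁| + |γ₂|) + |ζ.im|) ^ N := by
          exact pow_le_pow_left₀ (by positivity) (by linarith) N
        gcongr
        · exact H ζ h3 h4
        · exact h6.trans (H' _ (abs_nonneg _))
    _ = C * C' * (Real.exp (-(δ * |ζ.im|)) * Real.exp (δ / 2 * |ζ.im|)) := by ring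
    _ = _ := by
        rw [← Real.exp_add]
        congr 2
        ring

theorem rpow_le_add_of_mem {x σ γ₁ γ₂ : ℝ} (hx : 0 < x) (h1 : γ₁ ≤ σ) (h2 : σ ≤ γ₂) :
    x ^ σ ≤ x ^ γ₁ + x ^ γ₂ := by
  have e1 := Real.rpow_pos_of_pos hx γ₁
  have e2 := Real.rpow_pos_of_pos hx γ₂
  rcases le_total 1 x with h | h
  · linarith [Real.rpow_le_rpow_of_exponent_le h h2]
  · linarith [Real.rpow_le_rpow_of_exponent_ge hx h h1]

theorem exists_norm_fox_integrand_le {α b₁ b₂ γ₁ γ₂ x D : ℝ} {P : ℂ → ℂ} {N : ℕ} (hα : 0 < α)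
    (hα2 : α < 2) (h₁ : γ₂ < b₁) (h₂ : γ₂ < b₂) (hx : 0 < x)
    (hP : ∀ ζ, ‖P ζ‖ ≤ D * (1 + ‖ζ‖) ^ N) :
    ∃ C δ : ℝ, 0 < δ ∧ ∀ σ y : ℝ, γ₁ ≤ σ → σ ≤ γ₂ →
      ‖P (σ + y * I) * (foxF α b₁ b₂ (σ + y * I) * (x : ℂ) ^ ((σ : ℂ) + y * I))‖ ≤
        C * Real.exp (-(δ * |y|)) := by
  obtain ⟨C, δ, hC, hδ, H⟩ := exists_norm_foxF_mul_pow_le (γ₁ := γ₁) hα hα2 h₁ h₂ N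
  have hD : 0 ≤ D := by simpa using (norm_nonneg _).trans (hP 0)
  refine ⟨D * C * (x ^ γ₁ + x ^ γ₂), δ, hδ, fun σ y h3 h4 => ?_⟩
  have h5 := H (σ + y * I) (by simpa using h3) (by simpa using h4)
  have h6 : ((σ : ℂ) + y * I).im = y := by simp
  have h7 : ((σ : ℂ) + y * I).re = σ := by simp
  rw [h6] at h5
  rw [norm_mul, norm_mul, norm_cpow_eq_rpow_re_of_pos hx, h7]
  calc ‖P (σ + y * I)‖ * (‖foxF α b₁ b₂ (σ + y * I)‖ * x ^ σ)
      ≤ (D * (1 + ‖(σ : ℂ) + y * I‖) ^ N) * (‖foxF α b₁ b₂ (σ + y * I)‖ *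
          (x ^ γ₁ + x ^ γ₂)) := by
        gcongr
        · exact hP _
        · exact rpow_le_add_of_mem hx h3 h4
    _ = D * (‖foxF α b₁ b₂ (σ + y * I)‖ * (1 + ‖(σ : ℂ) + y * I‖) ^ N) *
          (x ^ γ₁ + x ^ γ₂) := by ring
    _ ≤ D * (C * Real.exp (-(δ * |y|))) * (x ^ γ₁ + x ^ γ₂) := by
        have := Real.rpow_nonneg hx.le γ₁
        have := Real.rpow_nonneg hx.le γ₂
        gcongr
    _ = _ := by ring

theorem differentiableAt_fox_integrand {α b₁ b₂ x : ℝ} {P : ℂ → ℂ} {ζ : ℂ}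
    (hP : Differentiable ℂ P) (h₁ : ζ.re < b₁) (h₂ : ζ.re < b₂) (hx : 0 < x) :
    DifferentiableAt ℂ (fun ζ => P ζ * (foxF α b₁ b₂ ζ * (x : ℂ) ^ ζ)) ζ := by
  have hx0 : (x : ℂ) ≠ 0 := by exact_mod_cast hx.ne'
  exact (hP ζ).mul ((differentiableAt_foxF h₁ h₂).mul
    (differentiableAt_id.const_cpow (Or.inl hx0)))

theorem integrable_fox {α b₁ b₂ γ x D : ℝ} {P : ℂ → ℂ} {N : ℕ} (hα : 0 < α)
    (hα2 : α < 2) (h₁ : γ < b₁) (h₂ : γ < b₂) (hx : 0 < x) (hPd : Differentiable ℂ P)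
    (hP : ∀ ζ, ‖P ζ‖ ≤ D * (1 + ‖ζ‖) ^ N) :
    Integrable fun y : ℝ =>
      P (γ + y * I) * (foxF α b₁ b₂ (γ + y * I) * (x : ℂ) ^ ((γ : ℂ) + y * I)) := by
  obtain ⟨C, δ, hδ, H⟩ := exists_norm_fox_integrand_le (γ₁ := γ) hα hα2 h₁ h₂ hx hP
  exact integrable_vertical (F := fun ζ => P ζ * (foxF α b₁ b₂ ζ * (x : ℂ) ^ ζ)) hδ
    (fun z hz => differentiableAt_fox_integrand hPd (hz ▸ h₁) (hz ▸ h₂) hx)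
    fun y => H γ y le_rfl le_rfl

theorem integral_fox_eq {α b₁ b₂ γ₁ γ₂ x D : ℝ} {P : ℂ → ℂ} {N : ℕ} (hα : 0 < α)
    (hα2 : α < 2) (hγ : γ₁ ≤ γ₂) (h₁ : γ₂ < b₁) (h₂ : γ₂ < b₂) (hx : 0 < x)
    (hPd : Differentiable ℂ P) (hP : ∀ ζ, ‖P ζ‖ ≤ D * (1 + ‖ζ‖) ^ N) :
    ∫ y : ℝ, P (γ₁ + y * I) * (foxF α b₁ b₂ (γ₁ + y * I) * (x : ℂ) ^ ((γ₁ : ℂ) + y * I)) =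
      ∫ y : ℝ, P (γ₂ + y * I) * (foxF α b₁ b₂ (γ₂ + y * I) * (x : ℂ) ^ ((γ₂ : ℂ) + y * I)) := by
  obtain ⟨C, δ, hδ, H⟩ := exists_norm_fox_integrand_le (γ₁ := γ₁) hα hα2 h₁ h₂ hx hP
  exact integral_vertical_eq (F := fun ζ => P ζ * (foxF α b₁ b₂ ζ * (x : ℂ) ^ ζ)) hγ hδ
    (fun z _ hz => differentiableAt_fox_integrand hPd (hz.trans_lt h₁) (hz.trans_lt h₂) hx) H

/-! ### The profile of the Fox solution -/

/-- The similarity profile `K ∫ foxF(γ + i y) (1 / (4 z^α))^(γ + i y) dy`. -/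
def foxProfile (α b₁ b₂ γ : ℝ) (K : ℂ) (z : ℝ) : ℂ :=
  ∫ y : ℝ, K * (foxF α b₁ b₂ (γ + y * I) * ((1 / (4 * z ^ α) : ℝ) : ℂ) ^ ((γ : ℂ) + y * I))

/-- Independence of the contour. It is needed because an admissible γ may be so large that Re p =
-αγ ≤ -1, where the fractional integral cannot be taken termwise. -/
theorem foxProfile_eq {α b₁ b₂ γ₁ γ₂ z : ℝ} (K : ℂ) (hα : 0 < α) (hα2 : α < 2) (hγ : γ₁ ≤ γ₂)
    (h₁ : γ₂ < b₁) (h₂ : γ₂ < b₂) (hz : 0 < z) :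
    foxProfile α b₁ b₂ γ₁ K z = foxProfile α b₁ b₂ γ₂ K z :=
  integral_fox_eq (P := fun _ => K) (N := 0) (D := ‖K‖) hα hα2 hγ h₁ h₂
    (by have := Real.rpow_pos_of_pos hz α; positivity) (differentiable_const K) (by simp)

theorem foxProfile_arg_cpow {α z : ℝ} (hz : 0 < z) (ζ : ℂ) :
    ((1 / (4 * z ^ α) : ℝ) : ℂ) ^ ζ = ((1 / 4 : ℝ) : ℂ) ^ ζ * (z : ℂ) ^ (-(α * ζ)) := by
  have h1 : 1 / (4 * z ^ α) = (1 / 4) * z ^ (-α) := by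
    rw [Real.rpow_neg hz.le]
    field_simp
  rw [h1, ofReal_mul, mul_cpow_ofReal_nonneg (by norm_num) (Real.rpow_nonneg hz.le _),
    ofReal_cpow hz.le, ← cpow_mul]
  · push_cast
    ring_nf
  · rw [← ofReal_log hz.le, ← ofReal_mul, ofReal_im]
    exact neg_lt_zero.2 Real.pi_pos
  · rw [← ofReal_log hz.le, ← ofReal_mul, ofReal_im]
    exact Real.pi_pos.le

/-- The numerator of the Mellin-Barnes integrand, without the power of `z`. -/
def foxAmp (b₁ b₂ : ℝ) (K : ℂ) (ζ : ℂ) : ℂ :=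
  K * (Gamma (b₁ - ζ) * Gamma (b₂ - ζ) * ((1 / 4 : ℝ) : ℂ) ^ ζ)

theorem foxAmp_div (α b₁ b₂ : ℝ) (K ζ : ℂ) :
    foxAmp b₁ b₂ K ζ / Gamma (-(α * ζ) + 1) =
      K * (foxF α b₁ b₂ ζ * ((1 / 4 : ℝ) : ℂ) ^ ζ) := by
  rw [foxAmp, foxF, neg_add_eq_sub]
  ring

theorem foxProfile_eq_superpos {α b₁ b₂ γ z : ℝ} {K : ℂ} (hz : 0 < z) :
    foxProfile α b₁ b₂ γ K z = superpos volume
      (fun y : ℝ => foxAmp b₁ b₂ K (γ + y * I) / Gamma (-(α * (γ + y * I)) + 1))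
      (fun y : ℝ => -(α * (γ + y * I))) z := by
  unfold foxProfile superpos
  refine integral_congr_ae (Filter.Eventually.of_forall fun y => ?_)
  beta_reduce
  rw [foxAmp_div, foxProfile_arg_cpow hz]
  ring

theorem measurable_foxAmp {b₁ b₂ γ : ℝ} {K : ℂ} (h₁ : γ < b₁) (h₂ : γ < b₂) :
    AEStronglyMeasurable (fun y : ℝ => foxAmp b₁ b₂ K (γ + y * I)) volume := by
  refine Continuous.aestronglyMeasurable (continuous_iff_continuousAt.2 fun y => ?_)
  have hre : ((γ : ℂ) + y * I).re = γ := by simp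
  have h : DifferentiableAt ℂ (foxAmp b₁ b₂ K) (γ + y * I) :=
    (differentiableAt_const K).mul (((differentiableAt_Gamma_sub (by rwa [hre])).mul
      (differentiableAt_Gamma_sub (by rwa [hre]))).mul
        (differentiableAt_id.const_cpow (Or.inl (by norm_num))))
  exact ContinuousAt.comp (g := foxAmp b₁ b₂ K) h.continuousAt (by fun_prop)

theorem superposGood_fox {α b₁ b₂ γ R : ℝ} (K : ℂ) (hα : 0 < α) (hα2 : α < 2) (h₁ : γ < b₁)
    (h₂ : γ < b₂) : SuperposGood volume
      (fun y : ℝ => foxAmp b₁ b₂ K (γ + y * I) / Gamma (-(α * (γ + y * I)) + 1))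
      (fun y : ℝ => -(α * (γ + y * I))) R := by
  have hm : Measurable fun y : ℝ => -((α : ℂ) * (γ + y * I)) := by fun_prop
  have ha : AEStronglyMeasurable
      (fun y : ℝ => foxAmp b₁ b₂ K (γ + y * I) / Gamma (-(α * (γ + y * I)) + 1)) volume := by
    simp_rw [div_eq_mul_inv]
    exact (measurable_foxAmp h₁ h₂).mul
      (measurable_one_div_Gamma.comp (hm.add_const 1)).aestronglyMeasurable
  refine ⟨ha, hm, fun N z hz _ => ?_⟩
  obtain ⟨C, δ, hC, hδ, H⟩ := exists_norm_foxF_mul_pow_le (γ₁ := γ) hα hα2 h₁ h₂ N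
  refine ((integrable_exp_neg_mul_abs hδ).const_mul
    (‖K‖ * (1 / 4) ^ γ * (1 + α) ^ N * z ^ (-(α * γ)) * C)).mono' ?_
    (Filter.Eventually.of_forall fun y => ?_)
  · exact (ha.norm.mul ((measurable_const.add hm.norm).pow_const N).aestronglyMeasurable).mul
      (measurable_const.pow (measurable_re.comp hm)).aestronglyMeasurable
  · have hre : ((γ : ℂ) + y * I).re = γ := by simp
    have h5 := H (γ + y * I) hre.ge hre.le
    have h6 : ((γ : ℂ) + y * I).im = y := by simp
    have h7 : (-((α : ℂ) * (γ + y * I))).re = -(α * γ) := by simp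
    have h8 : ‖-((α : ℂ) * (γ + y * I))‖ = α * ‖(γ : ℂ) + y * I‖ := by
      rw [norm_neg, norm_mul, norm_real, Real.norm_of_nonneg hα.le]
    have hz1 := Real.rpow_pos_of_pos hz (-(α * γ))
    rw [h6] at h5
    rw [Real.norm_of_nonneg (by positivity), foxAmp_div, norm_mul, norm_mul,
      norm_cpow_eq_rpow_re_of_pos (by norm_num), hre, h7, h8]
    have h9 : (1 + α * ‖(γ : ℂ) + y * I‖) ^ N ≤ ((1 + α) * (1 + ‖(γ : ℂ) + y * I‖)) ^ N := by
      gcongr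
      nlinarith [norm_nonneg ((γ : ℂ) + y * I)]
    have h10 : (0 : ℝ) ≤ (1 / 4 : ℝ) ^ γ := Real.rpow_nonneg (by norm_num) _
    calc ‖K‖ * (‖foxF α b₁ b₂ (γ + y * I)‖ * (1 / 4 : ℝ) ^ γ) *
          (1 + α * ‖(γ : ℂ) + y * I‖) ^ N * z ^ (-(α * γ))
        ≤ ‖K‖ * (‖foxF α b₁ b₂ (γ + y * I)‖ * (1 / 4 : ℝ) ^ γ) *
          ((1 + α) * (1 + ‖(γ : ℂ) + y * I‖)) ^ N * z ^ (-(α * γ)) := by gcongr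
      _ = ‖K‖ * (1 / 4 : ℝ) ^ γ * (1 + α) ^ N * z ^ (-(α * γ)) *
          (‖foxF α b₁ b₂ (γ + y * I)‖ * (1 + ‖(γ : ℂ) + y * I‖) ^ N) := by
        rw [mul_pow]
        ring
      _ ≤ ‖K‖ * (1 / 4 : ℝ) ^ γ * (1 + α) ^ N * z ^ (-(α * γ)) *
          (C * Real.exp (-(δ * |y|))) := by gcongr
      _ = _ := by ring

/-! ### The Euler equation for the Fox profile -/

theorem Gamma_sub_shift {b : ℝ} {ζ : ℂ} (h : ζ.re + 1 < b) :
    Gamma (b - ζ) = (b - (ζ + 1)) * Gamma (b - (ζ + 1)) := by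
  have h1 : (b : ℂ) - (ζ + 1) ≠ 0 := by
    intro h0
    have := congrArg re h0
    simp at this
    linarith
  rw [← Gamma_add_one _ h1]
  congr 1
  ring

theorem fox_euler_polynomial {α s μ : ℝ} (hα : 0 < α) (ζ : ℂ) :
    ((s * (s - μ) : ℝ) : ℂ) + ((2 / α * (2 / α - 2 * s + μ) : ℝ) : ℂ) * (-(α * ζ)) +
      ((4 / α ^ 2 : ℝ) : ℂ) * (-(α * ζ) * (-(α * ζ) - 1)) =
    4 * (((-s / 2 : ℝ) : ℂ) - ζ) * (((-s / 2 + μ / 2 : ℝ) : ℂ) - ζ) := by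
  have h3 : (α : ℂ) ≠ 0 := by exact_mod_cast hα.ne'
  push_cast
  field_simp
  ring

/-- The fractional derivative produces the integral of 4(b₁-ζ)(b₂-ζ) times the original integrand
along Re ζ = γ+1, the Euler operator the same integral along Re ζ = γ. No pole lies between the two
lines since γ+1 < min(b₁,b₂). -/
theorem isEulerSolutionAt_superpos_fox {α s μ γ z : ℝ} (K : ℂ) (hα : 0 < α) (hα2 : α < 2)
    (hγ : γ ≤ 0) (h₁ : γ + 1 < -s / 2) (h₂ : γ + 1 < -s / 2 + μ / 2) (hz : 0 < z) :
    IsEulerSolutionAt α (s * (s - μ)) (2 / α * (2 / α - 2 * s + μ)) (4 / α ^ 2)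
      (superpos volume (fun y : ℝ => foxAmp (-s / 2) (-s / 2 + μ / 2) K (γ + y * I) /
        Gamma (-(α * (γ + y * I)) + 1)) (fun y : ℝ => -(α * (γ + y * I)))) z := by
  set b₁ := -s / 2 with hb₁
  set b₂ := -s / 2 + μ / 2 with hb₂
  have hx : 0 < 1 / (4 * z ^ α) := by
    have := Real.rpow_pos_of_pos hz α
    positivity
  -- Here γ ≤ 0 gives Re p = -αγ ≥ 0, so p₀ = 0 is a valid lower bound.
  refine (superposGood_fox (R := z + 1) K hα hα2 (by linarith)
    (by linarith)).isEulerSolutionAt (p₀ := 0) (measurable_foxAmp (by linarith) (by linarith))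
    (by norm_num) (fun y => by simp; nlinarith) hz (by linarith) ?_
  have hP : ∀ ζ : ℂ, ‖K * (4 * (b₁ - ζ) * (b₂ - ζ))‖ ≤
      (4 * ‖K‖ * (1 + |b₁|) * (1 + |b₂|)) * (1 + ‖ζ‖) ^ 2 := by
    intro ζ
    have e1 : ‖(b₁ : ℂ) - ζ‖ ≤ (1 + |b₁|) * (1 + ‖ζ‖) := by
      refine (norm_sub_le _ _).trans ?_
      rw [norm_real, Real.norm_eq_abs]
      nlinarith [norm_nonneg ζ, abs_nonneg b₁]
    have e2 : ‖(b₂ : ℂ) - ζ‖ ≤ (1 + |b₂|) * (1 + ‖ζ‖) := by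
      refine (norm_sub_le _ _).trans ?_
      rw [norm_real, Real.norm_eq_abs]
      nlinarith [norm_nonneg ζ, abs_nonneg b₂]
    rw [norm_mul, norm_mul, norm_mul]
    calc ‖K‖ * (‖(4 : ℂ)‖ * ‖(b₁ : ℂ) - ζ‖ * ‖(b₂ : ℂ) - ζ‖)
        ≤ ‖K‖ * (4 * ((1 + |b₁|) * (1 + ‖ζ‖)) * ((1 + |b₂|) * (1 + ‖ζ‖))) := by
          gcongr
          simp
      _ = _ := by ring
  have key := integral_fox_eq (γ₁ := γ) (γ₂ := γ + 1) hα hα2 (by linarith) h₁ h₂ hx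
    (P := fun ζ => K * (4 * (b₁ - ζ) * (b₂ - ζ))) (by fun_prop) hP
  unfold superpos
  refine Eq.trans ?_ (key.symm.trans ?_)
  · refine integral_congr_ae (Filter.Eventually.of_forall fun y => ?_)
    beta_reduce
    have hs : (((γ + 1 : ℝ) : ℂ) + y * I) = (γ + y * I) + 1 := by push_cast; ring
    have hre : ((γ : ℂ) + y * I).re = γ := by simp
    set ζ := (γ : ℂ) + y * I
    have e1 := Gamma_sub_shift (b := b₁) (ζ := ζ) (by rwa [hre])
    have e2 := Gamma_sub_shift (b := b₂) (ζ := ζ) (by rwa [hre])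
    rw [hs, foxProfile_arg_cpow hz, foxAmp, foxF, e1, e2, cpow_add ζ 1 (by norm_num), cpow_one,
      show -((α : ℂ) * ζ) - α + 1 = 1 - α * (ζ + 1) by ring,
      show -((α : ℂ) * ζ) - α = -(α * (ζ + 1)) by ring]
    push_cast
    ring
  · refine integral_congr_ae (Filter.Eventually.of_forall fun y => ?_)
    beta_reduce
    rw [fox_euler_polynomial hα, foxAmp_div, foxProfile_arg_cpow hz]
    ring

theorem isEulerSolutionAt_foxProfile {α s μ γ z : ℝ} (K : ℂ) (hα : 0 < α) (hα2 : α < 2)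
    (h₁ : γ < -s / 2) (h₂ : γ < -s / 2 + μ / 2) (hz : 0 < z) :
    IsEulerSolutionAt α (s * (s - μ)) (2 / α * (2 / α - 2 * s + μ)) (4 / α ^ 2)
      (foxProfile α (-s / 2) (-s / 2 + μ / 2) γ K) z := by
  have hγ1 := min_le_left γ 0
  have hγ2 := min_le_right γ 0
  -- This contour is nonpositive, and moving it right by 1 still leaves it at or to the left of γ,
  -- hence left of all poles.
  refine (isEulerSolutionAt_superpos_fox (γ := min γ 0 - 1) K hα hα2 (by linarith) (by linarith)
    (by linarith) hz).congr (R := z + 1) (fun w hw _ => ?_) hz (by linarith)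
  rw [← foxProfile_eq_superpos hw]
  exact (foxProfile_eq K hα hα2 (by linarith) h₁ h₂ hw).symm

/-! ### The Fox solution -/

theorem foxH_eq (α b₁ b₂ γ : ℝ) (z : ℂ) :
    foxH 2 0 ![1] ![α] ![b₁, b₂] ![1, 1] γ z =
      1 / (2 * Real.pi) * ∫ y : ℝ, foxF α b₁ b₂ (γ + y * I) * z ^ ((γ : ℂ) + y * I) := by
  unfold foxH
  simp_rw [foxKernel_eq]
  rw [integral_mul_const]
  have : (Real.pi : ℂ) ≠ 0 := by exact_mod_cast Real.pi_ne_zero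
  field_simp [I_ne_zero]

theorem foxConverges {α b₁ b₂ γ x : ℝ} (hα : 0 < α) (hα2 : α < 2) (h₁ : γ < b₁) (h₂ : γ < b₂)
    (hx : 0 < x) : FoxConverges 2 0 ![1] ![α] ![b₁, b₂] ![1, 1] γ (x : ℂ) := by
  unfold FoxConverges
  simp_rw [foxKernel_eq]
  simpa using integrable_fox (P := fun _ => 1) (N := 0) (D := 1) hα hα2 h₁ h₂ hx
    (differentiable_const 1) (by simp)

theorem foxF_conj (α b₁ b₂ : ℝ) (ζ : ℂ) :
    foxF α b₁ b₂ (starRingEnd ℂ ζ) = starRingEnd ℂ (foxF α b₁ b₂ ζ) := by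
  simp only [foxF, map_mul, map_inv₀, ← Gamma_conj, map_sub, conj_ofReal, map_one]

/-- The parameters are real, so conjugating the integrand amounts to y ↦ -y, which leaves the
integral unchanged. -/
theorem foxH_im {α b₁ b₂ γ x : ℝ} (hx : 0 < x) :
    (foxH 2 0 ![1] ![α] ![b₁, b₂] ![1, 1] γ (x : ℂ)).im = 0 := by
  rw [foxH_eq, ← conj_eq_iff_im, map_mul, ← integral_conj]
  have h1 : starRingEnd ℂ (1 / (2 * Real.pi)) = 1 / (2 * Real.pi) := by
    have := conj_ofReal (1 / (2 * Real.pi))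
    push_cast at this
    exact this
  rw [h1, ← integral_neg_eq_self]
  congr 2
  funext y
  have h2 : (γ : ℂ) + ((-y : ℝ) : ℂ) * I = starRingEnd ℂ (γ + y * I) := by simp
  have h3 : (x : ℂ).arg ≠ Real.pi := by
    rw [arg_ofReal_of_nonneg hx.le]
    exact Real.pi_pos.ne
  rw [h2, foxF_conj, cpow_conj _ _ h3, conj_ofReal, map_mul, conj_conj, conj_conj]

theorem similarity_arg_rpow {α ω t : ℝ} (hα : 0 < α) (hω : 0 < ω) (ht : 0 < t) :
    (ω ^ (-2 / α) * t) ^ α = t ^ α / ω ^ 2 := by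
  rw [Real.mul_rpow (Real.rpow_nonneg hω.le _) ht.le, ← Real.rpow_mul hω.le,
    div_mul_cancel₀ _ hα.ne', Real.rpow_neg hω.le, Real.rpow_two]
  field_simp

theorem foxSol_eq_similarity {α b₁ b₂ s γ c₁ ω t : ℝ} (g : ℝ → ℝ) (hα : 0 < α) (hω : 0 < ω)
    (ht : 0 < t) :
    ((c₁ * ω ^ s / g ω : ℝ) : ℂ) *
        foxH 2 0 ![1] ![α] ![b₁, b₂] ![1, 1] γ ((ω ^ 2 / (4 * t ^ α) : ℝ) : ℂ) =
      similarity α s g (foxProfile α b₁ b₂ γ (c₁ / (2 * Real.pi))) ω t := by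
  have h1 : ω ^ 2 / (4 * t ^ α) = 1 / (4 * (ω ^ (-2 / α) * t) ^ α) := by
    rw [similarity_arg_rpow hα hω ht]
    field_simp
  rw [h1, foxH_eq, similarity, foxProfile, integral_const_mul]
  push_cast
  ring

end

noncomputable section

/-! ### Convergence of the Wright series -/

/-- Log-convexity of Γ: the slope of log Γ on [y-1, y] is log(y-1), and it is at most the slope on
[y, y+ε]. -/
theorem rpow_mul_Gamma_le {y ε : ℝ} (hy : 1 < y) (hε : 0 ≤ ε) :
    (y - 1) ^ ε * Real.Gamma y ≤ Real.Gamma (y + ε) := by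
  rcases hε.eq_or_lt with rfl | hε
  · simp
  have h := Real.convexOn_log_Gamma.slope_mono_adjacent (x := y - 1) (y := y) (z := y + ε)
    (by simpa using hy) (by simp; linarith) (by linarith) (by linarith)
  have hg0 : 0 < Real.Gamma (y - 1) := Real.Gamma_pos_of_pos (by linarith)
  have hg1 : 0 < Real.Gamma y := Real.Gamma_pos_of_pos (by linarith)
  have hg2 : 0 < Real.Gamma (y + ε) := Real.Gamma_pos_of_pos (by linarith)
  have h1 : Real.Gamma y = (y - 1) * Real.Gamma (y - 1) := by
    have := Real.Gamma_add_one (s := y - 1) (by linarith)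
    rwa [sub_add_cancel] at this
  have h2 : Real.log (Real.Gamma y) = Real.log (y - 1) + Real.log (Real.Gamma (y - 1)) := by
    rw [h1, Real.log_mul (by linarith) hg0.ne']
  simp only [Function.comp_apply, h2, sub_sub_cancel, div_one, add_sub_cancel_left,
    add_sub_cancel_right, le_div_iff₀ hε] at h
  rw [← h2] at h
  rw [← Real.log_le_log_iff (mul_pos (Real.rpow_pos_of_pos (by linarith) _) hg1) hg2,
    Real.log_mul (Real.rpow_pos_of_pos (by linarith) _).ne' hg1.ne', Real.log_rpow (by linarith)]
  linarith

/-- The coefficients `Γ(a₁ + j) Γ(a₂ + j) / Γ(b + α j)`. -/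
def wrightCoeff (a₁ a₂ b α : ℝ) (j : ℕ) : ℝ :=
  Real.Gamma (a₁ + j) * Real.Gamma (a₂ + j) / Real.Gamma (b + α * j)

theorem tendsto_affine_div {a b α : ℝ} (hα : α ≠ 0) :
    Filter.Tendsto (fun j : ℕ => (a + j) / (b + α * j)) Filter.atTop (𝓝 (1 / α)) := by
  have h1 : Filter.Tendsto (fun j : ℕ => (j : ℝ)⁻¹) Filter.atTop (𝓝 0) :=
    tendsto_inv_atTop_nhds_zero_nat
  have h2 : Filter.Tendsto (fun j : ℕ => (a * (j : ℝ)⁻¹ + 1) / (b * (j : ℝ)⁻¹ + α)) Filter.atTop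
      (𝓝 ((a * 0 + 1) / (b * 0 + α))) :=
    ((h1.const_mul a).add_const 1).div ((h1.const_mul b).add_const α) (by simpa using hα)
  simp only [mul_zero, zero_add] at h2
  refine h2.congr' ?_
  filter_upwards [Filter.eventually_gt_atTop 0] with j hj
  have hj0 : (j : ℝ) ≠ 0 := by exact_mod_cast hj.ne'
  rw [← mul_div_mul_right (a + j) (b + α * j) (inv_ne_zero hj0)]
  congr 1 <;> field_simp

theorem exists_tendsto_wright_ratio {a₁ a₂ b α x : ℝ} (hα : 2 ≤ α) (h2 : α = 2 → x < 4)
    (N : ℕ) : ∃ L < 1, Filter.Tendsto (fun j : ℕ =>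
      (a₁ + j) / (b + (α - 1) + α * j) * ((a₂ + j) / (b + (α - 2) + α * j)) *
        ((2 + j) / (1 + 1 * j)) ^ N * x * (b + α * j - 1) ^ (-(α - 2))) Filter.atTop (𝓝 L) := by
  have hα0 : α ≠ 0 := by linarith
  have h1 := (((tendsto_affine_div (a := a₁) (b := b + (α - 1)) hα0).mul
    (tendsto_affine_div (a := a₂) (b := b + (α - 2)) hα0)).mul
    ((tendsto_affine_div (a := 2) (b := 1) one_ne_zero).pow N)).mul_const x
  rcases hα.eq_or_lt with rfl | hα2
  · refine ⟨x / 4, by linarith [h2 rfl], ?_⟩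
    have h3 : 1 / 2 * (1 / 2) * (1 / 1) ^ N * x = x / 4 := by
      rw [div_one, one_pow]
      ring
    rw [h3] at h1
    simpa using h1
  · refine ⟨0, zero_lt_one, ?_⟩
    have h3 : Filter.Tendsto (fun j : ℕ => b + α * j - 1) Filter.atTop Filter.atTop := by
      have : Filter.Tendsto (fun j : ℕ => α * (j : ℝ)) Filter.atTop Filter.atTop :=
        tendsto_natCast_atTop_atTop.const_mul_atTop (by linarith)
      refine (Filter.tendsto_atTop_add_const_left _ (b - 1) this).congr fun j => ?_
      ring
    have h4 := h1.mul ((tendsto_rpow_neg_atTop (y := α - 2) (by linarith)).comp h3)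
    rw [mul_zero] at h4
    exact h4

theorem wrightCoeff_succ {a₁ a₂ b α : ℝ} {j : ℕ} (h₁ : a₁ + j ≠ 0) (h₂ : a₂ + j ≠ 0) :
    wrightCoeff a₁ a₂ b α (j + 1) = (a₁ + j) * (a₂ + j) *
      (Real.Gamma (a₁ + j) * Real.Gamma (a₂ + j)) / Real.Gamma (b + α * j + α) := by
  unfold wrightCoeff
  push_cast
  rw [← add_assoc, ← add_assoc, Real.Gamma_add_one h₁, Real.Gamma_add_one h₂,
    show b + α * ((j : ℝ) + 1) = b + α * j + α by ring]
  ring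

/-- Ratio test. The weight (1+j)^N does not affect the limit of the ratio, which is x/4 for α = 2
and 0 for α > 2. -/
theorem summable_wrightCoeff {a₁ a₂ b α x : ℝ} (hα : 2 ≤ α) (hx : 0 < x)
    (h2 : α = 2 → x < 4) (N : ℕ) :
    Summable fun j : ℕ => wrightCoeff a₁ a₂ b α j * (1 + (j : ℝ)) ^ N * x ^ j := by
  obtain ⟨L, hL, hlim⟩ := exists_tendsto_wright_ratio (a₁ := a₁) (a₂ := a₂) (b := b) hα h2 N
  obtain ⟨r, hr1, hr2⟩ := exists_between hL
  refine summable_of_ratio_norm_eventually_le hr2 ?_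
  have hbig : ∀ c : ℝ, ∀ᶠ j : ℕ in Filter.atTop, c < j := fun c =>
    tendsto_natCast_atTop_atTop.eventually_gt_atTop c
  filter_upwards [hlim.eventually_le_const hr1, hbig (-a₁), hbig (-a₂), hbig |b - 1|,
    hbig 0] with j hj h3 h4 h5 h5'
  have p1 : 0 < a₁ + j := by linarith
  have p2 : 0 < a₂ + j := by linarith
  have p3 : 1 < b + α * j := by nlinarith [neg_abs_le (b - 1)]
  set y := b + α * j with hy
  have g1 := Real.Gamma_pos_of_pos p1
  have g2 := Real.Gamma_pos_of_pos p2
  have g3 : 0 < Real.Gamma y := Real.Gamma_pos_of_pos (by linarith)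
  have g4 : 0 < Real.Gamma (y + α) := Real.Gamma_pos_of_pos (by linarith)
  -- Two exact steps of the functional equation leave only the increment α-2 to log-convexity.
  -- Nothing is lost at α = 2, where the sharp constant is needed.
  have hG : Real.Gamma (y + α) = (y + (α - 1)) * (y + (α - 2)) * Real.Gamma (y + (α - 2)) := by
    have e1 := Real.Gamma_add_one (s := y + (α - 2)) (by linarith)
    have e2 := Real.Gamma_add_one (s := y + (α - 1)) (by linarith)
    rw [show y + (α - 2) + 1 = y + (α - 1) by ring] at e1
    rw [show y + (α - 1) + 1 = y + α by ring, e1] at e2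
    rw [e2]
    ring
  have hr := rpow_mul_Gamma_le p3 (ε := α - 2) (by linarith)
  have q1 : 0 < (y - 1) ^ (α - 2) := Real.rpow_pos_of_pos (by linarith) _
  have hinv : Real.Gamma y / Real.Gamma (y + α) ≤
      (y - 1) ^ (-(α - 2)) / ((y + (α - 1)) * (y + (α - 2))) := by
    have q2 : 0 < (y + (α - 1)) * (y + (α - 2)) := mul_pos (by linarith) (by linarith)
    rw [Real.rpow_neg (by linarith), div_le_div_iff₀ g4 q2, hG, inv_mul_eq_div,
      le_div_iff₀ q1]
    calc Real.Gamma y * ((y + (α - 1)) * (y + (α - 2))) * (y - 1) ^ (α - 2)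
        = (y + (α - 1)) * (y + (α - 2)) * ((y - 1) ^ (α - 2) * Real.Gamma y) := by ring
      _ ≤ _ := by gcongr
  have hpos : 0 < wrightCoeff a₁ a₂ b α j := div_pos (mul_pos g1 g2) g3
  have hsucc : wrightCoeff a₁ a₂ b α (j + 1) = (a₁ + j) * (a₂ + j) *
      (Real.Gamma (a₁ + j) * Real.Gamma (a₂ + j)) / Real.Gamma (y + α) :=
    wrightCoeff_succ p1.ne' p2.ne'
  rw [hsucc, Real.norm_of_nonneg (by positivity), Real.norm_of_nonneg (by positivity)]
  have hj' : (a₁ + j) * (a₂ + j) * ((2 + j) / (1 + 1 * j)) ^ N * x *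
      ((y - 1) ^ (-(α - 2)) / ((y + (α - 1)) * (y + (α - 2)))) ≤ r := by
    refine le_trans (le_of_eq ?_) hj
    rw [show b + (α - 1) + α * (j : ℝ) = y + (α - 1) by rw [hy]; ring,
      show b + (α - 2) + α * (j : ℝ) = y + (α - 2) by rw [hy]; ring]
    field_simp
  have hC : wrightCoeff a₁ a₂ b α j * Real.Gamma y =
      Real.Gamma (a₁ + j) * Real.Gamma (a₂ + j) := div_mul_cancel₀ _ g3.ne'
  rw [← hC]
  calc (a₁ + j) * (a₂ + j) * (wrightCoeff a₁ a₂ b α j * Real.Gamma y) / Real.Gamma (y + α) *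
        (1 + ((j + 1 : ℕ) : ℝ)) ^ N * x ^ (j + 1)
      = ((a₁ + j) * (a₂ + j) * ((2 + j) / (1 + 1 * j)) ^ N * x *
        (Real.Gamma y / Real.Gamma (y + α))) *
        (wrightCoeff a₁ a₂ b α j * (1 + (j : ℝ)) ^ N * x ^ j) := by
        push_cast
        rw [one_mul, div_pow, pow_succ x, show 1 + ((j : ℝ) + 1) = 2 + j by ring]
        field_simp
    _ ≤ ((a₁ + j) * (a₂ + j) * ((2 + j) / (1 + 1 * j)) ^ N * x *
        ((y - 1) ^ (-(α - 2)) / ((y + (α - 1)) * (y + (α - 2))))) *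
        (wrightCoeff a₁ a₂ b α j * (1 + (j : ℝ)) ^ N * x ^ j) := by gcongr
    _ ≤ _ := by gcongr

theorem wrightTerm_eq (a₁ a₂ b α x : ℝ) (j : ℕ) :
    wrightTerm ![(a₁ : ℂ), (a₂ : ℂ), 1] ![1, 1, 1] ![(b : ℂ)] ![α] (x : ℂ) j =
      ((wrightCoeff a₁ a₂ b α j * x ^ j : ℝ) : ℂ) := by
  have hf : (j.factorial : ℂ) ≠ 0 := by exact_mod_cast j.factorial_ne_zero
  have h1 : Gamma (1 + (j : ℂ)) = j.factorial := by
    rw [add_comm, Gamma_nat_eq_factorial]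
  unfold wrightTerm wrightCoeff
  simp only [Fin.prod_univ_three, Matrix.cons_val_zero, Matrix.cons_val_one, Matrix.cons_val,
    Fin.prod_univ_one, ofReal_one, one_mul, h1]
  push_cast
  simp only [← Gamma_ofReal]
  push_cast
  field_simp

theorem summable_wrightTerm {a₁ a₂ b α x : ℝ} (hα : 2 ≤ α) (hx : 0 < x) (h2 : α = 2 → x < 4) :
    Summable (wrightTerm ![(a₁ : ℂ), (a₂ : ℂ), 1] ![1, 1, 1] ![(b : ℂ)] ![α] (x : ℂ)) := by
  have h := summable_wrightCoeff (a₁ := a₁) (a₂ := a₂) (b := b) hα hx h2 0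
  simp only [pow_zero, mul_one] at h
  refine (summable_ofReal.2 h).congr fun j => ?_
  exact (wrightTerm_eq ..).symm

theorem wright_eq (a₁ a₂ b α x : ℝ) :
    wright ![(a₁ : ℂ), (a₂ : ℂ), 1] ![1, 1, 1] ![(b : ℂ)] ![α] (x : ℂ) =
      ((∑' j, wrightCoeff a₁ a₂ b α j * x ^ j : ℝ) : ℂ) := by
  unfold wright
  rw [ofReal_tsum]
  exact tsum_congr fun j => wrightTerm_eq ..

/-! ### The profiles of the Wright solutions -/

theorem superpos_count (A p : ℕ → ℂ) (z : ℝ) :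
    superpos Measure.count A p z = ∑' j, A j * (z : ℂ) ^ p j := by
  unfold superpos
  by_cases h : Integrable (fun j => A j * (z : ℂ) ^ p j) Measure.count
  · rw [integral_countable h]
    simp
  -- Without summability, which is absolute in ℂ, both sides default to 0.
  · rw [integral_undef h, tsum_eq_zero_of_not_summable]
    rw [integrable_count_iff] at h
    exact fun hs => h hs.norm

/-- The `k`-th similarity profile `c z^(α - k) ₃Ψ₁[4 z^α | …]`. -/
def wrightProfile (α a₁ a₂ : ℝ) (k : ℕ) (c z : ℝ) : ℂ :=
  ((c * z ^ (α - k) * ∑' j, wrightCoeff a₁ a₂ (1 + α - k) α j * (4 * z ^ α) ^ j : ℝ) : ℂ)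

/-- The numerators of the coefficients in the expansion of `wrightProfile`. -/
def wrightAmp (a₁ a₂ c : ℝ) (j : ℕ) : ℂ :=
  ((c * (Real.Gamma (a₁ + j) * Real.Gamma (a₂ + j)) * 4 ^ j : ℝ) : ℂ)

/-- The exponents in the expansion of `wrightProfile`. -/
def wrightExp (α : ℝ) (k j : ℕ) : ℂ := ((α * (j + 1) - k : ℝ) : ℂ)

theorem wrightAmp_div (α a₁ a₂ c : ℝ) (k j : ℕ) :
    wrightAmp a₁ a₂ c j / Gamma (wrightExp α k j + 1) =
      ((c * wrightCoeff a₁ a₂ (1 + α - k) α j * 4 ^ j : ℝ) : ℂ) := by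
  have h : wrightExp α k j + 1 = ((1 + α - k + α * j : ℝ) : ℂ) := by
    unfold wrightExp
    push_cast
    ring
  rw [h, Gamma_ofReal, wrightAmp, wrightCoeff, ← ofReal_div]
  congr 1
  ring

theorem rpow_wrightExp {α z : ℝ} (hz : 0 < z) (k j : ℕ) :
    z ^ (α * (j + 1) - k) = z ^ (α - k) * (z ^ α) ^ j := by
  rw [← Real.rpow_natCast (z ^ α), ← Real.rpow_mul hz.le, ← Real.rpow_add hz]
  congr 1
  ring

theorem wrightProfile_eq_superpos {α a₁ a₂ c z : ℝ} {k : ℕ} (hz : 0 < z) :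
    wrightProfile α a₁ a₂ k c z = superpos Measure.count
      (fun j => wrightAmp a₁ a₂ c j / Gamma (wrightExp α k j + 1)) (wrightExp α k) z := by
  rw [superpos_count, wrightProfile, ← tsum_mul_left, ofReal_tsum]
  refine tsum_congr fun j => ?_
  rw [wrightAmp_div, wrightExp, ← ofReal_cpow hz.le, rpow_wrightExp hz, ← ofReal_mul, mul_pow]
  congr 1
  ring

theorem superposGood_wright {α a₁ a₂ c R : ℝ} {k : ℕ} (hα : 2 ≤ α) (hR : α = 2 → R ≤ 1) :
    SuperposGood Measure.count (fun j => wrightAmp a₁ a₂ c j / Gamma (wrightExp α k j + 1))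
      (wrightExp α k) R := by
  refine ⟨(measurable_of_countable _).aestronglyMeasurable, measurable_of_countable _,
    fun N z hz hzR => ?_⟩
  rw [integrable_count_iff]
  have hzα : 0 < z ^ α := Real.rpow_pos_of_pos hz α
  have hzk : 0 < z ^ (α - k) := Real.rpow_pos_of_pos hz _
  have h4 : α = 2 → 4 * z ^ α < 4 := by
    rintro rfl
    have hz1 : z < 1 := hzR.trans_le (hR rfl)
    rw [Real.rpow_two]
    nlinarith
  have hs := ((summable_wrightCoeff (a₁ := a₁) (a₂ := a₂) (b := 1 + α - k) hα
    (x := 4 * z ^ α) (by positivity) h4 N).norm).mul_left (|c| * (1 + α + k) ^ N * z ^ (α - k))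
  refine hs.of_nonneg_of_le (fun j => norm_nonneg _) fun j => ?_
  have hp : 1 + ‖wrightExp α k j‖ ≤ (1 + α + k) * (1 + (j : ℝ)) := by
    rw [wrightExp, norm_real, Real.norm_eq_abs]
    have hj : (0 : ℝ) ≤ j := j.cast_nonneg
    have hk : (0 : ℝ) ≤ k := k.cast_nonneg
    have : |α * ((j : ℝ) + 1) - k| ≤ α * (j + 1) + k :=
      abs_le.2 ⟨by nlinarith, by nlinarith⟩
    nlinarith
  have hre : (wrightExp α k j).re = α * (j + 1) - k := ofReal_re _
  rw [hre, rpow_wrightExp hz, Real.norm_of_nonneg (by positivity), wrightAmp_div, norm_real]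
  simp only [norm_mul, norm_pow, Real.norm_eq_abs, abs_of_pos hzα]
  rw [abs_of_pos (show (0 : ℝ) < 4 by norm_num),
    abs_of_nonneg (show (0 : ℝ) ≤ 1 + (j : ℝ) by positivity)]
  calc |c| * |wrightCoeff a₁ a₂ (1 + α - k) α j| * 4 ^ j * (1 + ‖wrightExp α k j‖) ^ N *
        (z ^ (α - k) * (z ^ α) ^ j)
      ≤ |c| * |wrightCoeff a₁ a₂ (1 + α - k) α j| * 4 ^ j *
        ((1 + α + k) * (1 + (j : ℝ))) ^ N * (z ^ (α - k) * (z ^ α) ^ j) := by gcongr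
    _ = _ := by
      rw [mul_pow, mul_pow]
      ring

/-! ### The Euler equation for the Wright profiles -/

theorem wrightAmp_succ {a₁ a₂ c : ℝ} (h₁ : c ≠ 0 → NotGammaPole a₁)
    (h₂ : c ≠ 0 → NotGammaPole a₂) (j : ℕ) :
    wrightAmp a₁ a₂ c (j + 1) = 4 * (a₁ + j) * (a₂ + j) * wrightAmp a₁ a₂ c j := by
  -- A vanishing coefficient makes the recurrence trivial. Otherwise the functional equation of Γ
  -- requires aᵢ+j ≠ 0, which is the exclusion of poles.
  rcases eq_or_ne c 0 with rfl | hc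
  · simp [wrightAmp]
  have e1 : a₁ + j ≠ 0 := fun h => h₁ hc j (by linarith)
  have e2 : a₂ + j ≠ 0 := fun h => h₂ hc j (by linarith)
  unfold wrightAmp
  rw [Nat.cast_succ, ← add_assoc, ← add_assoc, Real.Gamma_add_one e1, Real.Gamma_add_one e2]
  push_cast
  ring

theorem wright_euler_polynomial {α s μ : ℝ} (hα : α ≠ 0) (k j : ℕ) :
    ((s * (s - μ) : ℝ) : ℂ) + ((2 / α * (2 / α - 2 * s + μ) : ℝ) : ℂ) * wrightExp α k j +
      ((4 / α ^ 2 : ℝ) : ℂ) * (wrightExp α k j * (wrightExp α k j - 1)) =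
    4 * (((1 - k / α - s / 2 : ℝ) : ℂ) + j) * (((1 - k / α - s / 2 + μ / 2 : ℝ) : ℂ) + j) := by
  have h3 : (α : ℂ) ≠ 0 := by exact_mod_cast hα
  unfold wrightExp
  push_cast
  field_simp
  ring

theorem isEulerSolutionAt_wrightProfile {α s μ c z : ℝ} {k n : ℕ} (hα : 2 ≤ α)
    (hn : (n : ℝ) - 1 < α) (hk1 : 1 ≤ k) (hkn : k ≤ n)
    (h₁ : c ≠ 0 → NotGammaPole (1 - k / α - s / 2))
    (h₂ : c ≠ 0 → NotGammaPole (1 - k / α - s / 2 + μ / 2)) (hz : 0 < z) (hz1 : α = 2 → z < 1) :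
    IsEulerSolutionAt α (s * (s - μ)) (2 / α * (2 / α - 2 * s + μ)) (4 / α ^ 2)
      (wrightProfile α (1 - k / α - s / 2) (1 - k / α - s / 2 + μ / 2) k c) z := by
  set a₁ := 1 - k / α - s / 2 with ha₁
  set a₂ := 1 - k / α - s / 2 + μ / 2 with ha₂
  -- For α = 2 the series is controlled only on (0,1); for α > 2 any R beyond z works.
  obtain ⟨R, hzR, hR⟩ : ∃ R, z < R ∧ (α = 2 → R ≤ 1) := by
    by_cases h : α = 2
    · exact ⟨1, hz1 h, fun _ => le_rfl⟩
    · exact ⟨z + 1, by linarith, fun h' => absurd h' h⟩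
  have hkn' : (k : ℝ) ≤ n := by exact_mod_cast hkn
  refine IsEulerSolutionAt.congr (h := superpos Measure.count
    (fun j => wrightAmp a₁ a₂ c j / Gamma (wrightExp α k j + 1)) (wrightExp α k)) ?_
    (fun w hw _ => wrightProfile_eq_superpos hw) hz (lt_add_one z)
  -- The smallest exponent α-k, at j = 0, exceeds -1 because k ≤ n < α+1.
  refine (superposGood_wright hα hR).isEulerSolutionAt (p₀ := α - k)
    (measurable_of_countable _).aestronglyMeasurable (by linarith) (fun j => ?_) hz hzR ?_
  · rw [wrightExp, ofReal_re]
    nlinarith [(j.cast_nonneg : (0 : ℝ) ≤ j)]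
  · rw [superpos_count, superpos_count]
    -- The argument is 1-k with k ≥ 1, a pole of Γ. The term z^(-k) therefore vanishes, and the rest
    -- is reindexed by j ↦ j+1.
    have h0 : Gamma (wrightExp α k 0 - α + 1) = 0 := by
      obtain ⟨m, rfl⟩ := Nat.exists_eq_add_of_le hk1
      have : wrightExp α (1 + m) 0 - α + 1 = -(m : ℂ) := by
        unfold wrightExp
        push_cast
        ring
      rw [this, Gamma_neg_nat_eq_zero]
    have hsupp : Function.support (fun j => wrightAmp a₁ a₂ c j / Gamma (wrightExp α k j - α + 1) *
        (z : ℂ) ^ (wrightExp α k j - α)) ⊆ Set.range Nat.succ := by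
      intro j hj
      rcases j with _ | j
      · exact absurd (by simp only [h0, div_zero, zero_mul]) hj
      · exact ⟨j, rfl⟩
    rw [← Nat.succ_injective.tsum_eq hsupp]
    refine tsum_congr fun j => ?_
    have he : wrightExp α k (Nat.succ j) - α = wrightExp α k j := by
      unfold wrightExp
      push_cast
      ring
    rw [he, Nat.succ_eq_add_one, wrightAmp_succ h₁ h₂, wright_euler_polynomial (by linarith)]
    ring

theorem isEulerSolutionAt_sum {ι : Type*} {α k₀ k₁ k₂ z : ℝ} (S : Finset ι) (f : ι → ℝ → ℂ)
    (h : ∀ i ∈ S, IsEulerSolutionAt α k₀ k₁ k₂ (f i) z) :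
    IsEulerSolutionAt α k₀ k₁ k₂ (∑ i ∈ S, f i) z :=
  Finset.sum_induction f (fun φ => IsEulerSolutionAt α k₀ k₁ k₂ φ z) (fun _ _ => .add)
    isEulerSolutionAt_zero h

theorem wrightSol_eq_similarity {α s ω t : ℝ} (a₁ a₂ : ℕ → ℝ) (n : ℕ) (c : ℕ → ℝ) (g : ℝ → ℝ)
    (hα : 0 < α) (hω : 0 < ω) (ht : 0 < t) :
    ((ω ^ (s - 2) * t ^ α / g ω : ℝ) : ℂ) *
        ∑ k ∈ Finset.Icc 1 n, ((c k * ω ^ (2 * k / α) / t ^ k : ℝ) : ℂ) *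
          wright ![(a₁ k : ℂ), (a₂ k : ℂ), 1] ![1, 1, 1] ![((1 + α - k : ℝ) : ℂ)] ![α]
            ((4 * t ^ α / ω ^ 2 : ℝ) : ℂ) =
      similarity α s g (∑ k ∈ Finset.Icc 1 n, wrightProfile α (a₁ k) (a₂ k) k (c k)) ω t := by
  rw [similarity, Finset.sum_apply, Finset.mul_sum, Finset.mul_sum, Finset.sum_div]
  refine Finset.sum_congr rfl fun k _ => ?_
  have h1 : 4 * (ω ^ (-2 / α) * t) ^ α = 4 * t ^ α / ω ^ 2 := by
    rw [similarity_arg_rpow hα hω ht]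
    ring
  -- This accounts for the prefactor ω^(-2) t^α and the powers ω^(2k/α) t^(-k) in the explicit
  -- solution.
  have h2 : (ω ^ (-2 / α) * t) ^ (α - k) = ω ^ (2 * k / α) / ω ^ 2 * (t ^ α / t ^ k) := by
    rw [Real.mul_rpow (Real.rpow_nonneg hω.le _) ht.le, ← Real.rpow_mul hω.le,
      Real.rpow_sub ht, Real.rpow_natCast, ← Real.rpow_two, ← Real.rpow_sub hω]
    congr 2
    field_simp
    ring
  rw [wright_eq, wrightProfile, h1, h2, Real.rpow_sub hω, Real.rpow_two]
  push_cast
  ring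

theorem wrightProfile_im (α a₁ a₂ : ℝ) (k : ℕ) (c z : ℝ) :
    (wrightProfile α a₁ a₂ k c z).im = 0 := ofReal_im _

end

/-! ### The elementary Fox solutions for `α = 1` -/

/-- Mellin inversion of exp(-x), whose Mellin transform is Γ, after the substitution w = b-ζ, which
also reverses the line. -/
theorem integral_Gamma_sub_mul_cpow {b γ x : ℝ} (hγ : γ < b) (hx : 0 < x) :
    (1 / (2 * Real.pi) : ℂ) * ∫ y : ℝ, Gamma (b - (γ + y * I)) * (x : ℂ) ^ ((γ : ℂ) + y * I) =
      ((x ^ b * Real.exp (-x) : ℝ) : ℂ) := by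
  have hσ : 0 < b - γ := sub_pos.2 hγ
  have hx0 : (x : ℂ) ≠ 0 := by exact_mod_cast hx.ne'
  have hmel : ∀ w : ℂ, 0 < w.re → mellin (fun x => (Real.exp (-x) : ℂ)) w = Gamma w := by
    intro w hw
    rw [← GammaIntegral_eq_mellin, Gamma_eq_integral hw]
  have hre : ∀ y : ℝ, (((b - γ : ℝ) : ℂ) + y * I).re = b - γ := fun y => by simp
  have hconv : MellinConvergent (fun x => (Real.exp (-x) : ℂ)) ((b - γ : ℝ) : ℂ) := by
    have := GammaIntegral_convergent (s := ((b - γ : ℝ) : ℂ)) (by simpa using hσ)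
    refine this.congr_fun (fun t _ => ?_) measurableSet_Ioi
    rw [smul_eq_mul, mul_comm]
  have hvert : VerticalIntegrable (mellin fun x => (Real.exp (-x) : ℂ)) (b - γ) := by
    -- Any angle in (0, π/2) suffices; θ = 1 is used.
    obtain ⟨C, _, hC⟩ := exists_norm_Gamma_le (b := b - γ) hσ zero_le_one
      (by linarith [Real.pi_gt_three])
    have h1 : Integrable fun y : ℝ => Gamma (((b - γ : ℝ) : ℂ) + y * I) := by
      refine integrable_vertical (C := C) one_pos (fun z hz => differentiableAt_Gamma z fun m hm => ?_)
        fun y => ?_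
      · have := congrArg re hm
        rw [hz, neg_re, natCast_re] at this
        have : (0 : ℝ) ≤ m := m.cast_nonneg
        linarith
      · have := hC (((b - γ : ℝ) : ℂ) + y * I) (hre y).ge (hre y).le
        simpa using this
    refine h1.congr (Filter.Eventually.of_forall fun y => ?_)
    exact (hmel _ (by rw [hre]; exact hσ)).symm
  have hcont : ContinuousAt (fun x : ℝ => (Real.exp (-x) : ℂ)) x := by fun_prop
  have h := mellinInv_mellin_eq (b - γ) _ hx hconv hvert hcont
  rw [mellinInv, ← integral_neg_eq_self, real_smul, ← integral_const_mul] at h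
  rw [ofReal_mul, ← h, ← integral_const_mul, ← integral_const_mul]
  refine integral_congr_ae (Filter.Eventually.of_forall fun y => ?_)
  beta_reduce
  rw [hmel _ (by rw [hre]; exact hσ), ofReal_cpow hx.le, smul_eq_mul]
  have e1 : ((b - γ : ℝ) : ℂ) + ((-y : ℝ) : ℂ) * I = b - (γ + y * I) := by push_cast; ring
  have e2 : (x : ℂ) ^ ((γ : ℂ) + y * I) = (x : ℂ) ^ (b : ℂ) * (x : ℂ) ^ (-(b - (γ + y * I))) := by
    rw [← cpow_add _ _ hx0]
    congr 1
    ring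
  rw [e1, e2]
  push_cast
  ring

theorem Gamma_sub_mul_inv_Gamma {γ y : ℝ} (h : γ < 1) :
    Gamma (((1 : ℝ) : ℂ) - (γ + y * I)) * (Gamma (1 - ((1 : ℝ) : ℂ) * (γ + y * I)))⁻¹ = 1 := by
  rw [ofReal_one, one_mul]
  refine mul_inv_cancel₀ (Gamma_ne_zero_of_re_pos ?_)
  simpa using h

/-- For α = 1 the factor Γ(1-ζ) cancels the denominator, leaving a single Gamma function. -/
theorem foxH_one_left {b γ x : ℝ} (h₁ : γ < 1) (h₂ : γ < b) (hx : 0 < x) :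
    foxH 2 0 ![1] ![1] ![1, b] ![1, 1] γ (x : ℂ) = ((x ^ b * Real.exp (-x) : ℝ) : ℂ) := by
  rw [foxH_eq, ← integral_Gamma_sub_mul_cpow h₂ hx]
  congr 2
  funext y
  rw [foxF, mul_right_comm (Gamma _) (Gamma _), Gamma_sub_mul_inv_Gamma h₁, one_mul]

theorem foxH_one_right {b γ x : ℝ} (h₁ : γ < b) (h₂ : γ < 1) (hx : 0 < x) :
    foxH 2 0 ![1] ![1] ![b, 1] ![1, 1] γ (x : ℂ) = ((x ^ b * Real.exp (-x) : ℝ) : ℂ) := by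
  rw [foxH_eq, ← integral_Gamma_sub_mul_cpow h₁ hx]
  congr 2
  funext y
  rw [foxF, mul_assoc (Gamma _) (Gamma _), Gamma_sub_mul_inv_Gamma h₂, mul_one]

theorem fox_elementary_prefactor {ω t b : ℝ} (hω : 0 < ω) (ht : 0 < t) :
    (ω ^ 2 / (4 * t ^ (1 : ℝ))) ^ b = ω ^ (2 * b) * 4 ^ (-b) * t ^ (-b) := by
  rw [Real.rpow_one, Real.div_rpow (by positivity) (by positivity),
    Real.mul_rpow (by norm_num) ht.le, ← Real.rpow_natCast ω 2, ← Real.rpow_mul hω.le,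
    Real.rpow_neg (by norm_num), Real.rpow_neg ht.le]
  push_cast
  field_simp

theorem foxSol₁_elementary {μ γ c₁ ω t : ℝ}
    (h : FoxAdmissible 2 0 ![1] ![1] ![-(-2) / 2, -(-2) / 2] ![1, 1] γ) (hω : 0 < ω)
    (ht : 0 < t) :
    foxSol₁ 1 (-2) μ γ c₁ ω t =
      ((c₁ / (4 * (Real.log ω + μ - 2) * t) * Real.exp (-(ω ^ 2 / (4 * t))) : ℝ) : ℂ) := by
  have h1 : γ < 1 := by simpa using h.lt.1
  have hx : 0 < ω ^ 2 / (4 * t ^ (1 : ℝ)) := by rw [Real.rpow_one]; positivity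
  unfold foxSol₁
  rw [show -(-2 : ℝ) / 2 = 1 by norm_num, foxH_one_left h1 h1 hx, fox_elementary_prefactor hω ht,
    ← ofReal_mul]
  congr 1
  rw [Real.rpow_one, mul_one, Real.rpow_neg_one, Real.rpow_neg_one, Real.rpow_neg hω.le]
  unfold den₁
  have := (Real.rpow_pos_of_pos hω 2).ne'
  field_simp

theorem foxSol₂_elementary {μ ν γ c₁ ω t : ℝ}
    (h : FoxAdmissible 2 0 ![1] ![1] ![-(μ - 2) / 2, -(μ - 2) / 2 + μ / 2] ![1, 1] γ)
    (hω : 0 < ω) (ht : 0 < t) :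
    foxSol₂ 1 (μ - 2) μ ν γ c₁ ω t =
      ((4 ^ (μ / 2 - 1) * c₁ * t ^ (μ / 2 - 1) / (ν * ω ^ μ + μ + 1) *
        Real.exp (-(ω ^ 2 / (4 * t))) : ℝ) : ℂ) := by
  have hb : -(μ - 2) / 2 + μ / 2 = 1 := by ring
  rw [hb] at h
  have hx : 0 < ω ^ 2 / (4 * t ^ (1 : ℝ)) := by rw [Real.rpow_one]; positivity
  unfold foxSol₂
  rw [hb, foxH_one_right h.lt.1 h.lt.2 hx, fox_elementary_prefactor hω ht, ← ofReal_mul]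
  congr 1
  rw [show -(-(μ - 2) / 2) = μ / 2 - 1 by ring, show 2 * (-(μ - 2) / 2) = -(μ - 2) by ring,
    Real.rpow_neg hω.le, Real.rpow_one]
  unfold den₂
  have := (Real.rpow_pos_of_pos hω (μ - 2)).ne'
  field_simp

theorem foxSol₂_elementary' {μ ν γ c₁ ω t : ℝ}
    (h : FoxAdmissible 2 0 ![1] ![1] ![-(-2) / 2, -(-2) / 2 + μ / 2] ![1, 1] γ)
    (hω : 0 < ω) (ht : 0 < t) :
    foxSol₂ 1 (-2) μ ν γ c₁ ω t =
      ((4 ^ (-μ / 2 - 1) * c₁ * ω ^ μ * t ^ (-μ / 2 - 1) / (ν * ω ^ μ + μ + 1) *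
        Real.exp (-(ω ^ 2 / (4 * t))) : ℝ) : ℂ) := by
  have hb : -(-2 : ℝ) / 2 = 1 := by norm_num
  rw [hb] at h
  have hx : 0 < ω ^ 2 / (4 * t ^ (1 : ℝ)) := by rw [Real.rpow_one]; positivity
  unfold foxSol₂
  rw [hb, foxH_one_left h.lt.1 h.lt.2 hx, fox_elementary_prefactor hω ht, ← ofReal_mul]
  congr 1
  rw [show -(1 + μ / 2) = -μ / 2 - 1 by ring, show 2 * (1 + μ / 2) = 2 + μ by ring,
    Real.rpow_neg hω.le, Real.rpow_one, Real.rpow_add hω]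
  unfold den₂
  have := (Real.rpow_pos_of_pos hω 2).ne'
  field_simp

/-! ### The hypergeometric form for `α = 2` -/

theorem Gamma_add_nat_eq {a : ℝ} (ha : NotGammaPole a) (j : ℕ) :
    Real.Gamma (a + j) = Real.Gamma a * (ascPochhammer ℝ j).eval a := by
  induction j with
  | zero => simp
  | succ j ih =>
    have h : a + j ≠ 0 := fun h => ha j (by linarith)
    rw [Nat.cast_succ, ← add_assoc, Real.Gamma_add_one h, ih, ascPochhammer_succ_eval]
    ring

/-- The duplication formula at integers, in the form (2j+1)! = 4^j j! (3/2)_j and (2j)! = 4^j j!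
(1/2)_j. It turns Wright coefficients into hypergeometric ones. -/
theorem Gamma_add_two_mul_nat {b c : ℝ} (h : b = 2 ∧ c = 3 / 2 ∨ b = 1 ∧ c = 1 / 2) (j : ℕ) :
    Real.Gamma (b + 2 * j) = 4 ^ j * j.factorial * (ascPochhammer ℝ j).eval c := by
  have hj : ∀ j : ℕ, (0 : ℝ) ≤ j := fun j => j.cast_nonneg
  induction j with
  | zero => rcases h with ⟨rfl, rfl⟩ | ⟨rfl, rfl⟩ <;> simp
  | succ j ih =>
    have hb : 0 < b := by rcases h with ⟨rfl, _⟩ | ⟨rfl, _⟩ <;> norm_num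
    have e1 := Real.Gamma_add_one (s := b + 2 * j) (by linarith [hj j])
    have e2 := Real.Gamma_add_one (s := b + 2 * j + 1) (by linarith [hj j])
    have e3 : b + 2 * ((j + 1 : ℕ) : ℝ) = b + 2 * j + 1 + 1 := by push_cast; ring
    rw [e3, e2, e1, ih, ascPochhammer_succ_eval, Nat.factorial_succ]
    push_cast
    rcases h with ⟨rfl, rfl⟩ | ⟨rfl, rfl⟩ <;> ring

theorem tsum_wrightCoeff_two {a₁ a₂ b c x : ℝ} (h₁ : NotGammaPole a₁) (h₂ : NotGammaPole a₂)
    (h : b = 2 ∧ c = 3 / 2 ∨ b = 1 ∧ c = 1 / 2) :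
    ∑' j, wrightCoeff a₁ a₂ b 2 j * (4 * x) ^ j =
      Real.Gamma a₁ * Real.Gamma a₂ * ordinaryHypergeometric a₁ a₂ c x := by
  rw [ordinaryHypergeometric_eq_tsum]
  beta_reduce
  rw [← tsum_mul_left]
  refine tsum_congr fun j => ?_
  unfold wrightCoeff
  rw [Gamma_add_nat_eq h₁, Gamma_add_nat_eq h₂, Gamma_add_two_mul_nat h, smul_eq_mul, mul_pow]
  have : (4 : ℝ) ^ j ≠ 0 := by positivity
  rw [div_eq_mul_inv, mul_inv, mul_inv]
  field_simp

theorem wright_two {a₁ a₂ b c x K : ℝ} (h₁ : K ≠ 0 → NotGammaPole a₁)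
    (h₂ : K ≠ 0 → NotGammaPole a₂) (h : b = 2 ∧ c = 3 / 2 ∨ b = 1 ∧ c = 1 / 2) :
    (K : ℂ) * wright ![(a₁ : ℂ), (a₂ : ℂ), 1] ![1, 1, 1] ![(b : ℂ)] ![2] ((4 * x : ℝ) : ℂ) =
      ((K * Real.Gamma a₁ * Real.Gamma a₂ * ordinaryHypergeometric a₁ a₂ c x : ℝ) : ℂ) := by
  rcases eq_or_ne K 0 with rfl | hK
  · simp
  rw [wright_eq, tsum_wrightCoeff_two (h₁ hK) (h₂ hK) h, ← ofReal_mul]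
  congr 1
  ring

theorem wright_sum_two {a₁ a₂ : ℕ → ℝ} {s ω t G : ℝ} {c : ℕ → ℝ} (hω : 0 < ω) (ht : 0 < t)
    (h₁ : c 1 ≠ 0 → NotGammaPole (a₁ 1) ∧ NotGammaPole (a₂ 1))
    (h₂ : c 2 ≠ 0 → NotGammaPole (a₁ 2) ∧ NotGammaPole (a₂ 2)) :
    ((ω ^ (s - 2) * t ^ (2 : ℝ) / G : ℝ) : ℂ) *
        ∑ k ∈ Finset.Icc 1 2, ((c k * ω ^ (2 * k / 2 : ℝ) / t ^ k : ℝ) : ℂ) *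
          wright ![(a₁ k : ℂ), (a₂ k : ℂ), 1] ![1, 1, 1] ![((1 + 2 - k : ℝ) : ℂ)] ![2]
            ((4 * t ^ (2 : ℝ) / ω ^ 2 : ℝ) : ℂ) =
      ((c 1 * Real.Gamma (a₁ 1) * Real.Gamma (a₂ 1) * ω ^ (s - 1) * t / G *
          ordinaryHypergeometric (a₁ 1) (a₂ 1) (3 / 2 : ℝ) (t ^ 2 / ω ^ 2) +
        c 2 * Real.Gamma (a₁ 2) * Real.Gamma (a₂ 2) * ω ^ s / G *
          ordinaryHypergeometric (a₁ 2) (a₂ 2) (1 / 2 : ℝ) (t ^ 2 / ω ^ 2) : ℝ) : ℂ) := by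
  have hx : 4 * t ^ (2 : ℝ) / ω ^ 2 = 4 * (t ^ 2 / ω ^ 2) := by
    rw [Real.rpow_two]
    ring
  have hI : Finset.Icc 1 2 = ({1, 2} : Finset ℕ) := by decide
  have k1 := wright_two (a₁ := a₁ 1) (a₂ := a₂ 1) (b := 2) (c := 3 / 2) (K := c 1)
    (x := t ^ 2 / ω ^ 2) (fun h => (h₁ h).1) (fun h => (h₁ h).2) (Or.inl ⟨rfl, rfl⟩)
  have k2 := wright_two (a₁ := a₁ 2) (a₂ := a₂ 2) (b := 1) (c := 1 / 2) (K := c 2)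
    (x := t ^ 2 / ω ^ 2) (fun h => (h₂ h).1) (fun h => (h₂ h).2) (Or.inr ⟨rfl, rfl⟩)
  have e1 : c 1 * ω ^ (2 * ((1 : ℕ) : ℝ) / 2) / t ^ 1 = ω / t * c 1 := by
    rw [Nat.cast_one, mul_one, div_self two_ne_zero, Real.rpow_one]
    ring
  have e2 : c 2 * ω ^ (2 * ((2 : ℕ) : ℝ) / 2) / t ^ 2 = ω ^ 2 / t ^ 2 * c 2 := by
    rw [Nat.cast_ofNat, mul_div_cancel_right₀ _ two_ne_zero, Real.rpow_two]
    ring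
  rw [hI, Finset.sum_pair (by norm_num), hx, e1, e2,
    show (1 : ℝ) + 2 - ((1 : ℕ) : ℝ) = 2 by norm_num,
    show (1 : ℝ) + 2 - ((2 : ℕ) : ℝ) = 1 by norm_num, ofReal_mul (ω / t), mul_assoc ((ω / t : ℝ) : ℂ), k1,
    ofReal_mul (ω ^ 2 / t ^ 2), mul_assoc ((ω ^ 2 / t ^ 2 : ℝ) : ℂ), k2, ← ofReal_mul, ← ofReal_mul, ← ofReal_add,
    ← ofReal_mul]
  congr 1
  rw [Real.rpow_sub hω, Real.rpow_sub hω, Real.rpow_one, Real.rpow_two, Real.rpow_two]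
  field_simp

/-! ### The invariant solutions -/

theorem isInvariantSolutionAt_fox₁ {α s μ γ c₁ ω t : ℝ} (hα : 0 < α) (hα2 : α < 2)
    (h : γ < -s / 2) (hω : 0 < ω) (ht : 0 < t) (h0 : den₁ μ ω ≠ 0) :
    IsInvariantSolutionAt α (coeff₁ μ) (V₁ α s μ) (foxSol₁ α s μ γ c₁) ω t := by
  have hz : 0 < ω ^ (-2 / α) * t := mul_pos (Real.rpow_pos_of_pos hω _) ht
  -- The reduction parameter is 0 here; the variable μ of this statement only enters the denominator
  -- g.
  have hE := isEulerSolutionAt_foxProfile (μ := 0) (c₁ / (2 * Real.pi)) hα hα2 h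
    (by simpa using h) hz
  have him : (foxSol₁ α s μ γ c₁ ω t).im = 0 := by
    unfold foxSol₁
    rw [im_ofReal_mul, foxH_im (by positivity), mul_zero]
  have he := fun y τ (hy : 0 < y) (hτ : 0 < τ) =>
    foxSol_eq_similarity (b₁ := -s / 2) (b₂ := -s / 2 + 0 / 2) (s := s) (γ := γ) (c₁ := c₁)
      (den₁ μ) hα hy hτ
  have he' : ∀ y τ : ℝ, 0 < y → 0 < τ → foxSol₁ α s μ γ c₁ y τ =
      similarity α s (den₁ μ) (foxProfile α (-s / 2) (-s / 2 + 0 / 2) γ (c₁ / (2 * Real.pi)))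
        y τ := by
    intro y τ hy hτ
    rw [← he y τ hy hτ, zero_div, add_zero, foxSol₁]
  refine IsInvariantSolutionAt.congr ⟨?_, (isSolutionAt_similarity₁_iff hα hω ht h0).2 hE,
    isInvariantAt_similarity₁ hω h0 (hE.1.differentiableAt (by simp))⟩ he' hω ht
  rw [← he' ω t hω ht, him]

theorem isInvariantSolutionAt_fox₂ {α s μ ν γ c₁ ω t : ℝ} (hα : 0 < α) (hα2 : α < 2)
    (h₁ : γ < -s / 2) (h₂ : γ < -s / 2 + μ / 2) (hω : 0 < ω) (ht : 0 < t)
    (h0 : den₂ μ ν ω ≠ 0) :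
    IsInvariantSolutionAt α (coeff₂ μ ν) (V₂ α s μ ν) (foxSol₂ α s μ ν γ c₁) ω t := by
  have hz : 0 < ω ^ (-2 / α) * t := mul_pos (Real.rpow_pos_of_pos hω _) ht
  have hE := isEulerSolutionAt_foxProfile (c₁ / (2 * Real.pi)) hα hα2 h₁ h₂ hz
  have him : (foxSol₂ α s μ ν γ c₁ ω t).im = 0 := by
    unfold foxSol₂
    rw [im_ofReal_mul, foxH_im (by positivity), mul_zero]
  have he : ∀ y τ : ℝ, 0 < y → 0 < τ → foxSol₂ α s μ ν γ c₁ y τ =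
      similarity α s (den₂ μ ν) (foxProfile α (-s / 2) (-s / 2 + μ / 2) γ (c₁ / (2 * Real.pi)))
        y τ := fun y τ hy hτ => foxSol_eq_similarity (den₂ μ ν) hα hy hτ
  refine IsInvariantSolutionAt.congr ⟨?_, (isSolutionAt_similarity₂_iff hα hω ht h0).2 hE,
    isInvariantAt_similarity₂ hω h0 (hE.1.differentiableAt (by simp))⟩ he hω ht
  rw [← he ω t hω ht, him]

theorem isEulerSolutionAt_wrightSum {α s μ ω t : ℝ} {n : ℕ} {c : ℕ → ℝ} (hα : 2 ≤ α)
    (hn : (n : ℝ) - 1 < α)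
    (hc : ∀ k ∈ Finset.Icc 1 n, c k ≠ 0 →
      NotGammaPole (1 - k / α - s / 2) ∧ NotGammaPole (1 - k / α - s / 2 + μ / 2))
    (hω : 0 < ω) (ht : 0 < t) (htω : α = 2 → t < ω) :
    IsEulerSolutionAt α (s * (s - μ)) (2 / α * (2 / α - 2 * s + μ)) (4 / α ^ 2)
      (∑ k ∈ Finset.Icc 1 n, wrightProfile α (1 - k / α - s / 2) (1 - k / α - s / 2 + μ / 2) k (c k))
      (ω ^ (-2 / α) * t) := by
  have hz : 0 < ω ^ (-2 / α) * t := mul_pos (Real.rpow_pos_of_pos hω _) ht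
  refine isEulerSolutionAt_sum _ _ fun k hk => isEulerSolutionAt_wrightProfile hα hn
    (Finset.mem_Icc.1 hk).1 (Finset.mem_Icc.1 hk).2 (fun h => (hc k hk h).1)
    (fun h => (hc k hk h).2) hz ?_
  intro h
  -- For α = 2 the similarity variable is z = t/ω, so the condition z < 1 is exactly t < ω.
  have h1 : (-2 : ℝ) / 2 = -1 := by norm_num
  rw [h, h1, Real.rpow_neg_one, inv_mul_lt_iff₀ hω, mul_one]
  exact htω h

theorem similarity_wright_im {α s ω t : ℝ} (a₁ a₂ : ℕ → ℝ) (n : ℕ) (c : ℕ → ℝ) (g : ℝ → ℝ) :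
    (similarity α s g (∑ k ∈ Finset.Icc 1 n, wrightProfile α (a₁ k) (a₂ k) k (c k)) ω t).im =
      0 := by
  rw [similarity_eq, im_ofReal_mul, Finset.sum_apply, im_sum]
  simp only [wrightProfile_im, Finset.sum_const_zero, mul_zero]

theorem isInvariantSolutionAt_wright₁ {α s μ ω t : ℝ} {n : ℕ} {c : ℕ → ℝ} (hα : 2 ≤ α)
    (hn : (n : ℝ) - 1 < α)
    (hc : ∀ k ∈ Finset.Icc 1 n, c k ≠ 0 → NotGammaPole (1 - k / α - s / 2))
    (hω : 0 < ω) (ht : 0 < t) (htω : α = 2 → t < ω) (h0 : den₁ μ ω ≠ 0) :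
    IsInvariantSolutionAt α (coeff₁ μ) (V₁ α s μ) (wrightSol₁ α s μ n c) ω t := by
  have hE := isEulerSolutionAt_wrightSum (μ := 0) hα hn
    (fun k hk h => ⟨hc k hk h, by simpa using hc k hk h⟩) hω ht htω
  simp only [zero_div (2 : ℝ), add_zero] at hE
  refine IsInvariantSolutionAt.congr ⟨?_, (isSolutionAt_similarity₁_iff (by linarith) hω ht
    h0).2 ?_, isInvariantAt_similarity₁ hω h0 (hE.1.differentiableAt (by simp))⟩
    (fun y τ hy hτ => wrightSol_eq_similarity _ _ n c (den₁ μ) (by linarith) hy hτ) hω ht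
  · exact similarity_wright_im ..
  · simpa only [add_zero] using hE

theorem isInvariantSolutionAt_wright₂ {α s μ ν ω t : ℝ} {n : ℕ} {c : ℕ → ℝ} (hα : 2 ≤ α)
    (hn : (n : ℝ) - 1 < α)
    (hc : ∀ k ∈ Finset.Icc 1 n, c k ≠ 0 →
      NotGammaPole (1 - k / α - s / 2) ∧ NotGammaPole (1 - k / α - s / 2 + μ / 2))
    (hω : 0 < ω) (ht : 0 < t) (htω : α = 2 → t < ω) (h0 : den₂ μ ν ω ≠ 0) :
    IsInvariantSolutionAt α (coeff₂ μ ν) (V₂ α s μ ν) (wrightSol₂ α s μ ν n c) ω t := by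
  have hE := isEulerSolutionAt_wrightSum hα hn hc hω ht htω
  exact IsInvariantSolutionAt.congr ⟨similarity_wright_im .., (isSolutionAt_similarity₂_iff
    (by linarith) hω ht h0).2 hE, isInvariantAt_similarity₂ hω h0
      (hE.1.differentiableAt (by simp))⟩
    (fun y τ hy hτ => wrightSol_eq_similarity _ _ n c (den₂ μ ν) (by linarith) hy hτ) hω ht

theorem wright_arg_lt {α ω t : ℝ} (hω : 0 < ω) (ht : 0 < t) (htω : α = 2 → t < ω) (h : α = 2) :
    4 * t ^ α / ω ^ 2 < 4 := by
  have h1 := htω h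
  rw [h, Real.rpow_two, div_lt_iff₀ (by positivity)]
  nlinarith

end FracDiffWave

/-! ### Assembly of the two cases -/

theorem mainTheorem2 :
    -- the logarithmic coefficient and the generator `V₁`
    (∀ s μ : ℝ,
      -- similarity reduction
      (∀ α : ℝ, 0 < α → ∀ φ : ℝ → ℂ, ∀ ω t : ℝ, 0 < ω → 0 < t → den₁ μ ω ≠ 0 →
        (DifferentiableAt ℝ φ (ω ^ (-2 / α) * t) →
          IsInvariantAt (V₁ α s μ) (similarity α s (den₁ μ) φ) ω t) ∧
        (IsSolutionAt α (coeff₁ μ) (similarity α s (den₁ μ) φ) ω t ↔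
          IsEulerSolutionAt α (s ^ 2) (4 / α * (1 / α - s)) (4 / α ^ 2) φ
            (ω ^ (-2 / α) * t))) ∧
      -- `0 < α < 2`
      (∀ α c₁ γ : ℝ, 0 < α → α < 2 →
        FoxAdmissible 2 0 ![1] ![α] ![-s / 2, -s / 2] ![1, 1] γ →
        ∀ ω t : ℝ, 0 < ω → 0 < t → den₁ μ ω ≠ 0 →
          FoxConverges 2 0 ![1] ![α] ![-s / 2, -s / 2] ![1, 1] γ
            ((ω ^ 2 / (4 * t ^ α) : ℝ) : ℂ) ∧
          IsInvariantSolutionAt α (coeff₁ μ) (V₁ α s μ) (foxSol₁ α s μ γ c₁) ω t) ∧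
      -- `α ≥ 2`
      (∀ (α : ℝ) (n : ℕ) (c : ℕ → ℝ), 2 ≤ α → (n : ℝ) - 1 < α → α ≤ n →
        (∀ k ∈ Finset.Icc 1 n, c k ≠ 0 → NotGammaPole (1 - k / α - s / 2)) →
        ∀ ω t : ℝ, 0 < ω → 0 < t → (α = 2 → t < ω) → den₁ μ ω ≠ 0 →
          (∀ k ∈ Finset.Icc 1 n, Summable (wrightTerm
            ![((1 - k / α - s / 2 : ℝ) : ℂ), ((1 - k / α - s / 2 : ℝ) : ℂ), 1] ![1, 1, 1]
            ![((1 + α - k : ℝ) : ℂ)] ![α] ((4 * t ^ α / ω ^ 2 : ℝ) : ℂ))) ∧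
          IsInvariantSolutionAt α (coeff₁ μ) (V₁ α s μ) (wrightSol₁ α s μ n c) ω t) ∧
      -- `α = 1`, `s = -2`
      (∀ c₁ γ : ℝ, s = -2 →
        FoxAdmissible 2 0 ![1] ![1] ![-s / 2, -s / 2] ![1, 1] γ →
        ∀ ω t : ℝ, 0 < ω → 0 < t → den₁ μ ω ≠ 0 →
          foxSol₁ 1 s μ γ c₁ ω t =
            ((c₁ / (4 * (Real.log ω + μ - 2) * t) * Real.exp (-(ω ^ 2 / (4 * t))) : ℝ) : ℂ)) ∧
      -- `α = 2`
      (∀ c : ℕ → ℝ,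
        (c 1 ≠ 0 → NotGammaPole (1 / 2 - s / 2)) → (c 2 ≠ 0 → NotGammaPole (-s / 2)) →
        ∀ ω t : ℝ, 0 < ω → 0 < t → t < ω → den₁ μ ω ≠ 0 →
          wrightSol₁ 2 s μ 2 c ω t =
            ((c 1 * Real.Gamma (1 / 2 - s / 2) ^ 2 * ω ^ (s - 1) * t / (Real.log ω + μ - 2) *
                ordinaryHypergeometric (1 / 2 - s / 2) (1 / 2 - s / 2) (3 / 2 : ℝ)
                  (t ^ 2 / ω ^ 2) +
              c 2 * Real.Gamma (-s / 2) ^ 2 * ω ^ s / (Real.log ω + μ - 2) *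
                ordinaryHypergeometric (-s / 2) (-s / 2) (1 / 2 : ℝ)
                  (t ^ 2 / ω ^ 2) : ℝ) : ℂ))) ∧
    -- the power-type coefficient and the generator `V₂`
    (∀ s μ ν : ℝ, μ ≠ -1 →
      -- similarity reduction
      (∀ α : ℝ, 0 < α → ∀ φ : ℝ → ℂ, ∀ ω t : ℝ, 0 < ω → 0 < t → den₂ μ ν ω ≠ 0 →
        (DifferentiableAt ℝ φ (ω ^ (-2 / α) * t) →
          IsInvariantAt (V₂ α s μ ν) (similarity α s (den₂ μ ν) φ) ω t) ∧
        (IsSolutionAt α (coeff₂ μ ν) (similarity α s (den₂ μ ν) φ) ω t ↔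
          IsEulerSolutionAt α (s * (s - μ)) (2 / α * (2 / α - 2 * s + μ)) (4 / α ^ 2) φ
            (ω ^ (-2 / α) * t))) ∧
      -- `0 < α < 2`
      (∀ α c₁ γ : ℝ, 0 < α → α < 2 →
        FoxAdmissible 2 0 ![1] ![α] ![-s / 2, -s / 2 + μ / 2] ![1, 1] γ →
        ∀ ω t : ℝ, 0 < ω → 0 < t → den₂ μ ν ω ≠ 0 →
          FoxConverges 2 0 ![1] ![α] ![-s / 2, -s / 2 + μ / 2] ![1, 1] γ
            ((ω ^ 2 / (4 * t ^ α) : ℝ) : ℂ) ∧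
          IsInvariantSolutionAt α (coeff₂ μ ν) (V₂ α s μ ν) (foxSol₂ α s μ ν γ c₁) ω t) ∧
      -- `α ≥ 2`
      (∀ (α : ℝ) (n : ℕ) (c : ℕ → ℝ), 2 ≤ α → (n : ℝ) - 1 < α → α ≤ n →
        (∀ k ∈ Finset.Icc 1 n, c k ≠ 0 →
          NotGammaPole (1 - k / α - s / 2) ∧ NotGammaPole (1 - k / α - s / 2 + μ / 2)) →
        ∀ ω t : ℝ, 0 < ω → 0 < t → (α = 2 → t < ω) → den₂ μ ν ω ≠ 0 →
          (∀ k ∈ Finset.Icc 1 n, Summable (wrightTerm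
            ![((1 - k / α - s / 2 : ℝ) : ℂ), ((1 - k / α - s / 2 + μ / 2 : ℝ) : ℂ), 1] ![1, 1, 1]
            ![((1 + α - k : ℝ) : ℂ)] ![α] ((4 * t ^ α / ω ^ 2 : ℝ) : ℂ))) ∧
          IsInvariantSolutionAt α (coeff₂ μ ν) (V₂ α s μ ν) (wrightSol₂ α s μ ν n c) ω t) ∧
      -- `α = 1`, `s = μ - 2`
      (∀ c₁ γ : ℝ, s = μ - 2 →
        FoxAdmissible 2 0 ![1] ![1] ![-s / 2, -s / 2 + μ / 2] ![1, 1] γ →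
        ∀ ω t : ℝ, 0 < ω → 0 < t → den₂ μ ν ω ≠ 0 →
          foxSol₂ 1 s μ ν γ c₁ ω t =
            ((4 ^ (μ / 2 - 1) * c₁ * t ^ (μ / 2 - 1) / (ν * ω ^ μ + μ + 1) *
              Real.exp (-(ω ^ 2 / (4 * t))) : ℝ) : ℂ)) ∧
      -- `α = 1`, `s = -2`
      (∀ c₁ γ : ℝ, s = -2 →
        FoxAdmissible 2 0 ![1] ![1] ![-s / 2, -s / 2 + μ / 2] ![1, 1] γ →
        ∀ ω t : ℝ, 0 < ω → 0 < t → den₂ μ ν ω ≠ 0 →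
          foxSol₂ 1 s μ ν γ c₁ ω t =
            ((4 ^ (-μ / 2 - 1) * c₁ * ω ^ μ * t ^ (-μ / 2 - 1) / (ν * ω ^ μ + μ + 1) *
              Real.exp (-(ω ^ 2 / (4 * t))) : ℝ) : ℂ)) ∧
      -- `α = 2`
      (∀ c : ℕ → ℝ,
        (c 1 ≠ 0 → NotGammaPole (1 / 2 - s / 2) ∧ NotGammaPole (1 / 2 - s / 2 + μ / 2)) →
        (c 2 ≠ 0 → NotGammaPole (-s / 2) ∧ NotGammaPole (-s / 2 + μ / 2)) →
        ∀ ω t : ℝ, 0 < ω → 0 < t → t < ω → den₂ μ ν ω ≠ 0 →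
          wrightSol₂ 2 s μ ν 2 c ω t =
            ((c 1 * Real.Gamma (1 / 2 - s / 2) * Real.Gamma (1 / 2 - s / 2 + μ / 2) *
                ω ^ (s - 1) * t / (ν * ω ^ μ + μ + 1) *
                ordinaryHypergeometric (1 / 2 - s / 2) (1 / 2 - s / 2 + μ / 2) (3 / 2 : ℝ)
                  (t ^ 2 / ω ^ 2) +
              c 2 * Real.Gamma (-s / 2) * Real.Gamma (-s / 2 + μ / 2) *
                ω ^ s / (ν * ω ^ μ + μ + 1) *
                ordinaryHypergeometric (-s / 2) (-s / 2 + μ / 2) (1 / 2 : ℝ)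
                  (t ^ 2 / ω ^ 2) : ℝ) : ℂ))) := by
  refine ⟨fun s μ => ⟨?_, ?_, ?_, ?_, ?_⟩, fun s μ ν _ => ⟨?_, ?_, ?_, ?_, ?_, ?_⟩⟩
  · intro α hα φ ω t hω ht h0
    refine ⟨isInvariantAt_similarity₁ hω h0, ?_⟩
    rw [isSolutionAt_similarity₁_iff hα hω ht h0, sub_zero, ← pow_two, add_zero,
      show 2 / α * (2 / α - 2 * s) = 4 / α * (1 / α - s) by ring]
  · intro α c₁ γ hα hα2 hγ ω t hω ht h0
    exact ⟨foxConverges hα hα2 hγ.lt.1 hγ.lt.2 (by positivity),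
      isInvariantSolutionAt_fox₁ hα hα2 hγ.lt.1 hω ht h0⟩
  · intro α n c hα hn _ hc ω t hω ht htω h0
    exact ⟨fun k _ => by
      simpa only [ofReal_one] using summable_wrightTerm hα (by positivity) (wright_arg_lt hω ht htω),
      isInvariantSolutionAt_wright₁ hα hn hc hω ht htω h0⟩
  · rintro c₁ γ rfl hγ ω t hω ht _
    exact foxSol₁_elementary hγ hω ht
  · intro c hc₁ hc₂ ω t hω ht _ _
    have e1 : 1 - ((1 : ℕ) : ℝ) / 2 - s / 2 = 1 / 2 - s / 2 := by norm_num
    have e2 : 1 - ((2 : ℕ) : ℝ) / 2 - s / 2 = -s / 2 := by norm_num; ring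
    have h := wright_sum_two (a₁ := fun k : ℕ => 1 - (k : ℝ) / 2 - s / 2)
      (a₂ := fun k : ℕ => 1 - (k : ℝ) / 2 - s / 2) (s := s) (G := den₁ μ ω) (c := c) hω ht
      (by simp only [e1]; exact fun h => ⟨hc₁ h, hc₁ h⟩)
      (by simp only [e2]; exact fun h => ⟨hc₂ h, hc₂ h⟩)
    simp only [e1, e2] at h
    refine h.trans ?_
    unfold den₁
    congr 1
    ring
  · intro α hα φ ω t hω ht h0
    exact ⟨isInvariantAt_similarity₂ hω h0, isSolutionAt_similarity₂_iff hα hω ht h0⟩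
  · intro α c₁ γ hα hα2 hγ ω t hω ht h0
    exact ⟨foxConverges hα hα2 hγ.lt.1 hγ.lt.2 (by positivity),
      isInvariantSolutionAt_fox₂ hα hα2 hγ.lt.1 hγ.lt.2 hω ht h0⟩
  · intro α n c hα hn _ hc ω t hω ht htω h0
    exact ⟨fun k _ => summable_wrightTerm hα (by positivity) (wright_arg_lt hω ht htω),
      isInvariantSolutionAt_wright₂ hα hn hc hω ht htω h0⟩
  · rintro c₁ γ rfl hγ ω t hω ht _
    exact foxSol₂_elementary hγ hω ht
  · rintro c₁ γ rfl hγ ω t hω ht _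
    exact foxSol₂_elementary' hγ hω ht
  · intro c hc₁ hc₂ ω t hω ht _ _
    have e1 : 1 - ((1 : ℕ) : ℝ) / 2 - s / 2 = 1 / 2 - s / 2 := by norm_num
    have e2 : 1 - ((2 : ℕ) : ℝ) / 2 - s / 2 = -s / 2 := by norm_num; ring
    have h := wright_sum_two (a₁ := fun k : ℕ => 1 - (k : ℝ) / 2 - s / 2)
      (a₂ := fun k : ℕ => 1 - (k : ℝ) / 2 - s / 2 + μ / 2) (s := s) (G := den₂ μ ν ω) (c := c)
      hω ht (by simp only [e1]; exact hc₁) (by simp only [e2]; exact hc₂)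
    simp only [e1, e2] at h
    exact h
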